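/- For quadratic characters $\varepsilon_1,\varepsilon_2\in\{1,\mathrm{sgn}\}$ of $\mathbb R^\times$ and $s_1,s_2\in\mathbb C$, let $I(\varepsilon_1\boxtimes\varepsilon_2,s_1,s_2)$ be the normalized principal series of $\mathrm{GL}_2(\mathbb R)$: the Fréchet space of smooth functions $f:\mathrm{GL}_2(\mathbb R)\to\mathbb C$ with \[ f\left(\begin{pmatrix} a & x\\ 0& d\end{pmatrix} g\right)=\varepsilon_1(a)\,\varepsilon_2(d)\,|a|^{s_1}|d|^{s_2}\,|a/d|^{1/2} f(g), \] on which $\mathrm{GL}_2(\mathbb R)$ acts by right translation. Let $m\ge 1$ be an integer and suppose $\varepsilon_1(-1)\varepsilon_2(-1)=(-1)^m$. Then $I(\varepsilon_1\boxtimes\varepsilon_2,\frac{m-1}{2},\frac{1-m}{2})$ has a unique irreducible closed subrepresentation $\delta(m)$ (the discrete series if $m\ge 2$, the limit of discrete series if $m=1$). Regard $\mathrm{GL}_1(\mathbb R)=\mathbb R^\times$ as a subgroup of $\mathrm{GL}_2(\mathbb R)$ by $t\mapsto \mathrm{diag}(t,1)$. Then there is a short exact sequence of Fréchet representations of $\mathbb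 R^\times$ \[ 0\to X\to \delta(m)|_{\mathbb R^\times}\to Y\to 0 \] with $X\subset\delta(m)$ closed, such that: (1) $X$ is isomorphic, as a topological representation, to the space $\mathcal S(\mathbb R^\times)$ of Schwartz functions on $\mathbb R^\times$ (the Schwartz functions on $\mathbb R$ all of whose derivatives vanish at $0$) with action $(t.f)(x)=f(xt)$; (2) $Y$ has a decreasing filtration $Y=F_0\supset F_1\supset F_2\supset\cdots$ by invariant closed subspaces such that, for every $l\ge 0$, $F_{2l}/F_{2l+1}$ is the one-dimensional representation $t\mapsto |t|^{\frac m2+l}$ and $F_{2l+1}/F_{2l+2}$ is the one-dimensional representation $t\mapsto \mathrm{sgn}(t)|t|^{\frac m2+l}$; moreover, the canonical map $Y\to\varprojlim_n Y/F_n$ is an isomorphism of topological vector spaces. -/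

import Mathlib

open scoped ContDiff SchwartzMap MatrixGroups UniformConvergence

noncomputable section

namespace DiscreteSeriesFiltration

/-! ### Characters of `ℝˣ` and elements of `GL₂(ℝ)` -/

/-- The value at `t ∈ ℝˣ` of the character `|t|^s`, for `s ∈ ℂ`. -/
def absPow (s : ℂ) (t : ℝˣ) : ℂ := ((|(t : ℝ)| : ℝ) : ℂ) ^ s

/-- The value at `t ∈ ℝˣ` of the sign character. -/
def sgn (t : ℝˣ) : ℂ := ((Real.sign (t : ℝ) : ℝ) : ℂ)

/-- The upper triangular matrix `(a x; 0 d)`, a general element of the Borel subgroup `B`. -/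
def borelElt (a d : ℝˣ) (x : ℝ) : GL (Fin 2) ℝ :=
  Matrix.GeneralLinearGroup.mkOfDetNeZero !![(a : ℝ), x; 0, (d : ℝ)] (by simp)

/-- The element `(cos α, sin α; -sin α, cos α)` of `SO(2)`. -/
def rot (α : ℝ) : GL (Fin 2) ℝ :=
  Matrix.GeneralLinearGroup.mkOfDetNeZero
    !![Real.cos α, Real.sin α; -Real.sin α, Real.cos α]
    (by
      have h := Real.cos_sq_add_sin_sq α
      rw [Matrix.det_fin_two_of]
      nlinarith)

/-- The embedding `GL₁(ℝ) → GL₂(ℝ)`, `t ↦ diag(t, 1)`. -/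
def embGL1 : ℝˣ →* GL (Fin 2) ℝ where
  toFun t := Matrix.GeneralLinearGroup.mkOfDetNeZero !![(t : ℝ), 0; 0, 1] (by simp)
  map_one' := by
    ext i j
    fin_cases i <;> fin_cases j <;> simp [Matrix.GeneralLinearGroup.mkOfDetNeZero]
  map_mul' s t := by
    ext i j
    fin_cases i <;> fin_cases j <;> simp [Matrix.GeneralLinearGroup.mkOfDetNeZero]

/-! ### Principal series -/

/-- The entries of an invertible matrix, as a point of `ℝ^{2 × 2}`. -/
def entries (g : GL (Fin 2) ℝ) : Fin 2 → Fin 2 → ℝ := fun i j => (g : Matrix (Fin 2) (Fin 2) ℝ) i j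

lemma entries_injective : Function.Injective entries := by
  intro g h hgh
  ext i j
  exact congrFun (congrFun hgh i) j

/-- A function on `GL₂(ℝ)` is smooth if it is smooth as a function on the open subset of
invertible matrices in `ℝ^{2 × 2}`. -/
def IsSmooth (f : GL (Fin 2) ℝ → ℂ) : Prop :=
  ContDiffOn ℝ ∞ (Function.extend entries f 0) (Set.range entries)

lemma IsSmooth.add {f g : GL (Fin 2) ℝ → ℂ} (hf : IsSmooth f) (hg : IsSmooth g) :
    IsSmooth (f + g) := by
  refine (ContDiffOn.add hf hg).congr ?_
  rintro _ ⟨x, rfl⟩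
  simp [entries_injective.extend_apply]

lemma IsSmooth.zero : IsSmooth 0 := by
  refine (contDiffOn_const (c := (0 : ℂ))).congr ?_
  rintro _ ⟨x, rfl⟩
  simp [entries_injective.extend_apply]

lemma IsSmooth.const_smul (c : ℂ) {f : GL (Fin 2) ℝ → ℂ} (hf : IsSmooth f) :
    IsSmooth (c • f) := by
  refine (ContDiffOn.const_smul c hf).congr ?_
  rintro _ ⟨x, rfl⟩
  simp [entries_injective.extend_apply]

lemma IsSmooth.comp_mul_right {f : GL (Fin 2) ℝ → ℂ} (hf : IsSmooth f) (g : GL (Fin 2) ℝ) :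
    IsSmooth (fun x => f (x * g)) := by
  have hL : ContDiff ℝ ∞ (fun A : Fin 2 → Fin 2 → ℝ => fun i j => ∑ k, A i k * entries g k j) := by
    fun_prop
  have key : ∀ x, (fun i j => ∑ k, entries x i k * entries g k j) = entries (x * g) := by
    intro x
    funext i j
    simp [entries, Matrix.mul_apply]
  refine (ContDiffOn.comp hf hL.contDiffOn (s := Set.range entries) ?_).congr ?_
  · rintro _ ⟨x, rfl⟩
    exact ⟨x * g, (key x).symm⟩
  · rintro _ ⟨x, rfl⟩
    simp only [Function.comp_apply, key, entries_injective.extend_apply]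

/-- The space of smooth `f : GL₂(ℝ) → ℂ` such that
`f (b g) = ε₁(a) ε₂(d) |a|^{s₁} |d|^{s₂} |a / d|^{1/2} f(g)` for all `b = (a x; 0 d)` in `B`. -/
def principalSeriesSubmodule (ε₁ ε₂ : ℝˣ →* ℤˣ) (s₁ s₂ : ℂ) :
    Submodule ℂ (GL (Fin 2) ℝ → ℂ) where
  carrier := {f | IsSmooth f ∧ ∀ (a d : ℝˣ) (x : ℝ) (g : GL (Fin 2) ℝ),
    f (borelElt a d x * g) =
      ((ε₁ a : ℤ) : ℂ) * ((ε₂ d : ℤ) : ℂ) * absPow s₁ a * absPow s₂ d *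
        absPow (1 / 2) (a / d) * f g}
  add_mem' hf hg := ⟨hf.1.add hg.1, fun a d x g => by
    rw [Pi.add_apply, Pi.add_apply, hf.2, hg.2, mul_add]⟩
  zero_mem' := ⟨IsSmooth.zero, fun a d x g => by simp⟩
  smul_mem' c f hf := ⟨hf.1.const_smul c, fun a d x g => by
    rw [Pi.smul_apply, Pi.smul_apply, hf.2, smul_eq_mul, smul_eq_mul, mul_left_comm]⟩

/-- The normalized (smooth) principal series `I(ε, s₁, s₂)` of `GL₂(ℝ)`, where
`ε = ε₁ ⊠ ε₂` with `ε₁, ε₂` quadratic characters of `ℝˣ`. -/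
def PrincipalSeries (ε₁ ε₂ : ℝˣ →* ℤˣ) (s₁ s₂ : ℂ) : Type :=
  principalSeriesSubmodule ε₁ ε₂ s₁ s₂

section

variable {ε₁ ε₂ : ℝˣ →* ℤˣ} {s₁ s₂ : ℂ}

instance : AddCommGroup (PrincipalSeries ε₁ ε₂ s₁ s₂) :=
  inferInstanceAs (AddCommGroup (principalSeriesSubmodule ε₁ ε₂ s₁ s₂))

instance : Module ℂ (PrincipalSeries ε₁ ε₂ s₁ s₂) :=
  inferInstanceAs (Module ℂ (principalSeriesSubmodule ε₁ ε₂ s₁ s₂))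

/-- The function on `GL₂(ℝ)` underlying an element of the principal series. -/
def PrincipalSeries.toFun (f : PrincipalSeries ε₁ ε₂ s₁ s₂) : GL (Fin 2) ℝ → ℂ :=
  Subtype.val (p := fun f => f ∈ principalSeriesSubmodule ε₁ ε₂ s₁ s₂) f

lemma PrincipalSeries.toFun_mem (f : PrincipalSeries ε₁ ε₂ s₁ s₂) :
    f.toFun ∈ principalSeriesSubmodule ε₁ ε₂ s₁ s₂ :=
  Subtype.prop (p := fun f => f ∈ principalSeriesSubmodule ε₁ ε₂ s₁ s₂) f

lemma PrincipalSeries.toFun_injective :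
    Function.Injective (PrincipalSeries.toFun (ε₁ := ε₁) (ε₂ := ε₂) (s₁ := s₁) (s₂ := s₂)) :=
  Subtype.val_injective

/-- The element of the principal series with a given underlying function. -/
def PrincipalSeries.mk (f : GL (Fin 2) ℝ → ℂ) (hf : f ∈ principalSeriesSubmodule ε₁ ε₂ s₁ s₂) :
    PrincipalSeries ε₁ ε₂ s₁ s₂ :=
  (⟨f, hf⟩ : principalSeriesSubmodule ε₁ ε₂ s₁ s₂)

/-- The `n`-th derivative of the restriction of `f` to `SO(2)`, as an element of the space of
functions with the topology of uniform convergence. -/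
def circleDeriv (f : PrincipalSeries ε₁ ε₂ s₁ s₂) (n : ℕ) : ℝ →ᵤ ℂ :=
  UniformFun.ofFun (iteratedDeriv n (fun α => f.toFun (rot α)))

/-- The Fréchet topology of the principal series. Since `GL₂(ℝ) = B · SO(2)`, restriction to
`SO(2)` identifies the principal series with a closed subspace of `C^∞(SO(2))`, and the topology is
that of uniform convergence of all derivatives on `SO(2)`. -/
instance : TopologicalSpace (PrincipalSeries ε₁ ε₂ s₁ s₂) :=
  TopologicalSpace.induced circleDeriv inferInstance

end

/-- `GL₂(ℝ)` acts on the principal series by right translation, `(g f)(x) = f(x g)`. -/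
def rightTranslation (ε₁ ε₂ : ℝˣ →* ℤˣ) (s₁ s₂ : ℂ) :
    Representation ℂ (GL (Fin 2) ℝ) (PrincipalSeries ε₁ ε₂ s₁ s₂) where
  toFun g :=
    { toFun := fun f => PrincipalSeries.mk (fun x => f.toFun (x * g))
        ⟨f.toFun_mem.1.comp_mul_right g, fun a d y x => by
          simpa only [mul_assoc] using f.toFun_mem.2 a d y (x * g)⟩
      map_add' := fun _ _ => rfl
      map_smul' := fun _ _ => rfl }
  map_one' := by
    ext f
    exact PrincipalSeries.toFun_injective (funext fun x => congrArg f.toFun (mul_one x))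
  map_mul' g h := by
    ext f
    exact PrincipalSeries.toFun_injective
      (funext fun x => congrArg f.toFun (mul_assoc x g h).symm)

/-! ### Topological representation theory -/

/-- A subrepresentation `V` is an irreducible (closed) subrepresentation if it is nonzero, closed,
and contains no closed subrepresentations besides `0` and `V`. -/
structure IsIrreducibleSub {G W : Type*} [Monoid G] [AddCommGroup W] [Module ℂ W]
    [TopologicalSpace W] {ρ : Representation ℂ G W} (V : Subrepresentation ρ) : Prop where
  isClosed : IsClosed (V : Set W)
  ne_bot : V ≠ ⊥
  eq_bot_or_eq : ∀ U : Subrepresentation ρ, IsClosed (U : Set W) → U ≤ V → U = ⊥ ∨ U = V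

section

variable {Y : Type*} [AddCommGroup Y] [Module ℂ Y]

/-- The inverse limit `lim Y / F n` of a decreasing filtration `F` of `Y`. With its topology as a
subspace of the product of the quotients, it is the inverse limit of topological spaces. -/
def inverseLimit (F : ℕ → Submodule ℂ Y) (hF : Antitone F) : Submodule ℂ (∀ n, Y ⧸ F n) where
  carrier := {y | ∀ n, Submodule.factor (hF n.le_succ) (y (n + 1)) = y n}
  add_mem' hx hy n := by rw [Pi.add_apply, Pi.add_apply, map_add, hx n, hy n]
  zero_mem' n := by simp
  smul_mem' c x hx n := by rw [Pi.smul_apply, Pi.smul_apply, map_smul, hx n]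

/-- The canonical map `Y → lim Y / F n`. -/
def toInverseLimit (F : ℕ → Submodule ℂ Y) (hF : Antitone F) : Y →ₗ[ℂ] inverseLimit F hF where
  toFun y := ⟨fun n => (F n).mkQ y, fun n => Submodule.factor_mk (hF n.le_succ) y⟩
  map_add' _ _ := rfl
  map_smul' _ _ := rfl

/-- For subspaces `B ⊆ A` of a representation `σ` of `ℝˣ`, with `A` invariant: the subquotient
`A / B` is isomorphic to the one-dimensional representation given by the character `χ`, that is,
there is a surjective continuous linear map `A → ℂ` with kernel `B` and on which `ℝˣ` acts
through `χ`. -/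
def SubquotientIsoChar [TopologicalSpace Y] (σ : Representation ℂ ℝˣ Y) (A B : Submodule ℂ Y)
    (hA : ∀ t, A ≤ A.comap (σ t)) (χ : ℝˣ → ℂ) : Prop :=
  ∃ φ : A →L[ℂ] ℂ, Function.Surjective φ ∧ φ.ker = B.submoduleOf A ∧
    ∀ (t : ℝˣ) (y : A), φ (σ.subrepresentation A hA t y) = χ t * φ y

end

/-! ### Schwartz functions on `ℝˣ` -/

/-- The space `𝓢(ℝˣ)` of Schwartz functions on `ℝˣ`: Schwartz functions on `ℝ` all of whose
derivatives vanish at `0`, with the topology induced from `𝓢(ℝ)`. -/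
def schwartzUnits : Submodule ℂ 𝓢(ℝ, ℂ) where
  carrier := {f | ∀ n : ℕ, iteratedDeriv n f 0 = 0}
  add_mem' {f g} hf hg n := by
    have := iteratedDeriv_add (n := n) (x := (0 : ℝ)) (f.smooth n).contDiffAt
      (g.smooth n).contDiffAt
    have h2 : (⇑(f + g)) = ⇑f + ⇑g := rfl
    rw [h2, this, hf n, hg n, add_zero]
  zero_mem' n := by
    have h2 : (⇑(0 : 𝓢(ℝ, ℂ))) = fun _ => (0 : ℂ) := rfl
    rw [h2, iteratedDeriv_const]
    simp
  smul_mem' c f hf n := by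
    have h2 : (⇑(c • f)) = c • ⇑f := rfl
    rw [h2, iteratedDeriv_const_smul_field, hf n, smul_zero]

/-- Dilation `x ↦ t x` of the real line. -/
def dilation (t : ℝˣ) : ℝ ≃L[ℝ] ℝ := ContinuousLinearEquiv.smulLeft t

/-- The translation action `(t f)(x) = f(x t)` of `ℝˣ` on `𝓢(ℝˣ)`. -/
def unitsTranslation : Representation ℂ ℝˣ schwartzUnits where
  toFun t := (SchwartzMap.compCLMOfContinuousLinearEquiv ℂ (dilation t)).toLinearMap.restrict
    (p := schwartzUnits) (q := schwartzUnits) (by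
      intro f hf n
      have h := iteratedDeriv_comp_const_smul (n := n) (f.smooth n) (t : ℝ)
      have h' := congrFun h 0
      simp only [mul_zero, hf n, smul_zero] at h'
      exact h')
  map_one' := by
    ext f x
    change f.1 ((1 : ℝˣ) • x) = f.1 x
    rw [one_smul]
  map_mul' s t := by
    ext f x
    change f.1 ((s * t) • x) = f.1 (t • s • x)
    rw [mul_comm, mul_smul]

lemma unitsTranslation_apply (t : ℝˣ) (f : schwartzUnits) (x : ℝ) :
    (unitsTranslation t f).1 x = f.1 (x * t) := by
  change f.1 (t • x) = f.1 (x * t)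
  rw [mul_comm]
  rfl

end DiscreteSeriesFiltration

end

open scoped ContDiff SchwartzMap MatrixGroups UniformConvergence

noncomputable section

namespace DiscreteSeriesFiltration

set_option linter.unusedSectionVars false

section


open Filter Topology Pointwise

/-! ### Complete first countable topological vector spaces -/

/-! Homogeneous model. An element f of the principal series is f(g) = `detChar`(det g) · Φ(bottom
row of g), where `detChar` is t ↦ ε₁(t)|t|^{m/2} and Φ is smooth on the punctured plane with Φ(tv) =
t^{-m}Φ(v) for every nonzero real t; the parity hypothesis is what turns |t|^{-m} with a sign into
t^{-m} (`toFun_eq`, `isHomogeneousPlane`, `ofPlane`). The group acts by linear substitution, up to a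
character of the determinant. If P is a homogeneous polynomial of degree m - 2, then ΦP has degree
-2 and can be integrated relatively invariantly over the projective line
(`exists_densityIntegral_comp`). The common annihilator `delta` of these P is δ(m); for m = 1 it is
everything.

Uniqueness. With (c, d) the coordinates of the plane, the weight vectors (d - ic)^a (d + ic)^{-m-a}
restrict to e^{i(2a+m)α} on the circle. A closed invariant subspace contains the weight components
of its elements, since Fourier projections are limits of Riemann sums of rotations. The
infinitesimal unipotent action moves a to a + 1 unless a = -m and to a - 1 unless a = 0, and
diag(-1, 1) exchanges a and -m - a. Hence every nonzero closed subrepresentation contains all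
weights with a ≥ 0 or a ≤ -m. These are the only weights of `delta`, so `delta` lies in every
nonzero closed subrepresentation (`delta_le`), which gives both irreducibility and uniqueness.

Filtration. The torus diag(t, 1) fixes two points of the projective line. Put F(x) = Φ(1, x) and
G(y) = Φ(y, 1). The l-th Taylor coefficient of G at 0 transforms by ε₁ sgn^l |t|^{m/2+l}, and the
moment of F of order m + l - 1 by the same character times sgn; so each l provides exactly the two
required characters, in an order depending on ε₁ and l. The moment is a principal value, which
exists once the Taylor coefficients of order less than l vanish (`exists_hasMoment`). Combinations
of c^l (d ± ic)^{-m-l} prescribe both coefficients at level l (`exists_hasCoeff_eq`).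

Intersection. If all Taylor coefficients of G vanish, F is a Schwartz function (`exists_schwartz`).
If all moments of F vanish as well, including those of order at most m - 2 that define `delta`, then
the Fourier transform of F is flat at 0. After multiplication by a suitable sign and power of |x|
the torus acts by plain translation, and the intersection is 𝓢(ℝˣ) (`exists_schwartzUnits_equiv`).

Inverse limit. For t ≥ 1 the N-th seminorm of diag(t, 1)v is at most a constant times t^{m/2+N},
whereas the n-th character has absolute value t^{m/2+⌊n/2⌋}. Rescaled dilation keeps the class of v
modulo the next step and, once ⌊n/2⌋ > N, makes the N-th seminorm arbitrarily small. A
Mittag-Leffler argument then lifts compatible families with control (`IsFrechet.exists_lift`,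
`IsFrechet.exists_quotient_filtration`), giving surjectivity and openness together.

Continuity is mostly obtained softly: limits of continuous functionals by Banach–Steinhaus, maps of
spaces by the closed graph theorem. -/

/-- A first countable topological additive group in which every Cauchy sequence converges. -/
structure IsFrechet (E : Type*) [AddCommGroup E] [TopologicalSpace E] : Prop where
  firstCountable : FirstCountableTopology E
  complete : ∀ u : ℕ → E, (∀ U ∈ 𝓝 (0 : E), ∃ N, ∀ m ≥ N, ∀ n ≥ N, u m - u n ∈ U) →
    ∃ x, Tendsto u atTop (𝓝 x)

section Frechet

variable {E : Type*} [AddCommGroup E] [Module ℂ E] [TopologicalSpace E] [IsTopologicalAddGroup E]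

lemma IsFrechet.of_isClosed (hE : IsFrechet E) {V : Submodule ℂ E} (hV : IsClosed (V : Set E)) :
    IsFrechet V where
  firstCountable := by
    have := hE.firstCountable
    exact Topology.IsInducing.subtypeVal.firstCountableTopology
  complete u hu := by
    obtain ⟨x, hx⟩ := hE.complete (fun n => (u n : E)) fun U hU => by
      obtain ⟨N, hN⟩ := hu ((↑) ⁻¹' U) (continuous_subtype_val.continuousAt.preimage_mem_nhds
        (by simpa using hU))
      exact ⟨N, fun m hm n hn => by simpa using hN m hm n hn⟩
    exact ⟨⟨x, hV.mem_of_tendsto hx (Eventually.of_forall fun n => (u n).2)⟩,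
      tendsto_subtype_rng.2 hx⟩

/-- First countability makes the group uniformity countably generated, so sequential completeness is
completeness and Baire's theorem applies. -/
lemma IsFrechet.baireSpace (hE : IsFrechet E) : BaireSpace E := by
  have := hE.firstCountable
  let : UniformSpace E := IsTopologicalAddGroup.rightUniformSpace E
  have : IsUniformAddGroup E := isUniformAddGroup_of_addCommGroup
  have : (uniformity E).IsCountablyGenerated := by
    rw [uniformity_eq_comap_nhds_zero E]
    infer_instance
  have : CompleteSpace E := by
    refine UniformSpace.complete_of_cauchySeq_tendsto fun u hu => hE.complete u fun U hU => ?_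
    have hU' : {p : E × E | p.2 - p.1 ∈ U} ∈ uniformity E := by
      rw [uniformity_eq_comap_nhds_zero E]
      exact ⟨U, hU, fun p hp => hp⟩
    obtain ⟨N, hN⟩ := (cauchySeq_iff.1 hu) _ hU'
    exact ⟨N, fun m hm n hn => hN n hn m hm⟩
  infer_instance

/-- Pointwise limits of continuous linear functionals are continuous (Banach–Steinhaus). -/
lemma IsFrechet.continuous_of_tendsto [ContinuousSMul ℂ E] (hE : IsFrechet E)
    (T : ℕ → E →ₗ[ℂ] ℂ) (hT : ∀ n, Continuous (T n)) (L : E → ℂ)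
    (h : ∀ x, Tendsto (fun n => T n x) atTop (𝓝 (L x))) : Continuous L := by
  let : UniformSpace E := IsTopologicalAddGroup.rightUniformSpace E
  have : IsUniformAddGroup E := isUniformAddGroup_of_addCommGroup
  have := hE.baireSpace
  exact (continuousLinearMapOfTendsto (fun n => (⟨T n, hT n⟩ : E →L[ℂ] ℂ)) (f := L)
    (tendsto_pi_nhds.2 h)).continuous

/-- Partial sums of a sequence which is controlled by a shrinking family of sets. -/
lemma sum_Ico_mem_of_add_subset {U : ℕ → Set E} (hU0 : ∀ n, (0 : E) ∈ U n)
    (hU : ∀ n, U (n + 1) + U (n + 1) ⊆ U n) (d : ℕ → E) (n p : ℕ)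
    (hd : ∀ k ≥ n, d k ∈ U (k + 1)) : ∑ k ∈ Finset.Ico n (n + p), d k ∈ U n := by
  induction p generalizing n with
  | zero => simpa using hU0 n
  | succ p ih =>
    rw [Finset.sum_eq_sum_Ico_succ_bot (by omega)]
    refine hU n (Set.add_mem_add (hd n le_rfl) ?_)
    have := ih (n + 1) fun k hk => hd k (by omega)
    rwa [show n + 1 + p = n + (p + 1) by ring] at this

/-- Convergence of series whose terms are controlled by a shrinking basis of neighbourhoods. -/
lemma IsFrechet.exists_tendsto_of_mem (hE : IsFrechet E) {U : ℕ → Set E}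
    (hb : (𝓝 (0 : E)).HasAntitoneBasis U) (hU : ∀ n, U (n + 1) + U (n + 1) ⊆ U n)
    (w : ℕ → E) (hd : ∀ k, w (k + 1) - w k ∈ U (k + 1)) :
    ∃ x, Tendsto w atTop (𝓝 x) := by
  have hU0 : ∀ n, (0 : E) ∈ U n := fun n => mem_of_mem_nhds (hb.mem n)
  have hsum : ∀ n p, w (n + p) - w n ∈ U n := fun n p => by
    have h1 := sum_Ico_mem_of_add_subset hU0 hU (fun k => w (k + 1) - w k) n p fun k _ => hd k
    rwa [Finset.sum_Ico_sub w (Nat.le_add_right n p)] at h1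
  refine hE.complete w fun S hS => ?_
  have hS' : ∀ᶠ p : E × E in 𝓝 (0, 0), p.1 - p.2 ∈ S := by
    have : Tendsto (fun p : E × E => p.1 - p.2) (𝓝 (0, 0)) (𝓝 0) := by
      have := (continuous_sub (G := E)).tendsto (0, 0)
      simpa using this
    exact this hS
  rw [nhds_prod_eq] at hS'
  obtain ⟨n, -, hn⟩ := (hb.1.prod_self).mem_iff.1 hS'
  refine ⟨n, fun p hp q hq => ?_⟩
  obtain ⟨p, rfl⟩ := Nat.exists_eq_add_of_le hp
  obtain ⟨q, rfl⟩ := Nat.exists_eq_add_of_le hq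
  have := hn (Set.mk_mem_prod (hsum n p) (hsum n q))
  simpa using this

end Frechet

/-! ### The closed graph theorem for complete first countable spaces. -/

section ClosedGraph

variable {E F : Type*} [AddCommGroup E] [Module ℂ E] [TopologicalSpace E]
  [IsTopologicalAddGroup E] [ContinuousSMul ℂ E]
  [AddCommGroup F] [Module ℂ F] [TopologicalSpace F]
  [IsTopologicalAddGroup F] [ContinuousSMul ℂ F]

/-- The Baire half of the closed graph theorem. Since (n + 1)⁻¹ • T x tends to 0, the multiples of
closure (T⁻¹ S') cover E, so this closure has an interior point; subtracting that point gives a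
neighbourhood of 0, which lies in closure (T⁻¹ S) because S' - S' ⊆ S. -/
lemma IsFrechet.closure_preimage_mem_nhds (hE : IsFrechet E) (T : E →ₗ[ℂ] F) {S : Set F}
    (hS : S ∈ 𝓝 (0 : F)) : closure (T ⁻¹' S) ∈ 𝓝 (0 : E) := by
  have := hE.baireSpace
  obtain ⟨S', hS', hS'S⟩ : ∃ S' ∈ 𝓝 (0 : F), ∀ x ∈ S', ∀ y ∈ S', x - y ∈ S := by
    have : Tendsto (fun p : F × F => p.1 - p.2) (𝓝 (0, 0)) (𝓝 0) := by
      have := (continuous_sub (G := F)).tendsto (0, 0)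
      simpa using this
    have h2 := this hS
    rw [nhds_prod_eq] at h2
    obtain ⟨A, hA, hAS⟩ := mem_prod_self_iff.1 h2
    exact ⟨A, hA, fun x hx y hy => hAS (Set.mk_mem_prod hx hy)⟩
  let c : ℕ → ℂ := fun n => (n : ℂ) + 1
  have hc : ∀ n, c n ≠ 0 := fun n => Nat.cast_add_one_ne_zero n
  have hcl : ∀ n, IsClosed (c n • closure (T ⁻¹' S')) := fun n =>
    isClosed_closure.smul_of_ne_zero (hc n)
  have hcov : ⋃ n, c n • closure (T ⁻¹' S') = Set.univ := by
    refine Set.eq_univ_of_forall fun x => Set.mem_iUnion.2 ?_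
    have h1 : Tendsto (fun n : ℕ => (c n)⁻¹ • T x) atTop (𝓝 0) := by
      have : Tendsto (fun n : ℕ => (c n)⁻¹) atTop (𝓝 0) := by
        simpa [c] using tendsto_one_div_add_atTop_nhds_zero_nat (𝕜 := ℂ)
      simpa using this.smul_const (T x)
    obtain ⟨n, hn⟩ := (h1.eventually_mem hS').exists
    refine ⟨n, (Set.mem_smul_set_iff_inv_smul_mem₀ (hc n) _ _).2 (subset_closure ?_)⟩
    simpa using hn
  obtain ⟨n, x, hx⟩ := nonempty_interior_of_iUnion_of_closed hcl hcov
  have h1 : closure (T ⁻¹' S') ∈ 𝓝 ((c n)⁻¹ • x) := by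
    have h2 := mem_interior_iff_mem_nhds.1 hx
    have h3 : Tendsto (fun y : E => c n • y) (𝓝 ((c n)⁻¹ • x)) (𝓝 x) := by
      have := (continuous_const_smul (c n) : Continuous fun y : E => c n • y).tendsto
        ((c n)⁻¹ • x)
      rwa [smul_inv_smul₀ (hc n)] at this
    refine mem_of_superset (h3 h2) fun y hy => ?_
    obtain ⟨z, hz, hzy⟩ := hy
    rwa [← smul_right_injective E (hc n) hzy]
  set y := (c n)⁻¹ • x
  have hy : y ∈ closure (T ⁻¹' S') := mem_of_mem_nhds h1
  have h4 : Tendsto (fun z : E => z + y) (𝓝 0) (𝓝 y) := by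
    have := (continuous_add_const y).tendsto (0 : E)
    rwa [zero_add] at this
  refine mem_of_superset (h4 h1) fun z hz => ?_
  have h5 : (z + y) - y ∈ closure (T ⁻¹' S) :=
    map_mem_closure₂ continuous_sub hz hy fun a ha b hb => by
      change T (a - b) ∈ S
      rw [map_sub]
      exact hS'S _ ha _ hb
  simpa using h5

/-- The closed graph theorem. -/
theorem IsFrechet.continuous_of_closed_graph (hE : IsFrechet E) (hF : IsFrechet F)
    (T : E →ₗ[ℂ] F)
    (hT : ∀ (u : ℕ → E) (x : E) (y : F), Tendsto u atTop (𝓝 x) →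
      Tendsto (fun n => T (u n)) atTop (𝓝 y) → y = T x) : Continuous T := by
  have := hE.firstCountable
  have := hF.firstCountable
  obtain ⟨U, hb, hU⟩ := IsTopologicalAddGroup.exists_antitone_basis_nhds_zero F
  obtain ⟨B, hB, -⟩ := IsTopologicalAddGroup.exists_antitone_basis_nhds_zero E
  have hU0 : ∀ n, (0 : F) ∈ U n := fun n => mem_of_mem_nhds (hb.mem n)
  refine continuous_of_continuousAt_zero T ?_
  rw [ContinuousAt, map_zero]
  -- Only closed S are tested: T x will be reached as a limit of points of S.
  refine (closed_nhds_basis (0 : F)).tendsto_right_iff.2 fun S hS => ?_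
  obtain ⟨N, -, hN⟩ := hb.1.mem_iff.1 hS.1
  refine mem_of_superset (hE.closure_preimage_mem_nhds T (hb.mem (N + 1))) fun x hx => ?_
  -- Replaces z by a remainder z' that is small in E (through `B k`) and lies in the closure for the
  -- next index, while T (z - z') is small. Iterating from x, the remainders `r k` tend to 0 and T x
  -- - T (r k) converges; the closed graph identifies the limit with T x.
  have step : ∀ (k : ℕ) (z : E), z ∈ closure (T ⁻¹' U (N + k + 1)) →
      ∃ z', T (z - z') ∈ U (N + k + 1) ∧ z' ∈ closure (T ⁻¹' U (N + (k + 1) + 1)) ∧ z' ∈ B k := by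
    intro k z hz
    have h1 : closure (T ⁻¹' U (N + (k + 1) + 1)) ∩ B k ∈ 𝓝 (0 : E) :=
      inter_mem (hE.closure_preimage_mem_nhds T (hb.mem _)) (hB.mem k)
    have h2 : Tendsto (fun y : E => z - y) (𝓝 z) (𝓝 0) := by
      have := (continuous_sub_left z).tendsto z
      rwa [sub_self] at this
    obtain ⟨y, hy, hy'⟩ := mem_closure_iff_nhds.1 hz _ (h2 h1)
    exact ⟨z - y, by simpa using hy', hy.1, hy.2⟩
  choose! g hg1 hg2 hg3 using step
  let r : ℕ → E := fun k => Nat.rec x (fun k z => g k z) k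
  have hr : ∀ k, r k ∈ closure (T ⁻¹' U (N + k + 1)) := by
    intro k
    induction k with
    | zero => exact hx
    | succ k ih => exact hg2 k _ ih
  have hrB : Tendsto r atTop (𝓝 0) := by
    rw [← tendsto_add_atTop_iff_nat 1]
    exact hB.tendsto fun k => hg3 k _ (hr k)
  have hd : ∀ k, T (r k) - T (r (k + 1)) ∈ U (N + k + 1) := fun k => by
    rw [← map_sub]
    exact hg1 k _ (hr k)
  let w : ℕ → F := fun k => T x - T (r k)
  have hw : ∀ k, w (k + 1) - w k = T (r k) - T (r (k + 1)) := fun k => by simp [w]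
  have hw0 : w 0 = 0 := by simp [w, r]
  have hUN : ∀ k, U (N + k + 1) ⊆ U (k + 1) := fun k => hb.2 (by omega)
  obtain ⟨y, hy⟩ := hF.exists_tendsto_of_mem hb hU w fun k => hUN k (by rw [hw]; exact hd k)
  have hyT : y = T x := by
    refine hT (fun k => x - r k) x y ?_ ?_
    · simpa using hrB.const_sub x
    · simpa [w] using hy
  have hmem : ∀ k, w k ∈ S := fun k => hN (by
    have h1 := sum_Ico_mem_of_add_subset (U := fun j => U (N + j)) (fun n => hU0 _)
      (fun n => hU (N + n)) (fun k => w (k + 1) - w k) 0 k (fun k _ => by rw [hw]; exact hd k)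
    rwa [zero_add, Finset.sum_Ico_sub w (Nat.zero_le k), hw0, sub_zero] at h1)
  change T x ∈ S
  rw [← hyT]
  exact hS.2.mem_of_tendsto hy (Eventually.of_forall hmem)

/-- A linear bijection with closed graph between complete spaces is a homeomorphism. -/
def IsFrechet.continuousLinearEquiv (hE : IsFrechet E) (hF : IsFrechet F) (e : E ≃ₗ[ℂ] F)
    (he : ∀ (u : ℕ → E) (x : E) (y : F), Tendsto u atTop (𝓝 x) →
      Tendsto (fun n => e (u n)) atTop (𝓝 y) → y = e x) : E ≃L[ℂ] F where
  toLinearEquiv := e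
  continuous_toFun := hE.continuous_of_closed_graph hF e.toLinearMap he
  continuous_invFun := hF.continuous_of_closed_graph hE e.symm.toLinearMap fun u x y hu hy => by
    have := he (fun n => e.symm (u n)) y x hy (by simpa using hu)
    simp [this]

end ClosedGraph

end

section

open Filter Topology Pointwise

/-! ### Filtrations with dense steps -/

section Filtration

variable {W : Type*} [AddCommGroup W] [Module ℂ W] [TopologicalSpace W]
  [IsTopologicalAddGroup W] [ContinuousSMul ℂ W]

lemma sum_Ico_geometric_lt {ε : ℝ} (hε : 0 < ε) (p q : ℕ) :
    ∑ i ∈ Finset.Ico p q, ε / 2 ^ i ≤ 2 * ε / 2 ^ p := by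
  rcases le_total q p with h | h
  · rw [Finset.Ico_eq_empty_of_le h, Finset.sum_empty]
    positivity
  · have key : ∀ k, ∑ i ∈ Finset.Ico p (p + k), ε / 2 ^ i = 2 * ε / 2 ^ p - 2 * ε / 2 ^ (p + k) := by
      intro k
      induction k with
      | zero => simp
      | succ k ih =>
        rw [← add_assoc, Finset.sum_Ico_succ_top (by omega), ih, pow_succ 2 (p + k)]
        field_simp
        ring
    obtain ⟨k, rfl⟩ := Nat.exists_eq_add_of_le h
    rw [key]
    have : 0 < 2 * ε / 2 ^ (p + k) := by positivity
    linarith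

/-- A Mittag-Leffler argument: if `V (n + 1)` is dense in `V n` for finer and finer seminorms,
then a compatible family of classes modulo `V n` which vanishes up to a certain index is induced by
a small vector. -/
lemma IsFrechet.exists_lift (hW : IsFrechet W) (V : ℕ → Submodule ℂ W) (hV : Antitone V)
    (hcl : ∀ n, IsClosed (V n : Set W)) (p : ℕ → Seminorm ℂ W) (hpmono : Monotone p)
    (hpc : ∀ N, Continuous (p N))
    (hp : ∀ U ∈ 𝓝 (0 : W), ∃ N, ∃ ε > 0, ∀ w, p N w < ε → w ∈ U)
    (hsmall : ∀ N, ∃ M, ∀ n ≥ M, ∀ v ∈ V n, ∀ ε > 0,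
      ∃ v' ∈ V n, p N v' < ε ∧ v - v' ∈ V (n + 1)) (N : ℕ) :
    ∃ M, ∀ v : ℕ → W, (∀ n, v (n + 1) - v n ∈ V n) → v M ∈ V M → ∀ ε > 0,
      ∃ w, p N w < ε ∧ ∀ n, w - v n ∈ V n := by
  choose M hM using hsmall
  -- From this index on every correction is controlled in the seminorm `p N`, because both N and `M
  -- N` are at most the current level.
  set M₀ := max N (M N)
  refine ⟨M₀, fun v hv hv0 ε hε => ?_⟩
  -- One correction must be small for all seminorms `p k` admissible at level n. By monotonicity it
  -- is enough to treat the largest admissible index; if there is none, z' = z works.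
  have step : ∀ n (z : W), z ∈ V n → ∃ z', z' ∈ V n ∧ z - z' ∈ V (n + 1) ∧
      ∀ k ≤ n, M k ≤ n → p k z' < ε / 4 / 2 ^ n := by
    intro n z hz
    by_cases hne : ((Finset.range (n + 1)).filter fun k => M k ≤ n).Nonempty
    · set K := ((Finset.range (n + 1)).filter fun k => M k ≤ n).max' hne with hK
      have hKM := Finset.max'_mem _ hne
      rw [← hK, Finset.mem_filter] at hKM
      obtain ⟨z', hz', hpz, hzz⟩ := hM K n hKM.2 z hz (ε / 4 / 2 ^ n) (by positivity)
      refine ⟨z', hz', hzz, fun k hk hMk => lt_of_le_of_lt (hpmono (?_ : k ≤ K) z') hpz⟩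
      exact Finset.le_max' _ _ (by simp [hMk]; omega)
    · refine ⟨z, hz, by simp, fun k hk hMk => absurd ⟨k, ?_⟩ hne⟩
      simp [hMk]; omega
  choose! g hg1 hg2 hg3 using step
  -- successive approximations, at level `M₀ + k`
  let w : ℕ → W := fun k => Nat.rec 0 (fun k z => z + g (M₀ + k) (v (M₀ + k + 1) - z)) k
  have hw0 : w 0 = 0 := rfl
  have hws : ∀ k, w (k + 1) - w k = g (M₀ + k) (v (M₀ + k + 1) - w k) := fun k => by simp [w]
  have hwv : ∀ k, v (M₀ + k) - w k ∈ V (M₀ + k) := by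
    intro k
    induction k with
    | zero => simpa [hw0] using hv0
    | succ k ih =>
      have h1 : v (M₀ + k + 1) - w k ∈ V (M₀ + k) := by
        have := (V (M₀ + k)).add_mem (hv (M₀ + k)) ih
        simpa using this
      have h2 := hg2 _ _ h1
      rw [← hws] at h2
      simpa [← add_assoc] using h2
  have hwv' : ∀ k, v (M₀ + k + 1) - w k ∈ V (M₀ + k) := fun k => by
    have := (V (M₀ + k)).add_mem (hv (M₀ + k)) (hwv k)
    simpa using this
  have hd1 : ∀ k, w (k + 1) - w k ∈ V (M₀ + k) := fun k => by
    rw [hws]; exact hg1 _ _ (hwv' k)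
  have hd2 : ∀ k j, j ≤ M₀ + k → M j ≤ M₀ + k → p j (w (k + 1) - w k) ≤ ε / 4 / 2 ^ k :=
    fun k j h1 h2 => by
      rw [hws]
      refine (hg3 _ _ (hwv' k) j h1 h2).le.trans ?_
      gcongr
      · norm_num
      · omega
  have hdiff : ∀ j a b, j ≤ M₀ + a → M j ≤ M₀ + a → a ≤ b →
      p j (w b - w a) ≤ 2 * (ε / 4) / 2 ^ a := by
    intro j a b h1 h2 hab
    rw [← Finset.sum_Ico_sub w hab]
    refine (Finset.le_sum_of_subadditive (p j) (map_zero _).le (map_add_le_add _) _ _).trans (le_trans (Finset.sum_le_sum fun i hi => ?_)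
      (sum_Ico_geometric_lt (by positivity) a b))
    have := (Finset.mem_Ico.1 hi).1
    exact hd2 i j (by omega) (by omega)
  obtain ⟨x, hx⟩ := hW.complete w fun U hU => by
    obtain ⟨j, η, hη, hj⟩ := hp U hU
    obtain ⟨a, ha⟩ := exists_pow_lt_of_lt_one (show 0 < η / ε by positivity)
      (show (1 / 2 : ℝ) < 1 by norm_num)
    -- Beyond A the geometric tail is below η / 2, and all increments are already controlled by `p
    -- j`.
    set A := max a (max j (M j))
    have hA : 2 * (ε / 4) / 2 ^ A < η / 2 := by
      have h1 : (1 / 2 : ℝ) ^ A ≤ (1 / 2) ^ a :=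
        pow_le_pow_of_le_one (by norm_num) (by norm_num) (le_max_left _ _)
      have h2 : (1 / 2 : ℝ) ^ A < η / ε := h1.trans_lt ha
      rw [lt_div_iff₀ hε] at h2
      have h3 : 2 * (ε / 4) / 2 ^ A = (1 / 2 : ℝ) ^ A * ε / 2 := by
        rw [one_div, inv_pow]; ring
      linarith
    have hjA : j ≤ M₀ + A := by simp only [A]; omega
    have hMA : M j ≤ M₀ + A := by simp only [A]; omega
    refine ⟨A, fun b hb c hc => hj _ ?_⟩
    have e : w b - w c = (w b - w A) - (w c - w A) := by abel
    rw [e]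
    refine (map_sub_le_add (p j) _ _).trans_lt ?_
    have := hdiff j A b hjA hMA hb
    have := hdiff j A c hjA hMA hc
    linarith
  refine ⟨x, ?_, ?_⟩
  · have h1 : ∀ k, p N (w k) ≤ 2 * (ε / 4) / 2 ^ 0 := fun k => by
      have := hdiff N 0 k (by simp [M₀]) (by simp [M₀]) (Nat.zero_le k)
      simpa [hw0] using this
    have h2 : p N x ≤ 2 * (ε / 4) / 2 ^ 0 :=
      le_of_tendsto (((hpc N).tendsto x).comp hx) (Eventually.of_forall h1)
    refine h2.trans_lt ?_
    rw [pow_zero]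
    linarith
  · have hwV : ∀ k j, w (k + j) - w k ∈ V (M₀ + k) := by
      intro k j
      induction j with
      | zero => simp
      | succ j ih =>
        have := (V (M₀ + k)).add_mem (hV (by omega) (hd1 (k + j))) ih
        simpa [← add_assoc] using this
    have hvV : ∀ n k, v (n + k) - v n ∈ V n := by
      intro n k
      induction k with
      | zero => simp
      | succ k ih =>
        have := (V n).add_mem (hV (Nat.le_add_right n k) (hv (n + k))) ih
        simpa [← add_assoc] using this
    intro n
    have h1 : x - w n ∈ V (M₀ + n) := by
      have h2 : Tendsto (fun j => w (n + j) - w n) atTop (𝓝 (x - w n)) := by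
        have h3 : Tendsto (fun j => w (n + j)) atTop (𝓝 x) := by
          simpa [add_comm] using (tendsto_add_atTop_iff_nat n).2 hx
        exact h3.sub_const _
      exact (hcl _).mem_of_tendsto h2 (Eventually.of_forall fun j => hwV n j)
    have h2 : x - v (M₀ + n) ∈ V (M₀ + n) := by
      have := (V (M₀ + n)).sub_mem h1 (hwv n)
      simpa using this
    have h3 := (V n).add_mem (hV (Nat.le_add_left n M₀) h2) (by
      have := hvV n M₀
      rwa [add_comm] at this)
    simpa using h3

/-- Representations of `ℝˣ` with a filtration by characters on which a dilation argument applies: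
the filtration of the quotient by the intersection. -/
theorem IsFrechet.exists_quotient_filtration (hW : IsFrechet W) (σ : Representation ℂ ℝˣ W)
    (V : ℕ → Submodule ℂ W) (hV : Antitone V) (hV0 : V 0 = ⊤)
    (hcl : ∀ n, IsClosed (V n : Set W)) (hinv : ∀ n t, V n ≤ (V n).comap (σ t))
    (χ : ℕ → ℝˣ → ℂ) (hχ : ∀ n t, χ n t ≠ 0)
    (L : ∀ n, V n →ₗ[ℂ] ℂ) (hL : ∀ n, Function.Surjective (L n))
    (hker : ∀ n (v : V n), L n v = 0 ↔ (v : W) ∈ V (n + 1))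
    (heq : ∀ n t (v : V n), L n ⟨σ t v, hinv n t v.2⟩ = χ n t * L n v)
    (p : ℕ → Seminorm ℂ W) (hpmono : Monotone p) (hpc : ∀ N, Continuous (p N))
    (hp : ∀ U ∈ 𝓝 (0 : W), ∃ N, ∃ ε > 0, ∀ w, p N w < ε → w ∈ U)
    (hdil : ∀ N, ∃ M, ∀ n ≥ M, ∀ v : W, ∀ ε > 0, ∃ t, p N ((χ n t)⁻¹ • σ t v) < ε)
    (X : Submodule ℂ W) (hX : X = ⨅ n, V n) (hXinv : ∀ t, X ≤ X.comap (σ t)) :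
    ∃ (F : ℕ → Submodule ℂ (W ⧸ X)) (hF : Antitone F)
      (hFinv : ∀ n t, F n ≤ (F n).comap (Representation.quotient σ X hXinv t)),
      F 0 = ⊤ ∧
      (∀ n, SubquotientIsoChar (Representation.quotient σ X hXinv) (F n) (F (n + 1)) (hFinv n)
        (χ n)) ∧
      IsHomeomorph (toInverseLimit F hF) := by
  have hXV : ∀ n, X ≤ V n := fun n => hX ▸ iInf_le V n
  have hmemF : ∀ n w, X.mkQ w ∈ (V n).map X.mkQ ↔ w ∈ V n := fun n w => by
    rw [← Submodule.mem_comap, Submodule.comap_map_mkQ, sup_of_le_right (hXV n)]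
  have hFanti : Antitone fun n => (V n).map X.mkQ := fun a b hab => Submodule.map_mono (hV hab)
  have hFcl : ∀ n, IsClosed ((V n).map X.mkQ : Set (W ⧸ X)) := fun n => by
    refine (X.isOpenQuotientMap_mkQ.isQuotientMap.isClosed_preimage).1 ?_
    convert hcl n using 1
    ext w
    exact hmemF n w
  have hFinv : ∀ n t, (V n).map X.mkQ ≤
      ((V n).map X.mkQ).comap (Representation.quotient σ X hXinv t) := by
    rintro n t _ ⟨w, hw, rfl⟩
    exact ⟨σ t w, hinv n t hw, rfl⟩
  refine ⟨fun n => (V n).map X.mkQ, hFanti, hFinv, ?_, fun n => ?_, ?_⟩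
  · change (V 0).map X.mkQ = ⊤
    rw [hV0, Submodule.map_top, Submodule.range_mkQ]
  · let A := (V n).map X.mkQ
    have hex : ∀ y : A, ∃ w : V n, X.mkQ (w : W) = y := by
      rintro ⟨_, w, hw, rfl⟩
      exact ⟨⟨w, hw⟩, rfl⟩
    choose s hs using hex
    -- `L n` descends to the quotient: two lifts differ by an element of X, which is contained in V
    -- (n + 1), the kernel of `L n`.
    have hLX : ∀ v w : V n, X.mkQ (v : W) = X.mkQ (w : W) → L n v = L n w := by
      intro v w h
      rw [← sub_eq_zero, ← map_sub, hker]
      refine hXV _ ?_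
      rwa [← sub_eq_zero, ← map_sub, Submodule.mkQ_apply, Submodule.Quotient.mk_eq_zero] at h
    let φ : A →ₗ[ℂ] ℂ :=
      { toFun := fun y => L n (s y)
        map_add' := fun y z => by
          rw [← map_add]
          exact hLX _ _ (by simp only [Submodule.coe_add, map_add, hs])
        map_smul' := fun c y => by
          rw [RingHom.id_apply, ← map_smul]
          exact hLX _ _ (by simp only [Submodule.coe_smul, map_smul, hs]) }
    have hφ : ∀ v : V n, φ ⟨X.mkQ (v : W), (hmemF n _).2 v.2⟩ = L n v := fun v =>
      hLX _ _ (hs _)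
    have hφker : φ.ker = ((V (n + 1)).map X.mkQ).submoduleOf A := by
      ext y
      rw [LinearMap.mem_ker, Submodule.submoduleOf, Submodule.mem_comap, Submodule.subtype_apply,
        ← hs y, hmemF]
      exact hker n (s y)
    -- No continuity of `L n` is assumed: a functional with closed kernel is continuous.
    have hφc : Continuous φ := by
      refine φ.continuous_of_isClosed_ker ?_
      rw [hφker]
      exact (hFcl (n + 1)).preimage continuous_subtype_val
    refine ⟨⟨φ, hφc⟩, fun c => ?_, hφker, fun t y => ?_⟩
    · obtain ⟨v, hv⟩ := hL n c
      exact ⟨_, (hφ v).trans hv⟩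
    · change φ _ = χ n t * φ y
      rw [show φ y = L n (s y) from rfl, ← heq n t (s y), ← hφ]
      congr 1
      ext1
      change Representation.quotient σ X hXinv t y = X.mkQ (σ t (s y))
      rw [← hs y]
      rfl
  -- The vector (χ n t)⁻¹ • σ t v has the same value under `L n` as v, so it represents v modulo V
  -- (n + 1); the dilation hypothesis makes it as small as desired.
  · have hsmall : ∀ N, ∃ M, ∀ n ≥ M, ∀ v ∈ V n, ∀ ε > 0,
        ∃ v' ∈ V n, p N v' < ε ∧ v - v' ∈ V (n + 1) := by
      intro N
      obtain ⟨M, hM⟩ := hdil N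
      refine ⟨M, fun n hn v hv ε hε => ?_⟩
      obtain ⟨t, ht⟩ := hM n hn v ε hε
      have hmem : (χ n t)⁻¹ • σ t v ∈ V n := (V n).smul_mem _ (hinv n t hv)
      refine ⟨_, hmem, ht, ?_⟩
      have h1 := heq n t ⟨v, hv⟩
      have h2 : L n (⟨v, hv⟩ - (χ n t)⁻¹ • ⟨σ t v, hinv n t hv⟩) = 0 := by
        rw [map_sub, map_smul, h1, smul_eq_mul, inv_mul_cancel_left₀ (hχ n t), sub_self]
      exact (hker n _).1 h2
    have hlift := hW.exists_lift V hV hcl p hpmono hpc hp hsmall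
    set F : ℕ → Submodule ℂ (W ⧸ X) := fun n => (V n).map X.mkQ with hF
    have hrep : ∀ y : inverseLimit F hFanti, ∃ v : ℕ → W, (∀ n, (F n).mkQ (X.mkQ (v n)) = y.1 n) ∧
        ∀ n, v (n + 1) - v n ∈ V n := by
      intro y
      choose v hv using fun n => ((F n).mkQ_surjective.comp X.mkQ_surjective) (y.1 n)
      refine ⟨v, hv, fun n => (hmemF n _).1 ?_⟩
      have h1 := y.2 n
      rw [← hv n, ← hv (n + 1)] at h1
      have h2 : (F n).mkQ (X.mkQ (v (n + 1))) = (F n).mkQ (X.mkQ (v n)) := h1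
      rwa [← sub_eq_zero, ← map_sub, ← map_sub, Submodule.mkQ_apply,
        Submodule.Quotient.mk_eq_zero] at h2
    have hlim : ∀ (y : inverseLimit F hFanti) (w : W) (v : ℕ → W),
        (∀ n, (F n).mkQ (X.mkQ (v n)) = y.1 n) → (∀ n, w - v n ∈ V n) →
        toInverseLimit F hFanti (X.mkQ w) = y := by
      intro y w v hv hw
      ext n
      change (F n).mkQ (X.mkQ w) = y.1 n
      rw [← hv n, ← sub_eq_zero, ← map_sub, ← map_sub, Submodule.mkQ_apply,
        Submodule.Quotient.mk_eq_zero]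
      exact (hmemF n _).2 (hw n)
    have hcont : Continuous (toInverseLimit F hFanti) :=
      Continuous.subtype_mk (continuous_pi fun n => (F n).isOpenQuotientMap_mkQ.continuous) _
    have hinj : Function.Injective (toInverseLimit F hFanti) := by
      rw [injective_iff_map_eq_zero]
      intro y hy
      obtain ⟨w, rfl⟩ := X.mkQ_surjective y
      rw [Submodule.mkQ_apply, Submodule.Quotient.mk_eq_zero, hX, Submodule.mem_iInf]
      intro n
      have h1 : (F n).mkQ (X.mkQ w) = 0 := congrFun (congrArg Subtype.val hy) n
      rw [Submodule.mkQ_apply (F n), Submodule.Quotient.mk_eq_zero] at h1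
      exact (hmemF n w).1 h1
    -- lifting of elements whose component of index `M` is small
    have hopen : ∀ U ∈ 𝓝 (0 : W), ∃ M, ∃ S ∈ 𝓝 (0 : W), ∀ y : inverseLimit F hFanti,
        y.1 M ∈ (fun w => (F M).mkQ (X.mkQ w)) '' S →
        ∃ w ∈ U, toInverseLimit F hFanti (X.mkQ w) = y := by
      intro U hU
      obtain ⟨N, ε, hε, hN⟩ := hp U hU
      obtain ⟨M, hM⟩ := hlift N
      have hS : {w | p N w < ε / 2} ∈ 𝓝 (0 : W) :=
        (isOpen_lt (hpc N) continuous_const).mem_nhds (by simpa using half_pos hε)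
      refine ⟨M, _, hS, ?_⟩
      rintro y ⟨u, hu, huy⟩
      obtain ⟨v, hv, hvv⟩ := hrep y
      have h1 : v M - u ∈ V M := (hmemF M _).1 (by
        have h2 : (F M).mkQ (X.mkQ (v M)) = (F M).mkQ (X.mkQ u) := (hv M).trans huy.symm
        rwa [← sub_eq_zero, ← map_sub, ← map_sub, Submodule.mkQ_apply,
          Submodule.Quotient.mk_eq_zero] at h2)
      -- Subtracting the small representative u kills the component of index M, as the lifting
      -- statement requires; u is added back afterwards.
      obtain ⟨w, hw, hwv⟩ := hM (fun n => v n - u) (by simpa using hvv) h1 (ε / 2) (half_pos hε)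
      refine ⟨w + u, hN _ ?_, hlim y _ v hv fun n => ?_⟩
      · have := map_add_le_add (p N) w u
        have : p N u < ε / 2 := hu
        linarith
      · have := hwv n
        rwa [show w + u - v n = w - (v n - u) by abel]
    have hsurj : Function.Surjective (toInverseLimit F hFanti) := by
      intro y
      obtain ⟨M, S, hS, h⟩ := hopen Set.univ univ_mem
      obtain ⟨v, hv, hvv⟩ := hrep y
      let y' : inverseLimit F hFanti := y - toInverseLimit F hFanti (X.mkQ (v M))
      obtain ⟨w, -, hw⟩ := h y' ⟨0, mem_of_mem_nhds hS, by
        change (F M).mkQ (X.mkQ 0) = y.1 M - (F M).mkQ (X.mkQ (v M))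
        rw [hv M, map_zero, map_zero, sub_self]⟩
      exact ⟨X.mkQ (w + v M), by rw [map_add, map_add, hw]; exact sub_add_cancel y _⟩
    refine ⟨hcont, ?_, hinj, hsurj⟩
    have hopen0 : ∀ U ∈ 𝓝 (0 : W ⧸ X), toInverseLimit F hFanti '' U ∈
        𝓝 (0 : inverseLimit F hFanti) := by
      intro U hU
      have hU' : X.mkQ ⁻¹' U ∈ 𝓝 (0 : W) :=
        X.isOpenQuotientMap_mkQ.continuous.continuousAt.preimage_mem_nhds (by simpa using hU)
      obtain ⟨M, S, hS, h⟩ := hopen _ hU'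
      have h1 : (fun w => (F M).mkQ (X.mkQ w)) '' S ∈ 𝓝 (0 : (W ⧸ X) ⧸ F M) := by
        have := ((F M).isOpenQuotientMap_mkQ.comp X.isOpenQuotientMap_mkQ).isOpenMap.image_mem_nhds
          hS
        rwa [Function.comp_apply, map_zero, map_zero] at this
      have h2 : Continuous fun y : inverseLimit F hFanti => y.1 M :=
        (continuous_apply M).comp continuous_subtype_val
      refine mem_of_superset (h2.continuousAt.preimage_mem_nhds (x := 0) h1) fun y hy => ?_
      obtain ⟨w, hw, hwy⟩ := h y hy
      exact ⟨_, hw, hwy⟩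
    refine IsTopologicalAddGroup.isOpenMap_iff_nhds_zero
      (f := (toInverseLimit F hFanti : (W ⧸ X) →ₗ[ℂ] inverseLimit F hFanti)).2 fun S hS => ?_
    exact mem_of_superset (hopen0 _ hS) (Set.image_preimage_subset _ _)

end Filtration

end

section

open Filter Topology

/-! ### Homogeneous functions on the plane -/

/-- A positive real is a square, and squares in ℤˣ are trivial. -/
lemma quadChar_of_pos (ε : ℝˣ →* ℤˣ) {t : ℝˣ} (ht : 0 < (t : ℝ)) : ε t = 1 := by
  have h : t = Units.mk0 (√(t : ℝ)) (Real.sqrt_pos.2 ht).ne' *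
      Units.mk0 (√(t : ℝ)) (Real.sqrt_pos.2 ht).ne' := by
    ext
    simp [Real.mul_self_sqrt ht.le]
  rw [h, map_mul, Int.units_mul_self]

lemma quadChar_of_neg (ε : ℝˣ →* ℤˣ) {t : ℝˣ} (ht : (t : ℝ) < 0) : ε t = ε (-1) := by
  have h : t = -1 * -t := by simp
  rw [h, map_mul, quadChar_of_pos ε (t := -t) (by simpa using ht), mul_one]

/-- The function `t ↦ ε(t) |t|^{m/2}` on the real line. -/
def detChar (m : ℕ) (ε : ℝˣ →* ℤˣ) (t : ℝ) : ℂ :=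
  (if 0 < t then 1 else ((ε (-1) : ℤ) : ℂ)) * ((|t| ^ ((m : ℝ) / 2) : ℝ) : ℂ)

lemma detChar_units (m : ℕ) (ε : ℝˣ →* ℤˣ) (t : ℝˣ) :
    detChar m ε t = ((ε t : ℤ) : ℂ) * absPow ((m : ℂ) / 2) t := by
  have h : ((|(t : ℝ)| ^ ((m : ℝ) / 2) : ℝ) : ℂ) = absPow ((m : ℂ) / 2) t := by
    rw [absPow, Complex.ofReal_cpow (abs_nonneg _)]
    push_cast
    rfl
  rw [detChar, h]
  congr 1
  split_ifs with ht
  · simp [quadChar_of_pos ε ht]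
  · rw [quadChar_of_neg ε (lt_of_le_of_ne (not_lt.1 ht) t.ne_zero)]

@[simp] lemma detChar_one (m : ℕ) (ε : ℝˣ →* ℤˣ) : detChar m ε 1 = 1 := by
  simp [detChar]

lemma detChar_ne_zero (m : ℕ) (ε : ℝˣ →* ℤˣ) {t : ℝ} (ht : t ≠ 0) : detChar m ε t ≠ 0 := by
  refine mul_ne_zero ?_ ?_
  · split_ifs
    · exact one_ne_zero
    · exact_mod_cast (ε (-1)).ne_zero
  · exact_mod_cast (Real.rpow_pos_of_pos (abs_pos.2 ht) _).ne'

lemma contDiffAt_detChar (m : ℕ) (ε : ℝˣ →* ℤˣ) {t : ℝ} (ht : t ≠ 0) :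
    ContDiffAt ℝ ∞ (detChar m ε) t := by
  have h1 : ContDiffAt ℝ ∞ (fun t : ℝ => ((|t| ^ ((m : ℝ) / 2) : ℝ) : ℂ)) t :=
    Complex.ofRealCLM.contDiff.contDiffAt.comp t
      ((contDiffAt_abs ht).rpow_const_of_ne (abs_ne_zero.2 ht))
  rcases lt_or_gt_of_ne ht with h | h
  · refine (contDiffAt_const (c := ((ε (-1) : ℤ) : ℂ))).mul h1 |>.congr_of_eventuallyEq ?_
    filter_upwards [gt_mem_nhds h] with x hx
    simp [detChar, hx.not_gt]
  · refine h1.congr_of_eventuallyEq ?_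
    filter_upwards [lt_mem_nhds h] with x hx
    simp [detChar, hx]

/-- Smooth functions on the punctured plane which are homogeneous of degree `-m`. -/
structure IsHomogeneousPlane (m : ℕ) (Φ : ℝ × ℝ → ℂ) : Prop where
  contDiffOn : ContDiffOn ℝ ∞ Φ {0}ᶜ
  smul : ∀ (t : ℝ) (v : ℝ × ℝ), t ≠ 0 → v ≠ 0 → Φ (t • v) = ((t : ℂ) ^ m)⁻¹ * Φ v

/-- The bottom row of a matrix. -/
def bottomRow (g : GL (Fin 2) ℝ) : ℝ × ℝ := (g 1 0, g 1 1)

lemma bottomRow_ne_zero (g : GL (Fin 2) ℝ) : bottomRow g ≠ 0 := by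
  intro h
  have h0 : g 1 0 = 0 := congrArg Prod.fst h
  have h1 : g 1 1 = 0 := congrArg Prod.snd h
  have := g.det.ne_zero
  rw [Matrix.GeneralLinearGroup.val_det_apply, Matrix.det_fin_two, h0, h1] at this
  simp at this

/-- The entries of the matrix of determinant one with a given bottom row and orthogonal top row. -/
def sectionEntries (v : ℝ × ℝ) : Fin 2 → Fin 2 → ℝ :=
  ![![v.2 / (v.1 ^ 2 + v.2 ^ 2), -v.1 / (v.1 ^ 2 + v.2 ^ 2)], ![v.1, v.2]]

lemma normSq_pos {v : ℝ × ℝ} (hv : v ≠ 0) : 0 < v.1 ^ 2 + v.2 ^ 2 := by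
  by_contra h
  refine hv (Prod.ext ?_ ?_)
  · have : v.1 ^ 2 = 0 := by nlinarith [sq_nonneg v.1, sq_nonneg v.2]
    simpa using this
  · have : v.2 ^ 2 = 0 := by nlinarith [sq_nonneg v.1, sq_nonneg v.2]
    simpa using this

/-- The matrix of determinant one with a given bottom row and orthogonal top row. -/
def sectionGL (v : ℝ × ℝ) (hv : v ≠ 0) : GL (Fin 2) ℝ :=
  Matrix.GeneralLinearGroup.mkOfDetNeZero (Matrix.of (sectionEntries v)) (by
    have := (normSq_pos hv).ne'
    rw [Matrix.det_fin_two]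
    simp only [sectionEntries, Matrix.of_apply, Matrix.cons_val', Matrix.cons_val_zero,
      Matrix.cons_val_one, Matrix.cons_val_fin_one]
    field_simp
    rw [sub_neg_eq_add, add_comm, div_self this]
    exact one_ne_zero)

lemma coe_borelElt (a d : ℝˣ) (x : ℝ) :
    (borelElt a d x : Matrix (Fin 2) (Fin 2) ℝ) = !![(a : ℝ), x; 0, (d : ℝ)] := rfl

lemma coe_sectionGL (v : ℝ × ℝ) (hv : v ≠ 0) :
    (sectionGL v hv : Matrix (Fin 2) (Fin 2) ℝ) = Matrix.of (sectionEntries v) := rfl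

lemma entries_sectionGL (v : ℝ × ℝ) (hv : v ≠ 0) : entries (sectionGL v hv) = sectionEntries v :=
  rfl

lemma bottomRow_sectionGL (v : ℝ × ℝ) (hv : v ≠ 0) : bottomRow (sectionGL v hv) = v := rfl

lemma det_sectionGL (v : ℝ × ℝ) (hv : v ≠ 0) : ((sectionGL v hv).det : ℝ) = 1 := by
  have := (normSq_pos hv).ne'
  rw [Matrix.GeneralLinearGroup.val_det_apply, coe_sectionGL, Matrix.det_fin_two]
  simp only [sectionEntries, Matrix.of_apply, Matrix.cons_val', Matrix.cons_val_zero,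
      Matrix.cons_val_one, Matrix.cons_val_fin_one]
  field_simp
  ring

/-- An Iwasawa-type decomposition. The section has determinant one and orthogonal rows, so the Borel
factor has diagonal (det g, 1), and x is the inner product of the rows of g divided by the squared
length of the bottom one. -/
lemma eq_borelElt_mul_sectionGL (g : GL (Fin 2) ℝ) : ∃ x : ℝ,
    g = borelElt g.det 1 x * sectionGL (bottomRow g) (bottomRow_ne_zero g) := by
  have hq := (normSq_pos (bottomRow_ne_zero g)).ne'
  simp only [bottomRow] at hq
  refine ⟨(g 0 0 * g 1 0 + g 0 1 * g 1 1) / (g 1 0 ^ 2 + g 1 1 ^ 2), ?_⟩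
  have hd : (g.det : ℝ) = g 0 0 * g 1 1 - g 0 1 * g 1 0 := by
    rw [Matrix.GeneralLinearGroup.val_det_apply, Matrix.det_fin_two]
  ext i j
  rw [Units.val_mul, Matrix.mul_apply, Fin.sum_univ_two, coe_borelElt, coe_sectionGL]
  simp only [bottomRow, sectionEntries]
  fin_cases i <;> fin_cases j <;> simp [hd] <;> field_simp <;> ring

lemma rot_eq_sectionGL (α : ℝ) : entries (rot α) = sectionEntries (-Real.sin α, Real.cos α) := by
  have h : (-Real.sin α) ^ 2 + Real.cos α ^ 2 = 1 := by rw [neg_sq, Real.sin_sq_add_cos_sq]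
  funext i j
  simp only [entries, rot, sectionEntries, h]
  fin_cases i <;> fin_cases j <;> simp [Matrix.GeneralLinearGroup.mkOfDetNeZero]

lemma contDiffOn_sectionEntries : ContDiffOn ℝ ∞ sectionEntries {0}ᶜ := by
  have h1 : ∀ v ∈ ({0}ᶜ : Set (ℝ × ℝ)), v.1 ^ 2 + v.2 ^ 2 ≠ 0 := fun v hv => (normSq_pos hv).ne'
  rw [contDiffOn_pi]
  intro i
  rw [contDiffOn_pi]
  intro j
  fin_cases i <;> fin_cases j <;> simp only [sectionEntries, Fin.zero_eta, Fin.mk_one, Matrix.cons_val', Matrix.cons_val_zero, Matrix.cons_val_one, Matrix.cons_val_fin_one]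
  · exact contDiff_snd.contDiffOn.div (by fun_prop) h1
  · exact contDiff_fst.neg.contDiffOn.div (by fun_prop) h1
  · exact contDiff_fst.contDiffOn
  · exact contDiff_snd.contDiffOn

/-- The principal series containing `δ(m)`. -/
abbrev PS (m : ℕ) (ε₁ ε₂ : ℝˣ →* ℤˣ) : Type :=
  PrincipalSeries ε₁ ε₂ (((m : ℂ) - 1) / 2) ((1 - (m : ℂ)) / 2)

variable {m : ℕ} {ε₁ ε₂ : ℝˣ →* ℤˣ}

/-- The homogeneous function on the plane attached to an element of the principal series. -/
def plane (f : PS m ε₁ ε₂) (v : ℝ × ℝ) : ℂ :=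
  Function.extend entries f.toFun 0 (sectionEntries v)

lemma plane_eq (f : PS m ε₁ ε₂) (v : ℝ × ℝ) (hv : v ≠ 0) :
    plane f v = f.toFun (sectionGL v hv) := by
  rw [plane, ← entries_sectionGL v hv, entries_injective.extend_apply]

lemma absPow_one_right (s : ℂ) : absPow s 1 = 1 := by simp [absPow]

lemma absPow_add (s s' : ℂ) (t : ℝˣ) : absPow (s + s') t = absPow s t * absPow s' t := by
  rw [absPow, Complex.cpow_add]
  · rfl
  · simp

/-- In the decomposition above the Borel factor has d = 1 and a = det g, so the inducing character
contributes ε₁(a) |a|^{(m-1)/2} |a|^{1/2}, which is `detChar`. -/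
lemma toFun_eq (f : PS m ε₁ ε₂) (g : GL (Fin 2) ℝ) :
    f.toFun g = detChar m ε₁ g.det * plane f (bottomRow g) := by
  obtain ⟨x, hx⟩ := eq_borelElt_mul_sectionGL g
  rw [plane_eq f _ (bottomRow_ne_zero g)]
  conv_lhs => rw [hx]
  rw [f.toFun_mem.2, detChar_units]
  congr 1
  rw [map_one, absPow_one_right, div_one, mul_assoc _ _ (absPow (1 / 2) _)]
  have : absPow ((m : ℂ) / 2) g.det = absPow (((m : ℂ) - 1) / 2) g.det * absPow (1 / 2) g.det := by
    rw [← absPow_add]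
    congr 1
    ring
  rw [this]
  push_cast
  ring

lemma plane_ext {f f' : PS m ε₁ ε₂} (h : ∀ v ≠ 0, plane f v = plane f' v) : f = f' :=
  PrincipalSeries.toFun_injective (funext fun g => by
    rw [toFun_eq, toFun_eq, h _ (bottomRow_ne_zero g)])

lemma toFun_rot (f : PS m ε₁ ε₂) (α : ℝ) :
    f.toFun (rot α) = plane f (-Real.sin α, Real.cos α) := by
  rw [plane, ← rot_eq_sectionGL, entries_injective.extend_apply]

/-- The value at the origin is the default of `Function.extend`; it lets additivity and homogeneity
in f be stated at every v. -/
lemma plane_zero_right (f : PS m ε₁ ε₂) : plane f 0 = 0 := by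
  refine Function.extend_apply' _ _ _ ?_
  rintro ⟨g, hg⟩
  apply bottomRow_ne_zero g
  have h1 := congrFun (congrFun hg 1) 0
  have h2 := congrFun (congrFun hg 1) 1
  exact Prod.ext h1 h2

lemma plane_add (f f' : PS m ε₁ ε₂) (v : ℝ × ℝ) : plane (f + f') v = plane f v + plane f' v := by
  by_cases hv : v = 0
  · simp [hv, plane_zero_right]
  · rw [plane_eq _ _ hv, plane_eq _ _ hv, plane_eq _ _ hv]
    rfl

lemma plane_smul (c : ℂ) (f : PS m ε₁ ε₂) (v : ℝ × ℝ) : plane (c • f) v = c * plane f v := by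
  by_cases hv : v = 0
  · simp [hv, plane_zero_right]
  · rw [plane_eq _ _ hv, plane_eq _ _ hv]
    rfl

/-- Compatibility of the signs of the inducing characters with `m`. -/
lemma quadChar_mul_eq (hε : ε₁ (-1) * ε₂ (-1) = (-1) ^ m) (t : ℝˣ) :
    (((ε₁ t : ℤ) : ℂ) * ((ε₂ t : ℤ) : ℂ)) * ((|(t : ℝ)| : ℝ) : ℂ) ^ m = (t : ℂ) ^ m := by
  rcases lt_or_gt_of_ne t.ne_zero with h | h
  · rw [quadChar_of_neg ε₁ h, quadChar_of_neg ε₂ h, abs_of_neg h]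
    have h2 : ((ε₁ (-1) : ℤ) : ℂ) * ((ε₂ (-1) : ℤ) : ℂ) = (-1) ^ m := by
      have := congrArg (fun u : ℤˣ => ((u : ℤ) : ℂ)) hε
      simpa using this
    rw [h2, ← mul_pow]
    simp
  · rw [quadChar_of_pos ε₁ h, quadChar_of_pos ε₂ h, abs_of_pos h]
    simp

/-- Scaling the bottom row by t multiplies the section by diag(t⁻¹, t). The exponents of |t| add up
to -(m-1)/2 + (1-m)/2 - 1 = -m, and the parity hypothesis turns the sign ε₁ε₂(t) together with
|t|^{-m} into t^{-m}. -/
lemma isHomogeneousPlane (hε : ε₁ (-1) * ε₂ (-1) = (-1) ^ m) (f : PS m ε₁ ε₂) :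
    IsHomogeneousPlane m (plane f) where
  contDiffOn := f.toFun_mem.1.comp contDiffOn_sectionEntries fun v hv =>
    ⟨sectionGL v hv, entries_sectionGL v hv⟩
  smul t v ht hv := by
    have htv : t • v ≠ 0 := smul_ne_zero ht hv
    let u : ℝˣ := Units.mk0 t ht
    have hg : sectionGL (t • v) htv = borelElt u⁻¹ u 0 * sectionGL v hv := by
      have hq := (normSq_pos hv).ne'
      have hq' := (normSq_pos htv).ne'
      simp only [Prod.smul_fst, Prod.smul_snd, smul_eq_mul] at hq'
      ext i j
      rw [Units.val_mul, Matrix.mul_apply, Fin.sum_univ_two, coe_borelElt, coe_sectionGL,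
        coe_sectionGL]
      simp only [sectionEntries]
      fin_cases i <;> fin_cases j <;> simp [u] <;> field_simp
    rw [plane_eq f _ htv, plane_eq f _ hv, hg, f.toFun_mem.2]
    congr 1
    have key := quadChar_mul_eq hε u
    have hm : absPow (((m : ℂ) - 1) / 2) u⁻¹ * absPow ((1 - (m : ℂ)) / 2) u *
        absPow (1 / 2) (u⁻¹ / u) = (((|t| : ℝ) : ℂ) ^ m)⁻¹ := by
      have hu : ((|(u⁻¹ : ℝˣ)| : ℝ) : ℂ) = ((|t| : ℝ) : ℂ)⁻¹ := by simp [u]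
      have h0 : ((|t| : ℝ) : ℂ) ≠ 0 := by simpa using ht
      have hinv : ∀ s : ℂ, absPow s u⁻¹ = absPow (-s) u := by
        intro s
        have e1 : absPow s u⁻¹ * absPow s u = 1 := by
          rw [absPow, absPow, ← Complex.mul_cpow_ofReal_nonneg (abs_nonneg _) (abs_nonneg _), hu]
          rw [show ((|(u : ℝ)| : ℝ) : ℂ) = ((|t| : ℝ) : ℂ) from rfl, inv_mul_cancel₀ h0,
            Complex.one_cpow]
        have e2 : absPow (-s) u * absPow s u = 1 := by
          rw [← absPow_add, neg_add_cancel, absPow, Complex.cpow_zero]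
        have e3 : absPow s u ≠ 0 := right_ne_zero_of_mul_eq_one e2
        exact mul_right_cancel₀ e3 (e1.trans e2.symm)
      have hdiv : absPow (1 / 2) (u⁻¹ / u) = absPow (-1 / 2) u * absPow (-1 / 2) u := by
        rw [div_eq_mul_inv u⁻¹ u, absPow, Units.val_mul, abs_mul, Complex.ofReal_mul,
          Complex.mul_cpow_ofReal_nonneg (abs_nonneg _) (abs_nonneg _)]
        have := hinv (1 / 2)
        rw [absPow] at this
        rw [this, ← neg_div]
      rw [hinv, hdiv, ← absPow_add, ← absPow_add, ← absPow_add]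
      rw [show -(((m : ℂ) - 1) / 2) + (1 - (m : ℂ)) / 2 + (-1 / 2 + -1 / 2) = -(m : ℂ) by ring]
      rw [absPow, Complex.cpow_neg, Complex.cpow_natCast]
      rfl
    have ht0 : ((|t| : ℝ) : ℂ) ^ m ≠ 0 := pow_ne_zero _ (by simpa using ht)
    have ht1 : (t : ℂ) ^ m ≠ 0 := pow_ne_zero _ (by simpa using ht)
    have hε' : ((ε₁ u⁻¹ : ℤ) : ℂ) = ((ε₁ u : ℤ) : ℂ) := by
      rw [map_inv, Int.units_inv_eq_self]
    have key2 : ((ε₁ u : ℤ) : ℂ) * ((ε₂ u : ℤ) : ℂ) = (t : ℂ) ^ m * (((|t| : ℝ) : ℂ) ^ m)⁻¹ := by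
      rw [eq_mul_inv_iff_mul_eq₀ ht0]
      exact key
    have hsq : (t : ℂ) ^ m * (t : ℂ) ^ m = ((|t| : ℝ) : ℂ) ^ m * ((|t| : ℝ) : ℂ) ^ m := by
      rw [← mul_pow, ← mul_pow]
      congr 1
      have := abs_mul_abs_self t
      exact_mod_cast this.symm
    calc _ = (((ε₁ u : ℤ) : ℂ) * ((ε₂ u : ℤ) : ℂ)) * (absPow (((m : ℂ) - 1) / 2) u⁻¹ *
          absPow ((1 - (m : ℂ)) / 2) u * absPow (1 / 2) (u⁻¹ / u)) := by rw [hε']; ring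
      _ = _ := by
        rw [hm, key2]
        field_simp
        rw [pow_two, pow_two]
        exact hsq

end

section

open Filter Topology

variable {m : ℕ} {ε₁ ε₂ : ℝˣ →* ℤˣ}

/-! ### From homogeneous functions back to the principal series, and the group action on them. -/

lemma bottomRow_borelElt_mul (a d : ℝˣ) (x : ℝ) (g : GL (Fin 2) ℝ) :
    bottomRow (borelElt a d x * g) = (d : ℝ) • bottomRow g := by
  simp only [bottomRow, Units.val_mul, Matrix.mul_apply, Fin.sum_univ_two, coe_borelElt]
  simp

lemma det_borelElt (a d : ℝˣ) (x : ℝ) : (borelElt a d x).det = a * d := by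
  ext
  rw [Matrix.GeneralLinearGroup.val_det_apply, coe_borelElt, Matrix.det_fin_two]
  simp

/-- The element of the principal series attached to a homogeneous function on the plane. -/
def ofPlane (hε : ε₁ (-1) * ε₂ (-1) = (-1) ^ m) (Φ : ℝ × ℝ → ℂ) (hΦ : IsHomogeneousPlane m Φ) :
    PS m ε₁ ε₂ :=
  PrincipalSeries.mk (fun g => detChar m ε₁ g.det * Φ (bottomRow g)) <| by
    constructor
    · have h1 : ContDiffOn ℝ ∞ (fun A : Fin 2 → Fin 2 → ℝ =>
          detChar m ε₁ (A 0 0 * A 1 1 - A 0 1 * A 1 0) * Φ (A 1 0, A 1 1)) (Set.range entries) := by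
        refine ContDiffOn.mul (fun A hA => ?_) (hΦ.contDiffOn.comp (by fun_prop) ?_)
        · obtain ⟨g, rfl⟩ := hA
          have hd : entries g 0 0 * entries g 1 1 - entries g 0 1 * entries g 1 0 ≠ 0 := by
            have := g.det.ne_zero
            rwa [Matrix.GeneralLinearGroup.val_det_apply, Matrix.det_fin_two] at this
          exact ((contDiffAt_detChar m ε₁ hd).comp (f := fun A : Fin 2 → Fin 2 → ℝ =>
            A 0 0 * A 1 1 - A 0 1 * A 1 0) (entries g) (by fun_prop)).contDiffWithinAt
        · rintro _ ⟨g, rfl⟩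
          exact bottomRow_ne_zero g
      refine h1.congr ?_
      rintro _ ⟨g, rfl⟩
      rw [entries_injective.extend_apply, Matrix.GeneralLinearGroup.val_det_apply,
        Matrix.det_fin_two]
      rfl
    · intro a d x g
      beta_reduce
      rw [bottomRow_borelElt_mul, hΦ.smul _ _ d.ne_zero (bottomRow_ne_zero g), map_mul,
        det_borelElt, detChar_units, detChar_units, map_mul, map_mul]
      have hd := quadChar_mul_eq hε d
      have hd0 : ((d : ℝ) : ℂ) ^ m ≠ 0 := pow_ne_zero _ (by simp)
      have hmul : ∀ (s : ℂ) (t u : ℝˣ), absPow s (t * u) = absPow s t * absPow s u := by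
        intro s t u
        rw [absPow, Units.val_mul, abs_mul, Complex.ofReal_mul,
          Complex.mul_cpow_ofReal_nonneg (abs_nonneg _) (abs_nonneg _)]
        rfl
      have hinv : absPow (1 / 2) d⁻¹ * absPow (1 / 2) d = 1 := by
        rw [← hmul, inv_mul_cancel, absPow_one_right]
      have h2 : absPow ((m : ℂ) / 2) a = absPow (((m : ℂ) - 1) / 2) a * absPow (1 / 2) a := by
        rw [← absPow_add]; congr 1; ring
      have h3 : absPow ((1 - (m : ℂ)) / 2) d * absPow ((m : ℂ) / 2) d = absPow (1 / 2) d := by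
        rw [← absPow_add]; congr 1; ring
      have h4 : absPow ((m : ℂ) / 2) d * absPow ((m : ℂ) / 2) d = ((|(d : ℝ)| : ℝ) : ℂ) ^ m := by
        rw [← absPow_add, absPow, add_halves, Complex.cpow_natCast]
      have hne : absPow ((m : ℂ) / 2) d ≠ 0 := by
        intro h0
        rw [h0, zero_mul] at h4
        exact pow_ne_zero m (by simp) h4.symm
      rw [div_eq_mul_inv a d, hmul, hmul, hmul, h2]
      -- The part of the equivariance that involves d. Cleared of denominators it is the parity
      -- relation `quadChar_mul_eq`.
      have key : ((ε₁ d : ℤ) : ℂ) * absPow ((m : ℂ) / 2) d * (((d : ℝ) : ℂ) ^ m)⁻¹ =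
          ((ε₂ d : ℤ) : ℂ) * absPow ((1 - (m : ℂ)) / 2) d * absPow (1 / 2) d⁻¹ := by
        have h5 : absPow ((1 - (m : ℂ)) / 2) d * absPow (1 / 2) d⁻¹ * absPow ((m : ℂ) / 2) d = 1 := by
          rw [mul_right_comm, h3, mul_comm, hinv]
        apply mul_right_cancel₀ hne
        apply mul_right_cancel₀ hd0
        calc _ = ((ε₁ d : ℤ) : ℂ) * (absPow ((m : ℂ) / 2) d * absPow ((m : ℂ) / 2) d) := by
              field_simp
          _ = ((ε₂ d : ℤ) : ℂ) * (absPow ((1 - (m : ℂ)) / 2) d * absPow (1 / 2) d⁻¹ *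
              absPow ((m : ℂ) / 2) d) * ((d : ℝ) : ℂ) ^ m := by
              rw [h4, h5, ← hd]
              have hsq2 : ((ε₂ d : ℤ) : ℂ) * ((ε₂ d : ℤ) : ℂ) = 1 := by
                rw [← Int.cast_mul, ← Units.val_mul, Int.units_mul_self]
                simp
              linear_combination (- ((ε₁ d : ℤ) : ℂ) * ((|(d : ℝ)| : ℝ) : ℂ) ^ m) * hsq2
          _ = _ := by ring
      push_cast
      linear_combination (((ε₁ a : ℤ) : ℂ) * absPow (((m : ℂ) - 1) / 2) a * absPow (1 / 2) a *
        ((ε₁ g.det : ℤ) : ℂ) * absPow ((m : ℂ) / 2) g.det * Φ (bottomRow g)) * key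

lemma toFun_ofPlane (hε : ε₁ (-1) * ε₂ (-1) = (-1) ^ m) {Φ : ℝ × ℝ → ℂ}
    (hΦ : IsHomogeneousPlane m Φ) (g : GL (Fin 2) ℝ) :
    (ofPlane hε Φ hΦ).toFun g = detChar m ε₁ g.det * Φ (bottomRow g) := rfl

lemma plane_ofPlane (hε : ε₁ (-1) * ε₂ (-1) = (-1) ^ m) {Φ : ℝ × ℝ → ℂ}
    (hΦ : IsHomogeneousPlane m Φ) {v : ℝ × ℝ} (hv : v ≠ 0) : plane (ofPlane hε Φ hΦ) v = Φ v := by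
  rw [plane_eq _ _ hv, toFun_ofPlane, det_sectionGL, bottomRow_sectionGL, detChar_one, one_mul]

/-- The right action of a matrix on row vectors. -/
def rowMul (v : ℝ × ℝ) (g : GL (Fin 2) ℝ) : ℝ × ℝ :=
  (v.1 * g 0 0 + v.2 * g 1 0, v.1 * g 0 1 + v.2 * g 1 1)

lemma bottomRow_mul (g g' : GL (Fin 2) ℝ) : bottomRow (g * g') = rowMul (bottomRow g) g' := by
  simp [bottomRow, rowMul, Units.val_mul, Matrix.mul_apply, Fin.sum_univ_two]

lemma rowMul_ne_zero {v : ℝ × ℝ} (hv : v ≠ 0) (g : GL (Fin 2) ℝ) : rowMul v g ≠ 0 := by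
  rw [← bottomRow_sectionGL v hv, ← bottomRow_mul]
  exact bottomRow_ne_zero _

/-- The action on the principal series of `GL₂(ℝ)`. -/
abbrev psAction (m : ℕ) (ε₁ ε₂ : ℝˣ →* ℤˣ) : Representation ℂ (GL (Fin 2) ℝ) (PS m ε₁ ε₂) :=
  rightTranslation ε₁ ε₂ (((m : ℂ) - 1) / 2) ((1 - (m : ℂ)) / 2)

lemma toFun_psAction (g : GL (Fin 2) ℝ) (f : PS m ε₁ ε₂) (x : GL (Fin 2) ℝ) :
    (psAction m ε₁ ε₂ g f).toFun x = f.toFun (x * g) := rfl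

lemma plane_psAction (g : GL (Fin 2) ℝ) (f : PS m ε₁ ε₂) {v : ℝ × ℝ} (hv : v ≠ 0) :
    plane (psAction m ε₁ ε₂ g f) v = detChar m ε₁ g.det * plane f (rowMul v g) := by
  rw [plane_eq _ _ hv, toFun_psAction, toFun_eq, bottomRow_mul, bottomRow_sectionGL, map_mul,
    Units.val_mul, det_sectionGL, one_mul]

/-! ### The restriction to the circle -/

/-- The restriction to `SO(2)`. -/
def circle (f : PS m ε₁ ε₂) (α : ℝ) : ℂ := f.toFun (rot α)

lemma circle_eq_plane (f : PS m ε₁ ε₂) (α : ℝ) :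
    circle f α = plane f (-Real.sin α, Real.cos α) := toFun_rot f α

lemma sin_cos_ne_zero (α : ℝ) : ((-Real.sin α, Real.cos α) : ℝ × ℝ) ≠ 0 := by
  intro h
  have h1 : -Real.sin α = 0 := congrArg Prod.fst h
  have h2 : Real.cos α = 0 := congrArg Prod.snd h
  have := Real.sin_sq_add_cos_sq α
  rw [h2, neg_eq_zero.1 h1] at this
  simp at this

lemma circle_add (f f' : PS m ε₁ ε₂) : circle (f + f') = circle f + circle f' := rfl

lemma circle_smul (c : ℂ) (f : PS m ε₁ ε₂) : circle (c • f) = c • circle f := rfl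

lemma contDiff_circle (f : PS m ε₁ ε₂) : ContDiff ℝ ∞ (circle f) := by
  have h : ContDiffOn ℝ ∞ (plane f) {0}ᶜ :=
    f.toFun_mem.1.comp contDiffOn_sectionEntries fun v hv =>
      ⟨sectionGL v hv, entries_sectionGL v hv⟩
  rw [funext (circle_eq_plane f), ← contDiffOn_univ]
  exact h.comp (by fun_prop) fun α _ => sin_cos_ne_zero α

lemma contDiffAt_circle (f : PS m ε₁ ε₂) (n : ℕ) (α : ℝ) : ContDiffAt ℝ n (circle f) α :=
  ((contDiff_circle f).of_le (by exact_mod_cast le_top)).contDiffAt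

lemma circle_add_pi (hε : ε₁ (-1) * ε₂ (-1) = (-1) ^ m) (f : PS m ε₁ ε₂) (α : ℝ) :
    circle f (α + Real.pi) = (-1) ^ m * circle f α := by
  rw [circle_eq_plane, circle_eq_plane, Real.sin_add_pi, Real.cos_add_pi]
  have := (isHomogeneousPlane hε f).smul (-1) _ (by simp) (sin_cos_ne_zero α)
  simp only [Prod.smul_mk, smul_eq_mul, neg_mul, one_mul, neg_neg] at this
  rw [neg_neg, this]
  push_cast
  rw [← inv_pow]
  norm_num

lemma circle_periodic (f : PS m ε₁ ε₂) : Function.Periodic (circle f) (2 * Real.pi) := fun α => by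
  rw [circle_eq_plane, circle_eq_plane, Real.sin_add_two_pi, Real.cos_add_two_pi]

lemma periodic_iteratedDeriv {h : ℝ → ℂ} {c : ℝ} (hh : Function.Periodic h c) (n : ℕ) :
    Function.Periodic (iteratedDeriv n h) c := fun α => by
  have := iteratedDeriv_comp_add_const n h c
  rw [← congrFun this α]
  congr 1
  funext z
  exact hh z

lemma exists_polar {v : ℝ × ℝ} (hv : v ≠ 0) :
    ∃ r > (0 : ℝ), ∃ α : ℝ, v = r • (-Real.sin α, Real.cos α) := by
  -- With z = d - ic the point r • (-sin α, cos α) corresponds to r e^{iα}, so modulus and argument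
  -- of z are the polar coordinates.
  obtain ⟨z, hz⟩ : ∃ z : ℂ, z = ⟨v.2, -v.1⟩ := ⟨_, rfl⟩
  have hre : z.re = v.2 := by rw [hz]
  have him : z.im = -v.1 := by rw [hz]
  have hz : z ≠ 0 := fun h0 => hv (Prod.ext (by simpa [him] using congrArg Complex.im h0)
    (by simpa [hre] using congrArg Complex.re h0))
  have hn : ‖z‖ ≠ 0 := norm_ne_zero_iff.2 hz
  refine ⟨‖z‖, norm_pos_iff.2 hz, z.arg, ?_⟩
  rw [Complex.sin_arg, Complex.cos_arg hz, hre, him]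
  refine Prod.ext ?_ ?_ <;> simp <;> field_simp

lemma circle_ext (hε : ε₁ (-1) * ε₂ (-1) = (-1) ^ m) {f f' : PS m ε₁ ε₂}
    (h : circle f = circle f') : f = f' := by
  refine plane_ext fun v hv => ?_
  obtain ⟨r, hr, α, rfl⟩ := exists_polar hv
  rw [(isHomogeneousPlane hε f).smul _ _ hr.ne' (sin_cos_ne_zero _),
    (isHomogeneousPlane hε f').smul _ _ hr.ne' (sin_cos_ne_zero _), ← circle_eq_plane,
    ← circle_eq_plane, h]

lemma exists_bound_of_periodic {h : ℝ → ℂ} {c : ℝ} (hc : 0 < c) (hh : Function.Periodic h c)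
    (hcont : Continuous h) : ∃ C, ∀ α, ‖h α‖ ≤ C := by
  obtain ⟨C, hC⟩ := (isCompact_Icc (a := 0) (b := 0 + c)).exists_bound_of_continuousOn
    hcont.continuousOn
  refine ⟨C, fun α => ?_⟩
  obtain ⟨β, hβ, hβ'⟩ := hh.exists_mem_Ico hc α 0
  rw [hβ']
  exact hC β (Set.Ico_subset_Icc_self hβ)

lemma continuous_iteratedDeriv_circle (f : PS m ε₁ ε₂) (n : ℕ) :
    Continuous (iteratedDeriv n (circle f)) :=
  (contDiff_circle f).continuous_iteratedDeriv n (by exact_mod_cast le_top)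

lemma bddAbove_iteratedDeriv_circle (f : PS m ε₁ ε₂) (n : ℕ) :
    BddAbove (Set.range fun α => ‖iteratedDeriv n (circle f) α‖) := by
  obtain ⟨C, hC⟩ := exists_bound_of_periodic Real.two_pi_pos
    (periodic_iteratedDeriv (circle_periodic f) n) (continuous_iteratedDeriv_circle f n)
  exact ⟨C, by rintro _ ⟨α, rfl⟩; exact hC α⟩

lemma iteratedDeriv_circle_add (f f' : PS m ε₁ ε₂) (n : ℕ) (α : ℝ) :
    iteratedDeriv n (circle (f + f')) α =
      iteratedDeriv n (circle f) α + iteratedDeriv n (circle f') α := by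
  rw [circle_add]
  exact iteratedDeriv_add (contDiffAt_circle f n α) (contDiffAt_circle f' n α)

lemma iteratedDeriv_circle_smul (c : ℂ) (f : PS m ε₁ ε₂) (n : ℕ) (α : ℝ) :
    iteratedDeriv n (circle (c • f)) α = c * iteratedDeriv n (circle f) α := by
  rw [circle_smul, iteratedDeriv_const_smul_field, smul_eq_mul]

lemma iteratedDeriv_circle_sub (f f' : PS m ε₁ ε₂) (n : ℕ) (α : ℝ) :
    iteratedDeriv n (circle (f - f')) α =
      iteratedDeriv n (circle f) α - iteratedDeriv n (circle f') α := by
  have := iteratedDeriv_circle_add (f - f') f' n α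
  rw [sub_add_cancel] at this
  rw [this, add_sub_cancel_right]

/-- The seminorm `f ↦ sup |(d/dα)^n f|` on the principal series. -/
def circleSeminorm (n : ℕ) : Seminorm ℂ (PS m ε₁ ε₂) :=
  Seminorm.of (fun f => ⨆ α, ‖iteratedDeriv n (circle f) α‖)
    (fun f f' => ciSup_le fun α => by
      rw [iteratedDeriv_circle_add]
      exact (norm_add_le _ _).trans (add_le_add (le_ciSup (bddAbove_iteratedDeriv_circle f n) α)
        (le_ciSup (bddAbove_iteratedDeriv_circle f' n) α)))
    (fun c f => by
      simp only [iteratedDeriv_circle_smul, norm_mul]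
      rw [Real.mul_iSup_of_nonneg (norm_nonneg _)])

lemma norm_le_circleSeminorm (f : PS m ε₁ ε₂) (n : ℕ) (α : ℝ) :
    ‖iteratedDeriv n (circle f) α‖ ≤ circleSeminorm n f :=
  le_ciSup (bddAbove_iteratedDeriv_circle f n) α

lemma circleSeminorm_le {f : PS m ε₁ ε₂} {n : ℕ} {C : ℝ}
    (h : ∀ α, ‖iteratedDeriv n (circle f) α‖ ≤ C) : circleSeminorm n f ≤ C := ciSup_le h

/-- `circleDeriv` as a linear map. -/
def circleDerivHom : PS m ε₁ ε₂ →+ (ℕ → (ℝ →ᵤ ℂ)) where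
  toFun := circleDeriv
  map_zero' := by
    funext n
    apply UniformFun.toFun.injective
    funext α
    change iteratedDeriv n (circle (0 : PS m ε₁ ε₂)) α = 0
    have := iteratedDeriv_circle_smul 0 (0 : PS m ε₁ ε₂) n α
    rwa [zero_smul, zero_mul] at this
  map_add' f f' := by
    funext n
    apply UniformFun.toFun.injective
    funext α
    exact iteratedDeriv_circle_add f f' n α

instance : IsTopologicalAddGroup (PS m ε₁ ε₂) :=
  topologicalAddGroup_induced (circleDerivHom (m := m) (ε₁ := ε₁) (ε₂ := ε₂))

lemma withSeminorms_circle :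
    WithSeminorms (circleSeminorm : SeminormFamily ℂ (PS m ε₁ ε₂) ℕ) := by
  rw [SeminormFamily.withSeminorms_iff_nhds_eq_iInf]
  have h0 : 𝓝 (0 : PS m ε₁ ε₂) = comap circleDerivHom (𝓝 (circleDerivHom (0 : PS m ε₁ ε₂))) :=
    nhds_induced _ _
  rw [h0, map_zero, nhds_pi, Filter.pi, comap_iInf]
  refine iInf_congr fun n => ?_
  rw [comap_comap]
  have hb := (UniformFun.hasBasis_nhds_zero (α := ℝ) (G := ℂ)).comap
    (Function.eval n ∘ (circleDerivHom : PS m ε₁ ε₂ →+ _))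
  refine le_antisymm ?_ ?_
  · refine ((Metric.nhds_basis_closedBall (x := (0 : ℝ))).comap _).ge_iff.2 fun ε hε => ?_
    refine hb.mem_iff.2 ⟨Metric.closedBall 0 ε, Metric.closedBall_mem_nhds _ hε, fun f hf => ?_⟩
    have h1 : circleSeminorm n f ≤ ε := circleSeminorm_le fun α => by
      have := hf α
      rw [mem_closedBall_zero_iff] at this
      exact this
    simpa [abs_of_nonneg (apply_nonneg (circleSeminorm n) f)] using h1
  · refine hb.ge_iff.2 fun V hV => ?_
    obtain ⟨ε, hε, hεV⟩ := Metric.nhds_basis_closedBall.mem_iff.1 hV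
    refine mem_comap.2 ⟨Metric.closedBall 0 ε, Metric.closedBall_mem_nhds _ hε, fun f hf α => hεV ?_⟩
    have h1 : circleSeminorm n f ≤ ε := by
      simpa [abs_of_nonneg (apply_nonneg (circleSeminorm n) f)] using hf
    rw [mem_closedBall_zero_iff]
    exact (norm_le_circleSeminorm f n α).trans h1

instance : ContinuousSMul ℂ (PS m ε₁ ε₂) := withSeminorms_circle.continuousSMul

lemma tendsto_iff_circle {ι : Type*} {l : Filter ι} {u : ι → PS m ε₁ ε₂} {f : PS m ε₁ ε₂} :
    Tendsto u l (𝓝 f) ↔ ∀ n, TendstoUniformly (fun i => iteratedDeriv n (circle (u i)))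
      (iteratedDeriv n (circle f)) l := by
  have h : IsInducing (circleDeriv : PS m ε₁ ε₂ → _) := ⟨rfl⟩
  rw [h.tendsto_nhds_iff, tendsto_pi_nhds]
  refine forall_congr' fun n => ?_
  rw [UniformFun.tendsto_iff_tendstoUniformly]
  rfl

lemma continuous_circleSeminorm (n : ℕ) :
    Continuous (circleSeminorm n : Seminorm ℂ (PS m ε₁ ε₂)) :=
  withSeminorms_circle.continuous_seminorm n

end

section

open Filter Topology

variable {m : ℕ} {ε₁ ε₂ : ℝˣ →* ℤˣ}

/-! ### Completeness of the principal series -/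

/-- The homogeneous function on the plane with given values on the circle. -/
def planeOfCircle (m : ℕ) (h : ℝ → ℂ) (v : ℝ × ℝ) : ℂ :=
  ((‖(⟨v.2, -v.1⟩ : ℂ)‖ : ℂ) ^ m)⁻¹ * h (Complex.arg ⟨v.2, -v.1⟩)

lemma planeOfCircle_polar {h : ℝ → ℂ} (hh : Function.Periodic h (2 * Real.pi)) {r : ℝ}
    (hr : 0 < r) (α : ℝ) :
    planeOfCircle m h (r • (-Real.sin α, Real.cos α)) = ((r : ℂ) ^ m)⁻¹ * h α := by
  have hz : (⟨(r • ((-Real.sin α, Real.cos α) : ℝ × ℝ)).2,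
      -(r • ((-Real.sin α, Real.cos α) : ℝ × ℝ)).1⟩ : ℂ) = r * Complex.exp (α * Complex.I) := by
    apply Complex.ext <;> simp [Complex.exp_re, Complex.exp_im]
  rw [planeOfCircle, hz]
  have hnorm : ‖(r : ℂ) * Complex.exp (α * Complex.I)‖ = r := by
    rw [norm_mul, Complex.norm_exp_ofReal_mul_I, mul_one, Complex.norm_real, Real.norm_eq_abs,
      abs_of_pos hr]
  rw [hnorm]
  congr 1
  obtain ⟨n, hn⟩ : ∃ n : ℤ, α * Complex.I =
      Complex.arg (r * Complex.exp (α * Complex.I)) * Complex.I + n * (2 * Real.pi * Complex.I) := by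
    rw [← Complex.exp_eq_exp_iff_exists_int]
    have h1 := Complex.norm_mul_exp_arg_mul_I (r * Complex.exp (α * Complex.I))
    rw [hnorm] at h1
    exact (mul_left_cancel₀ (by exact_mod_cast hr.ne') h1).symm
  have hα : α = Complex.arg (r * Complex.exp (α * Complex.I)) + n * (2 * Real.pi) := by
    have h2 : ((α : ℝ) : ℂ) * Complex.I =
        ((Complex.arg (r * Complex.exp (α * Complex.I)) + n * (2 * Real.pi) : ℝ) : ℂ) *
          Complex.I := by
      push_cast
      linear_combination hn
    exact_mod_cast mul_right_cancel₀ Complex.I_ne_zero h2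
  conv_rhs => rw [hα]
  exact (hh.int_mul n _).symm

/-- The argument is smooth only off its cut. At a point v on the cut, -v is off it, and homogeneity
under t = -1, which comes from the behaviour of h under α ↦ α + π, transports smoothness from -v to
v. -/
lemma isHomogeneousPlane_planeOfCircle {h : ℝ → ℂ} (hsm : ContDiff ℝ ∞ h)
    (hpi : ∀ α, h (α + Real.pi) = (-1) ^ m * h α) : IsHomogeneousPlane m (planeOfCircle m h) := by
  have hper : Function.Periodic h (2 * Real.pi) := fun α => by
    rw [two_mul, ← add_assoc, hpi, hpi, ← mul_assoc, ← mul_pow]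
    norm_num
  have hsmul : ∀ (t : ℝ) (v : ℝ × ℝ), t ≠ 0 → v ≠ 0 →
      planeOfCircle m h (t • v) = ((t : ℂ) ^ m)⁻¹ * planeOfCircle m h v := by
    intro t v ht hv
    obtain ⟨r, hr, α, rfl⟩ := exists_polar hv
    rw [planeOfCircle_polar hper hr]
    rcases lt_or_gt_of_ne ht with ht' | ht'
    · have e : t • r • ((-Real.sin α, Real.cos α) : ℝ × ℝ) =
          (-t * r) • (-Real.sin (α + Real.pi), Real.cos (α + Real.pi)) := by
        rw [Real.sin_add_pi, Real.cos_add_pi]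
        ext <;> simp <;> ring
      rw [e, planeOfCircle_polar hper (mul_pos (neg_pos.2 ht') hr), hpi]
      push_cast
      rw [mul_pow, neg_pow (t : ℂ), mul_inv, mul_inv, ← inv_pow (-1 : ℂ)]
      have : ((-1 : ℂ)⁻¹) ^ m * (-1) ^ m = 1 := by rw [← mul_pow]; norm_num
      linear_combination (((t : ℂ) ^ m)⁻¹ * ((r : ℂ) ^ m)⁻¹ * h α) * this
    · rw [← mul_smul, planeOfCircle_polar hper (mul_pos ht' hr)]
      push_cast
      rw [mul_pow, mul_inv, mul_assoc]
  have hslit : ∀ v : ℝ × ℝ, (⟨v.2, -v.1⟩ : ℂ) ∈ Complex.slitPlane →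
      ContDiffAt ℝ ∞ (planeOfCircle m h) v := by
    intro v hv
    have hz : ContDiff ℝ ∞ (fun v : ℝ × ℝ => (⟨v.2, -v.1⟩ : ℂ)) := by
      have : (fun v : ℝ × ℝ => (⟨v.2, -v.1⟩ : ℂ)) =
          fun v => (v.2 : ℂ) - (v.1 : ℂ) * Complex.I := by
        funext v
        apply Complex.ext <;> simp
      rw [this]
      exact (Complex.ofRealCLM.contDiff.comp contDiff_snd).sub
        ((Complex.ofRealCLM.contDiff.comp contDiff_fst).mul contDiff_const)
    have hz0 : (⟨v.2, -v.1⟩ : ℂ) ≠ 0 := Complex.slitPlane_ne_zero hv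
    have hlog : ContDiffAt ℝ ∞ Complex.log ⟨v.2, -v.1⟩ :=
      (Complex.contDiffAt_log hv).restrict_scalars ℝ
    have harg : ContDiffAt ℝ ∞ (fun v : ℝ × ℝ => Complex.arg ⟨v.2, -v.1⟩) v := by
      have h1 := Complex.imCLM.contDiff.contDiffAt.comp v (hlog.comp v hz.contDiffAt)
      refine h1.congr_of_eventuallyEq (Eventually.of_forall fun w => ?_)
      simp [Complex.log_im]
    refine ContDiffAt.mul ?_ (hsm.contDiffAt.comp v harg)
    refine ContDiffAt.inv ?_ ?_
    · refine ContDiffAt.pow ?_ m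
      exact Complex.ofRealCLM.contDiff.contDiffAt.comp v
        (ContDiffAt.norm ℝ hz.contDiffAt hz0)
    · exact pow_ne_zero _ (by exact_mod_cast norm_ne_zero_iff.2 hz0)
  refine ⟨fun v hv => ContDiffAt.contDiffWithinAt ?_, hsmul⟩
  by_cases hv' : (⟨v.2, -v.1⟩ : ℂ) ∈ Complex.slitPlane
  · exact hslit v hv'
  · have hz0 : (⟨v.2, -v.1⟩ : ℂ) ≠ 0 := fun h0 => hv (Prod.ext
      (by simpa using congrArg Complex.im h0) (by simpa using congrArg Complex.re h0))
    have hneg : (⟨(-v).2, -(-v).1⟩ : ℂ) ∈ Complex.slitPlane := by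
      have e : (⟨(-v).2, -(-v).1⟩ : ℂ) = -⟨v.2, -v.1⟩ := by
        apply Complex.ext <;> simp
      rw [e]
      exact (Complex.mem_slitPlane_or_neg_mem_slitPlane hz0).resolve_left hv'
    have h1 : ContDiffAt ℝ ∞ (fun w => (((-1 : ℝ) : ℂ) ^ m) * planeOfCircle m h (-w)) v :=
      contDiffAt_const.mul ((hslit _ hneg).comp v contDiff_neg.contDiffAt)
    refine h1.congr_of_eventuallyEq ?_
    filter_upwards [isOpen_ne.mem_nhds hv] with w hw
    have := hsmul (-1) w (by simp) hw
    rw [neg_one_smul] at this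
    rw [this, ← mul_assoc, mul_inv_cancel₀ (pow_ne_zero _ (by simp)), one_mul]

lemma circle_ofPlane_planeOfCircle (hε : ε₁ (-1) * ε₂ (-1) = (-1) ^ m) {h : ℝ → ℂ}
    (hsm : ContDiff ℝ ∞ h) (hpi : ∀ α, h (α + Real.pi) = (-1) ^ m * h α) :
    circle (ofPlane hε _ (isHomogeneousPlane_planeOfCircle hsm hpi)) = h := by
  have hper : Function.Periodic h (2 * Real.pi) := fun α => by
    rw [two_mul, ← add_assoc, hpi, hpi, ← mul_assoc, ← mul_pow]
    norm_num
  funext α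
  rw [circle_eq_plane, plane_ofPlane hε _ (sin_cos_ne_zero α)]
  simpa using planeOfCircle_polar (m := m) hper one_pos α

/-- Limits of functions all of whose derivatives converge uniformly. -/
lemma contDiff_of_tendstoUniformly {u : ℕ → ℝ → ℂ} (hu : ∀ i, ContDiff ℝ ∞ (u i))
    {k : ℕ → ℝ → ℂ} (hk : ∀ n, TendstoUniformly (fun i => iteratedDeriv n (u i)) (k n) atTop) :
    ContDiff ℝ ∞ (k 0) ∧ ∀ n, iteratedDeriv n (k 0) = k n := by
  have hd : ∀ n x, HasDerivAt (k n) (k (n + 1) x) x := by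
    intro n x
    refine hasDerivAt_of_tendstoUniformly (hk (n + 1)) (Eventually.of_forall fun i y => ?_)
      (fun y => (hk n).tendsto_at y) x
    rw [iteratedDeriv_succ]
    exact ((hu i).differentiable_iteratedDeriv n (by exact_mod_cast ENat.natCast_lt_top n)
      y).hasDerivAt
  have hit : ∀ n, iteratedDeriv n (k 0) = k n := by
    intro n
    induction n with
    | zero => exact iteratedDeriv_zero
    | succ n ih =>
      rw [iteratedDeriv_succ, ih]
      exact funext fun x => (hd n x).deriv
  refine ⟨contDiff_of_differentiable_iteratedDeriv fun n _ => ?_, hit⟩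
  rw [hit n]
  exact fun x => (hd n x).differentiableAt

lemma exists_tendstoUniformly_of_cauchy {u : ℕ → ℝ → ℂ}
    (hu : ∀ ε > 0, ∃ N, ∀ i ≥ N, ∀ j ≥ N, ∀ x, ‖u i x - u j x‖ < ε) :
    ∃ k : ℝ → ℂ, TendstoUniformly u k atTop := by
  have hc : UniformCauchySeqOn u atTop Set.univ := by
    rw [Metric.uniformCauchySeqOn_iff]
    intro ε hε
    obtain ⟨N, hN⟩ := hu ε hε
    exact ⟨N, fun i hi j hj x _ => by rw [dist_eq_norm]; exact hN i hi j hj x⟩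
  choose k hk using fun x => cauchySeq_tendsto_of_complete (hc.cauchy_map (Set.mem_univ x))
  exact ⟨k, tendstoUniformlyOn_univ.1 (hc.tendstoUniformlyOn_of_tendsto fun x _ => hk x)⟩

/-- Uniform limits of all derivatives on the circle give a smooth function with the same sign under
a half turn, and every such function extends homogeneously to the plane. -/
theorem isFrechet_PS (hε : ε₁ (-1) * ε₂ (-1) = (-1) ^ m) : IsFrechet (PS m ε₁ ε₂) where
  firstCountable := withSeminorms_circle.firstCountableTopology
  complete u hu := by
    have h1 : ∀ n, ∃ k : ℝ → ℂ, TendstoUniformly (fun i => iteratedDeriv n (circle (u i))) k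
        atTop := by
      refine fun n => exists_tendstoUniformly_of_cauchy fun ε hε => ?_
      obtain ⟨N, hN⟩ := hu {f | circleSeminorm n f < ε}
        ((isOpen_lt (continuous_circleSeminorm n) continuous_const).mem_nhds (by simpa using hε))
      refine ⟨N, fun i hi j hj x => ?_⟩
      rw [← iteratedDeriv_circle_sub]
      exact (norm_le_circleSeminorm _ n x).trans_lt (hN i hi j hj)
    choose k hk using h1
    obtain ⟨hsm, hit⟩ := contDiff_of_tendstoUniformly (fun i => contDiff_circle (u i)) hk
    have hlim : ∀ α, Tendsto (fun i => circle (u i) α) atTop (𝓝 (k 0 α)) := fun α => by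
      simpa using (hk 0).tendsto_at α
    have hpi : ∀ α, k 0 (α + Real.pi) = (-1) ^ m * k 0 α := fun α => by
      refine tendsto_nhds_unique (hlim (α + Real.pi)) ?_
      simp only [circle_add_pi hε]
      exact (hlim α).const_mul _
    refine ⟨ofPlane hε _ (isHomogeneousPlane_planeOfCircle hsm hpi), tendsto_iff_circle.2 ?_⟩
    intro n
    rw [circle_ofPlane_planeOfCircle hε hsm hpi, hit n]
    exact hk n

/-- An increasing family of seminorms defining the topology of the principal series. -/
def psSeminorm (N : ℕ) : Seminorm ℂ (PS m ε₁ ε₂) :=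
  ∑ n ∈ Finset.range (N + 1), circleSeminorm n

lemma psSeminorm_apply (N : ℕ) (f : PS m ε₁ ε₂) :
    psSeminorm N f = ∑ n ∈ Finset.range (N + 1), circleSeminorm n f := by
  rw [psSeminorm]
  induction N with
  | zero => simp
  | succ N ih => rw [Finset.sum_range_succ, add_apply, ih, Finset.sum_range_succ _ (N + 1)]

lemma psSeminorm_mono : Monotone (psSeminorm : ℕ → Seminorm ℂ (PS m ε₁ ε₂)) := by
  intro M N hMN f
  rw [psSeminorm_apply, psSeminorm_apply]
  exact Finset.sum_le_sum_of_subset_of_nonneg (Finset.range_mono (by omega))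
    fun n _ _ => apply_nonneg _ _

lemma continuous_psSeminorm (N : ℕ) : Continuous (psSeminorm N : Seminorm ℂ (PS m ε₁ ε₂)) := by
  rw [show ⇑(psSeminorm N : Seminorm ℂ (PS m ε₁ ε₂)) =
    fun f => ∑ n ∈ Finset.range (N + 1), circleSeminorm n f from funext (psSeminorm_apply N)]
  exact continuous_finsetSum _ fun n _ => continuous_circleSeminorm n

lemma exists_psSeminorm_lt {U : Set (PS m ε₁ ε₂)} (hU : U ∈ 𝓝 0) :
    ∃ N, ∃ ε > 0, ∀ f, psSeminorm N f < ε → f ∈ U := by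
  obtain ⟨s, r, hr, hs⟩ := (withSeminorms_circle.mem_nhds_iff 0 U).1 hU
  refine ⟨s.sup id, r, hr, fun f hf => hs ?_⟩
  rw [Seminorm.mem_ball, sub_zero]
  refine lt_of_le_of_lt ?_ hf
  refine Seminorm.finset_sup_apply_le (apply_nonneg _ _) fun n hn => ?_
  rw [psSeminorm_apply]
  exact Finset.single_le_sum (f := fun n => circleSeminorm n f) (fun n _ => apply_nonneg _ _)
    (Finset.mem_range.2 (Nat.lt_succ_of_le (Finset.le_sup (f := id) hn)))

lemma continuous_circle_apply (α : ℝ) : Continuous fun f : PS m ε₁ ε₂ => circle f α := by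
  rw [continuous_iff_continuousAt]
  intro f
  have := (tendsto_iff_circle.1 (tendsto_id (α := PS m ε₁ ε₂) (x := 𝓝 f)) 0).tendsto_at α
  simpa [ContinuousAt] using this

lemma continuous_plane_apply (hε : ε₁ (-1) * ε₂ (-1) = (-1) ^ m) (v : ℝ × ℝ) :
    Continuous fun f : PS m ε₁ ε₂ => plane f v := by
  by_cases hv : v = 0
  · simp only [hv, plane_zero_right]
    exact continuous_const
  · obtain ⟨r, hr, α, rfl⟩ := exists_polar hv
    have : ∀ f : PS m ε₁ ε₂, plane f (r • (-Real.sin α, Real.cos α)) =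
        ((r : ℂ) ^ m)⁻¹ * circle f α := fun f => by
      rw [(isHomogeneousPlane hε f).smul _ _ hr.ne' (sin_cos_ne_zero _), circle_eq_plane]
    simp only [this]
    exact continuous_const.mul (continuous_circle_apply α)

end

section

open Filter Topology

variable {m : ℕ} {ε₁ ε₂ : ℝˣ →* ℤˣ}

/-! ### Growth of the action of the diagonal torus -/

/-- Dilation of the plane by a nonzero scalar. -/
def planeDilation (s : ℝˣ) : (ℝ × ℝ) ≃L[ℝ] (ℝ × ℝ) := ContinuousLinearEquiv.smulLeft s

lemma planeDilation_apply (s : ℝˣ) (v : ℝ × ℝ) : planeDilation s v = (s : ℝ) • v := rfl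

/-- Rescaling by s = 1/‖v‖ moves v to the unit sphere, where compactness bounds the i-th derivative.
Homogeneity gives back a factor s^{m+i}, and s ≤ 2 in the region considered. -/
lemma IsHomogeneousPlane.exists_bound {Φ : ℝ × ℝ → ℂ} (hΦ : IsHomogeneousPlane m Φ) (i : ℕ) :
    ∃ C, ∀ v : ℝ × ℝ, 1 / 2 ≤ ‖v‖ → ‖iteratedFDerivWithin ℝ i Φ {0}ᶜ v‖ ≤ C := by
  have hopen : IsOpen ({0}ᶜ : Set (ℝ × ℝ)) := isOpen_compl_singleton
  have hud : UniqueDiffOn ℝ ({0}ᶜ : Set (ℝ × ℝ)) := hopen.uniqueDiffOn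
  have hcont : ContinuousOn (iteratedFDerivWithin ℝ i Φ {0}ᶜ) {0}ᶜ :=
    hΦ.contDiffOn.continuousOn_iteratedFDerivWithin (by exact_mod_cast le_top) hud
  obtain ⟨M, hM⟩ := (isCompact_sphere (0 : ℝ × ℝ) 1).exists_bound_of_continuousOn
    (hcont.mono fun v hv h0 => by
      rw [Set.mem_singleton_iff] at h0
      simp [h0] at hv)
  refine ⟨2 ^ m * (M * 2 ^ i), fun v hv => ?_⟩
  have hv0 : 0 < ‖v‖ := by linarith
  let s : ℝˣ := (Units.mk0 ‖v‖ hv0.ne')⁻¹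
  have hs : (s : ℝ) = ‖v‖⁻¹ := rfl
  have hs0 : (s : ℝ) ≠ 0 := s.ne_zero
  have hs2 : ‖(s : ℝ)‖ ≤ 2 := by
    rw [hs, norm_inv, norm_norm]
    exact inv_le_of_inv_le₀ (by norm_num) (by linarith)
  have hpre : planeDilation s ⁻¹' {0}ᶜ = {0}ᶜ := by
    ext w
    simp [planeDilation_apply]
  have hw : planeDilation s v ∈ ({0}ᶜ : Set (ℝ × ℝ)) := by
    simp [planeDilation_apply, norm_pos_iff.1 hv0]
  have hcomp := (planeDilation s).iteratedFDerivWithin_comp_right (f := Φ) hud hw i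
  rw [hpre] at hcomp
  have heq : Set.EqOn Φ (((s : ℝ) : ℂ) ^ m • (Φ ∘ planeDilation s)) {0}ᶜ := by
    intro w hw
    have := hΦ.smul s w hs0 hw
    rw [Pi.smul_apply, Function.comp_apply, planeDilation_apply, this, smul_eq_mul, ← mul_assoc,
      mul_inv_cancel₀ (pow_ne_zero _ (by simp)), one_mul]
  have hvmem : v ∈ ({0}ᶜ : Set (ℝ × ℝ)) := norm_pos_iff.1 hv0
  have hsmooth : ContDiffOn ℝ ∞ (Φ ∘ planeDilation s) {0}ᶜ :=
    hΦ.contDiffOn.comp (planeDilation s).contDiff.contDiffOn fun w hw => by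
      simpa [planeDilation_apply] using hw
  rw [iteratedFDerivWithin_congr heq hvmem i,
    iteratedFDerivWithin_const_smul_apply
      ((hsmooth v hvmem).of_le (by exact_mod_cast le_top)) hud hvmem, norm_smul, hcomp]
  have hsph : planeDilation s v ∈ Metric.sphere (0 : ℝ × ℝ) 1 := by
    rw [mem_sphere_zero_iff_norm, planeDilation_apply, norm_smul, hs, norm_inv, norm_norm,
      inv_mul_cancel₀ hv0.ne']
  have hM0 : 0 ≤ M := (norm_nonneg _).trans (hM _ hsph)
  have hop : ‖(planeDilation s : (ℝ × ℝ) →L[ℝ] (ℝ × ℝ))‖ ≤ 2 := by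
    refine ContinuousLinearMap.opNorm_le_bound _ (by norm_num) fun w => ?_
    change ‖(s : ℝ) • w‖ ≤ _
    rw [norm_smul]
    gcongr
  gcongr
  · rw [norm_pow, Complex.norm_real]
    gcongr
  · refine (ContinuousMultilinearMap.norm_compContinuousLinearMap_le _ _).trans ?_
    rw [Finset.prod_const, Finset.card_univ, Fintype.card_fin]
    gcongr
    exact hM _ hsph

/-- The map `(c, d) ↦ (t c, d)` of the plane. -/
def planeStretch (t : ℝˣ) : (ℝ × ℝ) ≃L[ℝ] (ℝ × ℝ) :=
  (ContinuousLinearEquiv.smulLeft t).prodCongr (ContinuousLinearEquiv.refl ℝ ℝ)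

lemma coe_embGL1 (t : ℝˣ) :
    (embGL1 t : Matrix (Fin 2) (Fin 2) ℝ) = !![(t : ℝ), 0; 0, 1] := rfl

lemma rowMul_embGL1 (v : ℝ × ℝ) (t : ℝˣ) : rowMul v (embGL1 t) = ((t : ℝ) * v.1, v.2) := by
  simp [rowMul, coe_embGL1, mul_comm]

lemma det_embGL1 (t : ℝˣ) : ((embGL1 t).det : ℝ) = t := by
  rw [Matrix.GeneralLinearGroup.val_det_apply, coe_embGL1, Matrix.det_fin_two]
  simp

lemma plane_embGL1 (t : ℝˣ) (f : PS m ε₁ ε₂) {v : ℝ × ℝ} (hv : v ≠ 0) :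
    plane (psAction m ε₁ ε₂ (embGL1 t) f) v = detChar m ε₁ t * plane f ((t : ℝ) * v.1, v.2) := by
  rw [plane_psAction _ _ hv, det_embGL1, rowMul_embGL1]

lemma norm_detChar (t : ℝ) : ‖detChar m ε₁ t‖ = |t| ^ ((m : ℝ) / 2) := by
  rw [detChar, norm_mul, Complex.norm_real, Real.norm_eq_abs,
    abs_of_nonneg (Real.rpow_nonneg (abs_nonneg t) _)]
  split_ifs
  · simp
  · rcases Int.units_eq_one_or (ε₁ (-1)) with h | h <;> simp [h]

/-- The circle as a curve in the plane. -/
def circleCurve (α : ℝ) : ℝ × ℝ := (-Real.sin α, Real.cos α)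

/-- The norm is the sup norm. One of |sin α|, |cos α| is at least 1/2, and stretching by t ≥ 1
decreases neither coordinate, so the stretched circle stays where `IsHomogeneousPlane.exists_bound`
applies. -/
lemma half_le_norm_planeStretch_circleCurve {t : ℝˣ} (ht : 1 ≤ (t : ℝ)) (α : ℝ) :
    1 / 2 ≤ ‖planeStretch t (circleCurve α)‖ := by
  have h := Real.sin_sq_add_cos_sq α
  have h1 : |Real.sin α| ≤ ‖planeStretch t (circleCurve α)‖ := by
    refine le_trans ?_ (norm_fst_le _)
    change |Real.sin α| ≤ |(t : ℝ) * -Real.sin α|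
    rw [abs_mul, abs_neg, abs_of_pos (by linarith : 0 < (t : ℝ))]
    exact le_mul_of_one_le_left (abs_nonneg _) ht
  have h2 : |Real.cos α| ≤ ‖planeStretch t (circleCurve α)‖ :=
    norm_snd_le (planeStretch t (circleCurve α))
  by_contra hlt
  rw [not_le] at hlt
  have h3 : |Real.sin α| < 1 / 2 := h1.trans_lt hlt
  have h4 : |Real.cos α| < 1 / 2 := h2.trans_lt hlt
  rw [← sq_abs (Real.sin α), ← sq_abs (Real.cos α)] at h
  nlinarith [abs_nonneg (Real.sin α), abs_nonneg (Real.cos α)]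

/-- The orbit of a vector under the diagonal torus grows moderately. -/
theorem exists_growth_bound (hε : ε₁ (-1) * ε₂ (-1) = (-1) ^ m) (f : PS m ε₁ ε₂) (n : ℕ) :
    ∃ C, ∀ t : ℝˣ, 1 ≤ (t : ℝ) → circleSeminorm n (psAction m ε₁ ε₂ (embGL1 t) f) ≤
      (t : ℝ) ^ ((m : ℝ) / 2) * (C * (t : ℝ) ^ n) := by
  have hΦ := isHomogeneousPlane hε f
  have hopen : IsOpen ({0}ᶜ : Set (ℝ × ℝ)) := isOpen_compl_singleton
  have hud : UniqueDiffOn ℝ ({0}ᶜ : Set (ℝ × ℝ)) := hopen.uniqueDiffOn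
  choose C hC using hΦ.exists_bound
  have hγ : ContDiff ℝ ∞ circleCurve := by unfold circleCurve; fun_prop
  have hγ0 : ∀ α, circleCurve α ≠ 0 := sin_cos_ne_zero
  -- The condition 1 ≤ D allows D to be replaced by D^i, the form required by the bound for
  -- derivatives of a composition.
  have hD : ∃ D : ℝ, 1 ≤ D ∧ ∀ i ≤ n, ∀ α ∈ Set.Icc 0 (0 + 2 * Real.pi),
      ‖iteratedFDeriv ℝ i circleCurve α‖ ≤ D := by
    choose D hD using fun i : ℕ => (isCompact_Icc (a := (0 : ℝ))
      (b := 0 + 2 * Real.pi)).exists_bound_of_continuousOn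
      (hγ.continuous_iteratedFDeriv (m := i) (by exact_mod_cast le_top)).continuousOn
    refine ⟨1 + ∑ i ∈ Finset.range (n + 1), |D i|, ?_, fun i hi α hα => (hD i α hα).trans ?_⟩
    · have : 0 ≤ ∑ i ∈ Finset.range (n + 1), |D i| := Finset.sum_nonneg fun _ _ => abs_nonneg _
      linarith
    · have := Finset.single_le_sum (f := fun i => |D i|) (fun i _ => abs_nonneg _)
        (Finset.mem_range.2 (Nat.lt_succ_of_le hi))
      have := le_abs_self (D i)
      linarith
  obtain ⟨D, hD1, hD⟩ := hD
  set C' := ∑ i ∈ Finset.range (n + 1), |C i|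
  refine ⟨n.factorial * C' * D ^ n, fun t ht => circleSeminorm_le fun α => ?_⟩
  have ht0 : (0 : ℝ) < t := by linarith
  set Ψ : ℝ × ℝ → ℂ := plane f ∘ planeStretch t
  have hpre : planeStretch t ⁻¹' {0}ᶜ = {0}ᶜ := by
    ext w
    simp
  have hcirc : circle (psAction m ε₁ ε₂ (embGL1 t) f) = detChar m ε₁ t • (Ψ ∘ circleCurve) := by
    funext β
    rw [circle_eq_plane, plane_embGL1 _ _ (sin_cos_ne_zero β)]
    rfl
  obtain ⟨β, hβ, hβ'⟩ := (periodic_iteratedDeriv (circle_periodic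
    (psAction m ε₁ ε₂ (embGL1 t) f)) n).exists_mem_Ico Real.two_pi_pos α 0
  have hβ := Set.Ico_subset_Icc_self hβ
  have hΨ : ContDiffOn ℝ ∞ Ψ {0}ᶜ :=
    hΦ.contDiffOn.comp (planeStretch t).contDiff.contDiffOn hpre.ge
  rw [hβ', hcirc, iteratedDeriv_const_smul_field, norm_smul, norm_detChar,
    abs_of_pos ht0]
  gcongr
  rw [← norm_iteratedFDeriv_eq_norm_iteratedDeriv, ← iteratedFDerivWithin_univ]
  have hop : ‖(planeStretch t : (ℝ × ℝ) →L[ℝ] (ℝ × ℝ))‖ ≤ t := by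
    refine ContinuousLinearMap.opNorm_le_bound _ ht0.le fun w => ?_
    change ‖((t : ℝ) * w.1, w.2)‖ ≤ _
    rw [Prod.norm_mk, norm_mul, Real.norm_eq_abs (t : ℝ), abs_of_pos ht0]
    refine max_le ?_ ?_
    · gcongr
      exact norm_fst_le w
    · refine (norm_snd_le w).trans (le_mul_of_one_le_left (norm_nonneg _) ht)
  have hC0 : 0 ≤ C' := Finset.sum_nonneg fun _ _ => abs_nonneg _
  -- Faà di Bruno: the n-th derivative of the composition is at most n! · C · D^n. The i-th
  -- derivative of the stretched function gains ‖stretch‖^i ≤ t^i ≤ t^n, which is the only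
  -- dependence on t besides `detChar`.
  refine (norm_iteratedFDerivWithin_comp_le (C := C' * (t : ℝ) ^ n) (D := D) hΨ
    (hγ.contDiffOn (s := Set.univ)) (n := n) (by exact_mod_cast le_top) hud uniqueDiffOn_univ
    (fun β _ => hγ0 β) (Set.mem_univ β) ?_ ?_).trans (le_of_eq (by ring))
  · intro i hi
    have hcomp := (planeStretch t).iteratedFDerivWithin_comp_right (f := plane f) hud
      (x := circleCurve β) (by simpa using hγ0 β) i
    rw [hpre] at hcomp
    rw [hcomp]
    refine (ContinuousMultilinearMap.norm_compContinuousLinearMap_le _ _).trans ?_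
    rw [Finset.prod_const, Finset.card_univ, Fintype.card_fin]
    have h1 := hC i _ (half_le_norm_planeStretch_circleCurve ht β)
    have h2 : |C i| ≤ C' := Finset.single_le_sum (f := fun i => |C i|) (fun i _ => abs_nonneg _)
      (Finset.mem_range.2 (Nat.lt_succ_of_le hi))
    have h3 : (t : ℝ) ^ i ≤ (t : ℝ) ^ n := pow_le_pow_right₀ ht hi
    refine mul_le_mul (h1.trans ((le_abs_self _).trans h2)) ?_ (by positivity) hC0
    exact (pow_le_pow_left₀ (norm_nonneg _) hop i).trans h3
  · intro i hi1 hi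
    rw [iteratedFDerivWithin_univ]
    exact (hD i hi β hβ).trans (le_self_pow₀ hD1 (by omega))

lemma exists_psSeminorm_growth_bound (hε : ε₁ (-1) * ε₂ (-1) = (-1) ^ m) (f : PS m ε₁ ε₂)
    (N : ℕ) : ∃ C, ∀ t : ℝˣ, 1 ≤ (t : ℝ) → psSeminorm N (psAction m ε₁ ε₂ (embGL1 t) f) ≤
      (t : ℝ) ^ ((m : ℝ) / 2) * (C * (t : ℝ) ^ N) := by
  choose C hC using exists_growth_bound hε f
  refine ⟨∑ n ∈ Finset.range (N + 1), |C n|, fun t ht => ?_⟩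
  rw [psSeminorm_apply, Finset.sum_mul, Finset.mul_sum]
  refine Finset.sum_le_sum fun n hn => (hC n t ht).trans ?_
  have h1 : (t : ℝ) ^ n ≤ (t : ℝ) ^ N := pow_le_pow_right₀ ht (by
    have := Finset.mem_range.1 hn
    omega)
  have h2 : (0 : ℝ) < t := by linarith
  gcongr
  exact le_abs_self _

end

section

open Filter Topology

/-! ### Schwartz functions and flat functions -/

theorem isFrechet_schwartz : IsFrechet 𝓢(ℝ, ℂ) where
  firstCountable := inferInstance
  complete u hu := by
    have hc : ∀ k n : ℕ, ∀ ε > 0, ∃ N, ∀ i ≥ N, ∀ j ≥ N,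
        SchwartzMap.seminorm ℝ k n (u i - u j) < ε := fun k n ε hε =>
      hu {f | SchwartzMap.seminorm ℝ k n f < ε}
        ((isOpen_lt ((schwartz_withSeminorms ℝ ℝ ℂ).continuous_seminorm (k, n))
          continuous_const).mem_nhds (by simpa using hε))
    have hsub : ∀ n i j x, iteratedDeriv n (⇑(u i - u j)) x =
        iteratedDeriv n (u i) x - iteratedDeriv n (u j) x := fun n i j x =>
      iteratedDeriv_sub ((u i).smooth n).contDiffAt ((u j).smooth n).contDiffAt
    have h1 : ∀ n, ∃ k : ℝ → ℂ, TendstoUniformly (fun i => iteratedDeriv n (u i)) k atTop := by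
      refine fun n => exists_tendstoUniformly_of_cauchy fun ε hε => ?_
      obtain ⟨N, hN⟩ := hc 0 n ε hε
      refine ⟨N, fun i hi j hj x => ?_⟩
      have h2 := SchwartzMap.le_seminorm' ℝ 0 n (u i - u j) x
      rw [pow_zero, one_mul, hsub] at h2
      exact h2.trans_lt (hN i hi j hj)
    choose g hg using h1
    obtain ⟨hsm, hit⟩ := contDiff_of_tendstoUniformly (fun i => (u i).smooth') hg
    have hlim : ∀ n x, Tendsto (fun i => iteratedDeriv n (u i) x) atTop (𝓝 (g n x)) :=
      fun n x => (hg n).tendsto_at x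
    have hle : ∀ k n ε, 0 < ε → ∃ N, ∀ i ≥ N, ∀ x,
        |x| ^ k * ‖iteratedDeriv n (u i) x - g n x‖ ≤ ε := by
      intro k n ε hε
      obtain ⟨N, hN⟩ := hc k n ε hε
      refine ⟨N, fun i hi x => ?_⟩
      refine le_of_tendsto (((hlim n x).const_sub _).norm.const_mul _)
        ((eventually_ge_atTop N).mono fun j hj => ?_)
      have h2 := SchwartzMap.le_seminorm' ℝ k n (u i - u j) x
      rw [hsub] at h2
      exact h2.trans (hN i hi j hj).le
    let f : 𝓢(ℝ, ℂ) :=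
      { toFun := g 0
        smooth' := hsm
        decay' := fun k n => by
          obtain ⟨N, hN⟩ := hle k n 1 one_pos
          refine ⟨1 + SchwartzMap.seminorm ℝ k n (u N), fun x => ?_⟩
          rw [norm_iteratedFDeriv_eq_norm_iteratedDeriv, hit, Real.norm_eq_abs]
          have h2 := hN N le_rfl x
          have h3 := SchwartzMap.le_seminorm' ℝ k n (u N) x
          have h4 : ‖g n x‖ ≤ ‖iteratedDeriv n (u N) x - g n x‖ + ‖iteratedDeriv n (u N) x‖ := by
            rw [norm_sub_rev]
            simpa using norm_add_le (g n x - iteratedDeriv n (u N) x) (iteratedDeriv n (u N) x)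
          have h5 := mul_le_mul_of_nonneg_left h4 (pow_nonneg (abs_nonneg x) k)
          rw [mul_add] at h5
          linarith }
    refine ⟨f, ((schwartz_withSeminorms ℝ ℝ ℂ).tendsto_nhds_atTop u f).2 ?_⟩
    rintro ⟨k, n⟩ ε hε
    obtain ⟨N, hN⟩ := hle k n (ε / 2) (half_pos hε)
    refine ⟨N, fun i hi => lt_of_le_of_lt ?_ (half_lt_self hε)⟩
    refine SchwartzMap.seminorm_le_bound' ℝ k n _ (half_pos hε).le fun x => ?_
    have h2 : iteratedDeriv n (⇑(u i - f)) x = iteratedDeriv n (u i) x - g n x := by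
      rw [← hit n]
      exact iteratedDeriv_sub ((u i).smooth n).contDiffAt (f.smooth n).contDiffAt
    rw [h2]
    exact hN i hi x

lemma continuous_iteratedDeriv_apply (n : ℕ) (x : ℝ) :
    Continuous fun f : 𝓢(ℝ, ℂ) => iteratedDeriv n f x := by
  let L : 𝓢(ℝ, ℂ) →+ ℂ :=
    { toFun := fun f => iteratedDeriv n f x
      map_zero' := by
        have h2 : (⇑(0 : 𝓢(ℝ, ℂ))) = fun _ => (0 : ℂ) := rfl
        rw [h2, iteratedDeriv_const]
        simp
      map_add' := fun f g => iteratedDeriv_add (f.smooth n).contDiffAt (g.smooth n).contDiffAt }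
  refine continuous_of_continuousAt_zero L ?_
  rw [ContinuousAt, map_zero]
  refine squeeze_zero_norm (a := fun f => SchwartzMap.seminorm ℝ 0 n f) (fun f => ?_) ?_
  · have := SchwartzMap.le_seminorm' ℝ 0 n f x
    rwa [pow_zero, one_mul] at this
  · have := ((schwartz_withSeminorms ℝ ℝ ℂ).continuous_seminorm (0, n)).tendsto 0
    simpa using this

lemma isClosed_schwartzUnits : IsClosed (schwartzUnits : Set 𝓢(ℝ, ℂ)) := by
  have : (schwartzUnits : Set 𝓢(ℝ, ℂ)) = ⋂ n : ℕ, {f : 𝓢(ℝ, ℂ) | iteratedDeriv n f 0 = 0} := by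
    ext f
    simp [schwartzUnits]
  rw [this]
  exact isClosed_iInter fun n => isClosed_eq (continuous_iteratedDeriv_apply n 0) continuous_const

theorem isFrechet_schwartzUnits : IsFrechet schwartzUnits :=
  isFrechet_schwartz.of_isClosed isClosed_schwartzUnits

/-- Smooth functions all of whose derivatives vanish at `0`. -/
structure IsFlat (g : ℝ → ℂ) : Prop where
  contDiff : ContDiff ℝ ∞ g
  iteratedDeriv_zero : ∀ n, iteratedDeriv n g 0 = 0

lemma contDiff_deriv {g : ℝ → ℂ} (hg : ContDiff ℝ ∞ g) : ContDiff ℝ ∞ (deriv g) := by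
  have := (contDiff_succ_iff_deriv (n := ∞) (f := g) (𝕜 := ℝ)).1 (by simpa using hg)
  exact this.2.2

lemma IsFlat.deriv {g : ℝ → ℂ} (hg : IsFlat g) : IsFlat (_root_.deriv g) where
  contDiff := contDiff_deriv hg.contDiff
  iteratedDeriv_zero n := by
    rw [← iteratedDeriv_succ']
    exact hg.iteratedDeriv_zero (n + 1)

lemma IsFlat.mul {a g : ℝ → ℂ} (ha : ContDiff ℝ ∞ a) (hg : IsFlat g) :
    IsFlat (fun x => a x * g x) where
  contDiff := ha.mul hg.contDiff
  iteratedDeriv_zero n := by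
    induction n generalizing a g with
    | zero => simpa using Or.inr (by simpa using hg.iteratedDeriv_zero 0)
    | succ n ih =>
      have hd : _root_.deriv (fun x => a x * g x) =
          (fun x => _root_.deriv a x * g x) + fun x => a x * _root_.deriv g x := by
        funext x
        exact deriv_fun_mul ((ha.differentiable (by simp)) x)
          ((hg.contDiff.differentiable (by simp)) x)
      have h1 : ContDiff ℝ n (fun x => _root_.deriv a x * g x) :=
        ((contDiff_deriv ha).mul hg.contDiff).of_le (by exact_mod_cast le_top)
      have h2 : ContDiff ℝ n (fun x => a x * _root_.deriv g x) :=
        (ha.mul hg.deriv.contDiff).of_le (by exact_mod_cast le_top)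
      rw [iteratedDeriv_succ', hd, iteratedDeriv_add h1.contDiffAt h2.contDiffAt,
        ih (contDiff_deriv ha) hg, ih ha hg.deriv, add_zero]

lemma IsFlat.apply_zero {g : ℝ → ℂ} (hg : IsFlat g) : g 0 = 0 := by
  simpa using hg.iteratedDeriv_zero 0

/-- Taylor's estimate: a function whose derivatives of order less than `N` vanish at zero. -/
lemma exists_bound_of_iteratedDeriv_eq_zero {g : ℝ → ℂ} (hg : ContDiff ℝ ∞ g) (N : ℕ)
    (h0 : ∀ n < N, iteratedDeriv n g 0 = 0) : ∃ C, ∀ x, |x| ≤ 1 → ‖g x‖ ≤ C * |x| ^ N := by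
  induction N generalizing g with
  | zero =>
    obtain ⟨C, hC⟩ := (isCompact_Icc (a := (-1 : ℝ)) (b := 1)).exists_bound_of_continuousOn
      hg.continuous.continuousOn
    exact ⟨C, fun x hx => by simpa using hC x (abs_le.1 hx)⟩
  | succ N ih =>
    obtain ⟨C, hC⟩ := ih (contDiff_deriv hg) fun n hn => by
      rw [← iteratedDeriv_succ']
      exact h0 (n + 1) (by omega)
    refine ⟨C, fun x hx => ?_⟩
    have hd : ∀ y ∈ Metric.closedBall (0 : ℝ) |x|, ‖deriv g y‖ ≤ C * |x| ^ N := by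
      intro y hy
      have hy' : |y| ≤ |x| := by simpa using hy
      have hC0 : 0 ≤ C := by
        have := (norm_nonneg _).trans (hC 1 (by simp))
        simpa using this
      refine (hC y (hy'.trans hx)).trans ?_
      gcongr
    have := (convex_closedBall (0 : ℝ) |x|).norm_image_sub_le_of_norm_deriv_le
      (fun y _ => (hg.differentiable (by simp)) y) hd
      (Metric.mem_closedBall_self (abs_nonneg x)) (by simp : x ∈ Metric.closedBall (0 : ℝ) |x|)
    have h00 : g 0 = 0 := by simpa using h0 0 (by omega)
    rw [h00, sub_zero, sub_zero, Real.norm_eq_abs] at this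
    rw [pow_succ, ← mul_assoc]
    exact this

lemma IsFlat.exists_bound {g : ℝ → ℂ} (hg : IsFlat g) (N : ℕ) :
    ∃ C, ∀ x, |x| ≤ 1 → ‖g x‖ ≤ C * |x| ^ N :=
  exists_bound_of_iteratedDeriv_eq_zero hg.contDiff N fun n _ => hg.iteratedDeriv_zero n

lemma hasDerivAt_zero_of_sq_bound {g : ℝ → ℂ} (h0 : g 0 = 0) {C : ℝ}
    (hC : ∀ x, |x| ≤ 1 → ‖g x‖ ≤ C * |x| ^ 2) : HasDerivAt g 0 0 := by
  rw [hasDerivAt_iff_isLittleO]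
  have h1 : (fun x : ℝ => g x - g 0 - (x - 0) • (0 : ℂ)) =O[𝓝 0] fun x : ℝ => x ^ 2 := by
    refine Asymptotics.IsBigO.of_bound C ?_
    filter_upwards [Metric.closedBall_mem_nhds (0 : ℝ) one_pos] with x hx
    have := hC x (by simpa using hx)
    simpa [h0] using this
  refine h1.trans_isLittleO ?_
  simpa using Asymptotics.isLittleO_pow_id (𝕜 := ℝ) (n := 2) (by norm_num)

lemma schwartzUnits_isFlat {f : 𝓢(ℝ, ℂ)} (hf : f ∈ schwartzUnits) : IsFlat f :=
  ⟨f.smooth', hf⟩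

/-- A smooth function with rapidly decreasing derivatives, as a Schwartz function. -/
def schwartzOfBound (g : ℝ → ℂ) (hg : ContDiff ℝ ∞ g)
    (hb : ∀ n k : ℕ, ∃ C, ∀ x, |x| ^ k * ‖iteratedDeriv n g x‖ ≤ C) : 𝓢(ℝ, ℂ) where
  toFun := g
  smooth' := hg
  decay' k n := by
    obtain ⟨C, hC⟩ := hb n k
    exact ⟨C, fun x => by
      rw [norm_iteratedFDeriv_eq_norm_iteratedDeriv]
      exact hC x⟩

/-! ### Multiplication of flat Schwartz functions by signed powers of |x|. -/

/-- The character-like function `|x|^s` on the positive axis and `c |x|^s` on the negative axis. -/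
def signPow (c : ℂ) (s : ℝ) (x : ℝ) : ℂ := (if 0 < x then 1 else c) * ((|x| ^ s : ℝ) : ℂ)

lemma norm_signPow_le (c : ℂ) (s x : ℝ) : ‖signPow c s x‖ ≤ max 1 ‖c‖ * |x| ^ s := by
  rw [signPow, norm_mul, Complex.norm_real, Real.norm_eq_abs,
    abs_of_nonneg (Real.rpow_nonneg (abs_nonneg x) _)]
  gcongr
  split_ifs
  · simp
  · exact le_max_right _ _

/-- On the negative axis the derivative of (-x)^s is -s(-x)^{s-1}; hence the change of c into -c. -/
lemma hasDerivAt_signPow (c : ℂ) (s : ℝ) {x : ℝ} (hx : x ≠ 0) :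
    HasDerivAt (signPow c s) (s * signPow (-c) (s - 1) x) x := by
  rcases lt_or_gt_of_ne hx with h | h
  · have h1 : HasDerivAt (fun y : ℝ => c * (((-y) ^ s : ℝ) : ℂ))
        (c * ((-(s * (-x) ^ (s - 1)) : ℝ) : ℂ)) x := by
      have h2 := (Real.hasDerivAt_rpow_const (x := -x) (p := s) (Or.inl (by linarith))).comp x
        (hasDerivAt_neg x)
      have h3 : HasDerivAt (fun y : ℝ => (-y) ^ s) (-(s * (-x) ^ (s - 1))) x := by
        simpa [Function.comp_def] using h2
      exact h3.ofReal_comp.const_mul c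
    have h4 : signPow c s =ᶠ[𝓝 x] fun y : ℝ => c * (((-y) ^ s : ℝ) : ℂ) := by
      filter_upwards [gt_mem_nhds h] with y hy
      simp [signPow, hy.not_gt, abs_of_neg hy]
    refine (h1.congr_of_eventuallyEq h4).congr_deriv ?_
    rw [signPow, if_neg h.not_gt, abs_of_neg h]
    push_cast
    ring
  · have h1 : HasDerivAt (fun y : ℝ => ((y ^ s : ℝ) : ℂ)) (((s * x ^ (s - 1)) : ℝ) : ℂ) x :=
      (Real.hasDerivAt_rpow_const (x := x) (p := s) (Or.inl hx)).ofReal_comp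
    have h4 : signPow c s =ᶠ[𝓝 x] fun y : ℝ => ((y ^ s : ℝ) : ℂ) := by
      filter_upwards [lt_mem_nhds h] with y hy
      simp [signPow, hy, abs_of_pos hy]
    refine (h1.congr_of_eventuallyEq h4).congr_deriv ?_
    rw [signPow, if_pos h, abs_of_pos h]
    push_cast
    ring

lemma signPow_mul (c c' : ℂ) (s s' : ℝ) {x : ℝ} (hx : x ≠ 0) :
    signPow c s x * signPow c' s' x = signPow (c * c') (s + s') x := by
  rw [signPow, signPow, signPow, Real.rpow_add (abs_pos.2 hx)]
  push_cast
  split_ifs <;> ring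

lemma signPow_one_zero (x : ℝ) : signPow 1 0 x = 1 := by simp [signPow]

/-- The derivative of a flat Schwartz function. -/
lemma derivCLM_mem_schwartzUnits {φ : 𝓢(ℝ, ℂ)} (hφ : φ ∈ schwartzUnits) :
    SchwartzMap.derivCLM ℂ ℂ φ ∈ schwartzUnits := fun n => by
  have h : ⇑(SchwartzMap.derivCLM ℂ ℂ φ) = deriv φ := funext fun x => rfl
  rw [h]
  exact (schwartzUnits_isFlat hφ).deriv.iteratedDeriv_zero n

/-- Flatness at 0 beats a possible pole of |x|^s, and rapid decrease beats its growth at infinity. A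
single integer N ≥ |s| serves both regions. -/
lemma exists_bound_signPow_mul (c : ℂ) (s : ℝ) {φ : 𝓢(ℝ, ℂ)} (hφ : φ ∈ schwartzUnits) (k : ℕ) :
    ∃ C, ∀ x, |x| ^ k * ‖signPow c s x * φ x‖ ≤ C := by
  obtain ⟨N, hN⟩ := exists_nat_ge |s|
  obtain ⟨C₁, hC₁⟩ := (schwartzUnits_isFlat hφ).exists_bound N
  have hC₁0 : 0 ≤ C₁ := by
    have := (norm_nonneg _).trans (hC₁ 1 (by simp))
    simpa using this
  set A := max 1 ‖c‖
  have hA : 0 ≤ A := zero_le_one.trans (le_max_left _ _)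
  set C₂ := SchwartzMap.seminorm ℝ (k + N) 0 φ
  have hC₂0 : 0 ≤ C₂ := apply_nonneg _ _
  refine ⟨A * C₁ + A * C₂, fun x => ?_⟩
  have h1 := norm_signPow_le c s x
  rw [norm_mul]
  by_cases hx0 : x = 0
  · rw [hx0, (schwartzUnits_isFlat hφ).apply_zero, norm_zero, mul_zero, mul_zero]
    positivity
  have hx : 0 < |x| := abs_pos.2 hx0
  rcases le_total |x| 1 with hx1 | hx1
  · have h2 : |x| ^ s * |x| ^ N ≤ 1 := by
      rw [← Real.rpow_natCast, ← Real.rpow_add hx]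
      refine Real.rpow_le_one hx.le hx1 ?_
      have := neg_abs_le s
      linarith
    have h3 : |x| ^ k ≤ 1 := pow_le_one₀ hx.le hx1
    calc |x| ^ k * (‖signPow c s x‖ * ‖φ x‖)
        ≤ 1 * ((A * |x| ^ s) * (C₁ * |x| ^ N)) := by
          gcongr
          exact hC₁ x hx1
      _ = A * C₁ * (|x| ^ s * |x| ^ N) := by ring
      _ ≤ A * C₁ * 1 := by gcongr
      _ ≤ A * C₁ + A * C₂ := by nlinarith [mul_nonneg hA hC₂0]
  · have h2 : |x| ^ s ≤ |x| ^ N := by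
      rw [← Real.rpow_natCast]
      exact Real.rpow_le_rpow_of_exponent_le hx1 ((le_abs_self s).trans hN)
    have h3 := SchwartzMap.le_seminorm' ℝ (k + N) 0 φ x
    rw [iteratedDeriv_zero] at h3
    calc |x| ^ k * (‖signPow c s x‖ * ‖φ x‖)
        ≤ |x| ^ k * ((A * |x| ^ N) * ‖φ x‖) := by
          gcongr
          exact h1.trans (by gcongr)
      _ = A * (|x| ^ (k + N) * ‖φ x‖) := by ring
      _ ≤ A * C₂ := by gcongr
      _ ≤ A * C₁ + A * C₂ := by nlinarith [mul_nonneg hA hC₁0]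

lemma deriv_signPow_mul (c : ℂ) (s : ℝ) {φ : 𝓢(ℝ, ℂ)} (hφ : φ ∈ schwartzUnits) (x : ℝ) :
    HasDerivAt (fun x => signPow c s x * φ x)
      (signPow (-c) (s - 1) x * ((s : ℂ) • φ) x +
        signPow c s x * SchwartzMap.derivCLM ℂ ℂ φ x) x := by
  by_cases hx : x = 0
  · have h0 := (schwartzUnits_isFlat hφ).apply_zero
    have h0' := (schwartzUnits_isFlat (derivCLM_mem_schwartzUnits hφ)).apply_zero
    -- Lowering the exponent by 2 leaves a factor |x|² over, which forces the derivative at 0 to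
    -- vanish.
    obtain ⟨C, hC⟩ := exists_bound_signPow_mul c (s - 2) hφ 0
    have hd : HasDerivAt (fun x => signPow c s x * φ x) 0 0 := by
      refine hasDerivAt_zero_of_sq_bound (C := C) (by simp [h0]) fun y _ => ?_
      by_cases hy : y = 0
      · simp [hy, h0]
      · have h2 := hC y
        have h3 : signPow c s y = signPow c (s - 2) y * ((|y| ^ (2 : ℕ) : ℝ) : ℂ) := by
          have := signPow_mul c 1 (s - 2) 2 hy
          rw [mul_one, sub_add_cancel] at this
          rw [← this]
          congr 1
          simp [signPow]
        rw [pow_zero, one_mul] at h2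
        rw [h3, mul_right_comm, norm_mul, Complex.norm_real, Real.norm_eq_abs,
          abs_of_nonneg (by positivity : (0 : ℝ) ≤ |y| ^ 2)]
        gcongr
    have e : ((s : ℂ) • φ) 0 = 0 := by
      change (s : ℂ) • φ 0 = 0
      rw [h0, smul_zero]
    rw [hx, e, h0', mul_zero, mul_zero, add_zero]
    exact hd
  · have h1 := (hasDerivAt_signPow c s hx).mul (φ.differentiable x).hasDerivAt
    refine h1.congr_deriv ?_
    change _ = signPow (-c) (s - 1) x * ((s : ℂ) • φ x) + signPow c s x * deriv φ x
    rw [smul_eq_mul]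
    ring

/-- The derivative of such a product is a sum of two products of the same kind, with data (-c, s -
1, sφ) and (c, s, φ'). The induction on n therefore needs all c, s and φ at once. -/
lemma signPow_mul_aux (n : ℕ) : ∀ (c : ℂ) (s : ℝ) (φ : 𝓢(ℝ, ℂ)), φ ∈ schwartzUnits →
    ContDiff ℝ n (fun x => signPow c s x * φ x) ∧
    iteratedDeriv n (fun x => signPow c s x * φ x) 0 = 0 ∧
    ∀ k : ℕ, ∃ C, ∀ x, |x| ^ k * ‖iteratedDeriv n (fun x => signPow c s x * φ x) x‖ ≤ C := by
  induction n with
  | zero =>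
    intro c s φ hφ
    refine ⟨contDiff_zero.2 (continuous_iff_continuousAt.2 fun x =>
      (deriv_signPow_mul c s hφ x).continuousAt), ?_, fun k => ?_⟩
    · simp [(schwartzUnits_isFlat hφ).apply_zero]
    · simpa only [iteratedDeriv_zero] using exists_bound_signPow_mul c s hφ k
  | succ n ih =>
    intro c s φ hφ
    have hd : deriv (fun x => signPow c s x * φ x) =
        (fun x => signPow (-c) (s - 1) x * ((s : ℂ) • φ) x) +
          fun x => signPow c s x * SchwartzMap.derivCLM ℂ ℂ φ x :=
      funext fun x => (deriv_signPow_mul c s hφ x).deriv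
    obtain ⟨h1, h2, h3⟩ := ih (-c) (s - 1) ((s : ℂ) • φ) (schwartzUnits.smul_mem _ hφ)
    obtain ⟨k1, k2, k3⟩ := ih c s _ (derivCLM_mem_schwartzUnits hφ)
    have hit : ∀ x, iteratedDeriv (n + 1) (fun x => signPow c s x * φ x) x =
        iteratedDeriv n (fun x => signPow (-c) (s - 1) x * ((s : ℂ) • φ) x) x +
        iteratedDeriv n (fun x => signPow c s x * SchwartzMap.derivCLM ℂ ℂ φ x) x := fun x => by
      rw [iteratedDeriv_succ', hd, iteratedDeriv_add h1.contDiffAt k1.contDiffAt]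
    refine ⟨?_, by rw [hit, h2, k2, add_zero], fun k => ?_⟩
    · push_cast
      rw [contDiff_succ_iff_deriv]
      refine ⟨fun x => (deriv_signPow_mul c s hφ x).differentiableAt, by simp, ?_⟩
      rw [hd]
      exact h1.add k1
    · obtain ⟨C, hC⟩ := h3 k
      obtain ⟨C', hC'⟩ := k3 k
      refine ⟨C + C', fun x => ?_⟩
      rw [hit]
      have := mul_le_mul_of_nonneg_left (norm_add_le
        (iteratedDeriv n (fun x => signPow (-c) (s - 1) x * ((s : ℂ) • φ) x) x)
        (iteratedDeriv n (fun x => signPow c s x * SchwartzMap.derivCLM ℂ ℂ φ x) x))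
        (pow_nonneg (abs_nonneg x) k)
      rw [mul_add] at this
      linarith [hC x, hC' x]

/-- Multiplication of flat Schwartz functions by `signPow`. -/
def signPowMul (c : ℂ) (s : ℝ) : schwartzUnits →ₗ[ℂ] schwartzUnits where
  toFun φ := ⟨schwartzOfBound (fun x => signPow c s x * φ.1 x)
    (contDiff_infty.2 fun n => (signPow_mul_aux n c s φ.1 φ.2).1)
    fun n => (signPow_mul_aux n c s φ.1 φ.2).2.2, fun n => (signPow_mul_aux n c s φ.1 φ.2).2.1⟩
  map_add' φ ψ := by
    ext x
    exact mul_add _ _ _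
  map_smul' a φ := by
    ext x
    exact mul_left_comm _ _ _

lemma signPowMul_apply (c : ℂ) (s : ℝ) (φ : schwartzUnits) (x : ℝ) :
    (signPowMul c s φ).1 x = signPow c s x * φ.1 x := rfl

end

section

open Filter Topology

/-! ### Inversion exchanges rapid decrease and flatness -/

/-- The function `y ↦ F(1/y)`, extended by zero. -/
def inversion (F : ℝ → ℂ) (y : ℝ) : ℂ := if y = 0 then 0 else F y⁻¹

/-- The Schwartz function `x ↦ x^k F(x)`. -/
def powMul (k : ℕ) (F : 𝓢(ℝ, ℂ)) : 𝓢(ℝ, ℂ) := SchwartzMap.smulLeftCLM ℂ (fun x : ℝ => x ^ k) F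

lemma powMul_apply (k : ℕ) (F : 𝓢(ℝ, ℂ)) (x : ℝ) : powMul k F x = (x : ℂ) ^ k * F x := by
  rw [powMul, SchwartzMap.smulLeftCLM_apply_apply (by fun_prop), Complex.real_smul]
  push_cast
  rfl

/-- The derivative of F(1/y) is -y^{-2} F'(1/y), again the inversion of a Schwartz function, namely
of -x²F'(x). This closes the induction that proves smoothness and flatness. -/
lemma hasDerivAt_inversion (F : 𝓢(ℝ, ℂ)) (y : ℝ) :
    HasDerivAt (inversion F) (inversion (⇑(-powMul 2 (SchwartzMap.derivCLM ℂ ℂ F))) y) y := by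
  by_cases hy : y = 0
  · subst hy
    have e : inversion (⇑(-powMul 2 (SchwartzMap.derivCLM ℂ ℂ F))) 0 = 0 := if_pos rfl
    rw [e]
    refine hasDerivAt_zero_of_sq_bound (C := SchwartzMap.seminorm ℝ 2 0 F) (if_pos rfl)
      fun x _ => ?_
    by_cases hx : x = 0
    · simp [hx, inversion]
    · rw [inversion, if_neg hx]
      have h := SchwartzMap.le_seminorm' ℝ 2 0 F x⁻¹
      rw [iteratedDeriv_zero, abs_inv, inv_pow, inv_mul_le_iff₀ (by positivity)] at h
      rwa [mul_comm]
  · have h1 := (F.differentiable y⁻¹).hasDerivAt.scomp y (hasDerivAt_inv hy)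
    have h2 : inversion F =ᶠ[𝓝 y] F ∘ Inv.inv := by
      filter_upwards [isOpen_ne.mem_nhds hy] with z hz
      exact if_neg hz
    refine (h1.congr_of_eventuallyEq h2).congr_deriv ?_
    rw [inversion, if_neg hy]
    change _ = -(powMul 2 (SchwartzMap.derivCLM ℂ ℂ F) y⁻¹)
    rw [powMul_apply, SchwartzMap.derivCLM_apply, Complex.real_smul]
    push_cast
    ring

lemma isFlat_inversion (F : 𝓢(ℝ, ℂ)) : IsFlat (inversion F) := by
  have hd : ∀ F : 𝓢(ℝ, ℂ), deriv (inversion F) =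
      inversion (⇑(-powMul 2 (SchwartzMap.derivCLM ℂ ℂ F))) := fun F =>
    funext fun y => (hasDerivAt_inversion F y).deriv
  constructor
  · rw [contDiff_infty]
    intro n
    induction n generalizing F with
    | zero => exact contDiff_zero.2 (continuous_iff_continuousAt.2 fun y =>
        (hasDerivAt_inversion F y).continuousAt)
    | succ n ih =>
      push_cast
      rw [contDiff_succ_iff_deriv]
      refine ⟨fun y => (hasDerivAt_inversion F y).differentiableAt, by simp, ?_⟩
      rw [hd]
      exact ih _
  · intro n
    induction n generalizing F with
    | zero => simp [inversion]
    | succ n ih => rw [iteratedDeriv_succ', hd, ih]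

/-- The converse passage, from flatness to rapid decrease. In order zero, |g(y)| ≤ C|y|^k reads
|x|^k |F(x)| ≤ C with y = 1/x; and F' corresponds to -y²g', which is flat again. -/
lemma exists_bound_of_flat_at_infinity (n : ℕ) : ∀ {F g : ℝ → ℂ}, ContDiff ℝ ∞ F → IsFlat g →
    (∀ x ≠ 0, F x = g x⁻¹) → ∀ k : ℕ, ∃ C, ∀ x, |x| ^ k * ‖iteratedDeriv n F x‖ ≤ C := by
  induction n with
  | zero =>
    intro F g hF hg h k
    obtain ⟨C₁, hC₁⟩ := hg.exists_bound k
    obtain ⟨C₂, hC₂⟩ := (isCompact_Icc (a := (-1 : ℝ)) (b := 1)).exists_bound_of_continuousOn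
      hF.continuous.continuousOn
    refine ⟨max C₁ C₂, fun x => ?_⟩
    rw [iteratedDeriv_zero]
    rcases le_total |x| 1 with hx | hx
    · refine le_trans ?_ (le_max_right _ _)
      exact (mul_le_of_le_one_left (norm_nonneg _) (pow_le_one₀ (abs_nonneg x) hx)).trans
        (hC₂ x (abs_le.1 hx))
    · have hx0 : x ≠ 0 := by
        rintro rfl
        norm_num at hx
      have hx' : 0 < |x| := abs_pos.2 hx0
      refine le_trans ?_ (le_max_left _ _)
      have h2 := hC₁ x⁻¹ (by rw [abs_inv]; exact inv_le_one_of_one_le₀ hx)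
      rw [← h x hx0, abs_inv, inv_pow, ← div_eq_mul_inv, le_div_iff₀ (by positivity)] at h2
      rwa [mul_comm]
  | succ n ih =>
    intro F g hF hg h k
    simp only [iteratedDeriv_succ']
    have ha : ContDiff ℝ ∞ (fun y : ℝ => -((y : ℂ) ^ 2)) :=
      (Complex.ofRealCLM.contDiff.pow 2).neg
    refine ih (contDiff_deriv hF) (IsFlat.mul ha hg.deriv) (fun x hx => ?_) k
    have h1 : HasDerivAt (g ∘ Inv.inv) _ x :=
      ((hg.contDiff.differentiable (by simp)) x⁻¹).hasDerivAt.scomp x (hasDerivAt_inv hx)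
    have h2 : F =ᶠ[𝓝 x] g ∘ Inv.inv := by
      filter_upwards [isOpen_ne.mem_nhds hx] with z hz
      exact h z hz
    rw [(h1.congr_of_eventuallyEq h2).deriv, Complex.real_smul]
    push_cast
    ring

/-! ### Charts of the principal series -/

variable {m : ℕ} {ε₁ ε₂ : ℝˣ →* ℤˣ}

/-- The restriction of the homogeneous function to the affine line `(1, x)`. -/
def lineChart (f : PS m ε₁ ε₂) (x : ℝ) : ℂ := plane f (1, x)

/-- The restriction of the homogeneous function to the affine line `(y, 1)`. -/
def inftyChart (f : PS m ε₁ ε₂) (y : ℝ) : ℂ := plane f (y, 1)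

lemma one_mk_ne_zero (x : ℝ) : ((1, x) : ℝ × ℝ) ≠ 0 := fun h => one_ne_zero (congrArg Prod.fst h)

lemma mk_one_ne_zero (x : ℝ) : ((x, 1) : ℝ × ℝ) ≠ 0 := fun h => one_ne_zero (congrArg Prod.snd h)

lemma IsHomogeneousPlane.contDiff_line {Φ : ℝ × ℝ → ℂ} (hΦ : IsHomogeneousPlane m Φ) :
    ContDiff ℝ ∞ fun x => Φ (1, x) := by
  rw [← contDiffOn_univ]
  exact hΦ.contDiffOn.comp (by fun_prop) fun x _ => one_mk_ne_zero x

lemma contDiff_lineChart (hε : ε₁ (-1) * ε₂ (-1) = (-1) ^ m) (f : PS m ε₁ ε₂) :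
    ContDiff ℝ ∞ (lineChart f) := (isHomogeneousPlane hε f).contDiff_line

lemma contDiff_inftyChart (hε : ε₁ (-1) * ε₂ (-1) = (-1) ^ m) (f : PS m ε₁ ε₂) :
    ContDiff ℝ ∞ (inftyChart f) := by
  rw [← contDiffOn_univ]
  exact (isHomogeneousPlane hε f).contDiffOn.comp (by fun_prop) fun x _ => mk_one_ne_zero x

lemma plane_eq_lineChart (hε : ε₁ (-1) * ε₂ (-1) = (-1) ^ m) (f : PS m ε₁ ε₂) {c : ℝ}
    (hc : c ≠ 0) (d : ℝ) : plane f (c, d) = ((c : ℂ) ^ m)⁻¹ * lineChart f (d / c) := by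
  rw [lineChart, ← (isHomogeneousPlane hε f).smul c _ hc (one_mk_ne_zero _)]
  congr 1
  ext <;> simp
  field_simp

lemma plane_eq_inftyChart (hε : ε₁ (-1) * ε₂ (-1) = (-1) ^ m) (f : PS m ε₁ ε₂) {d : ℝ}
    (hd : d ≠ 0) (c : ℝ) : plane f (c, d) = ((d : ℂ) ^ m)⁻¹ * inftyChart f (c / d) := by
  rw [inftyChart, ← (isHomogeneousPlane hε f).smul d _ hd (mk_one_ne_zero _)]
  congr 1
  ext <;> simp
  field_simp

lemma lineChart_eq (hε : ε₁ (-1) * ε₂ (-1) = (-1) ^ m) (f : PS m ε₁ ε₂) {x : ℝ} (hx : x ≠ 0) :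
    lineChart f x = ((x : ℂ) ^ m)⁻¹ * inftyChart f x⁻¹ := by
  rw [lineChart, plane_eq_inftyChart hε f hx, one_div]

lemma inftyChart_eq (hε : ε₁ (-1) * ε₂ (-1) = (-1) ^ m) (f : PS m ε₁ ε₂) {y : ℝ} (hy : y ≠ 0) :
    inftyChart f y = ((y : ℂ) ^ m)⁻¹ * lineChart f y⁻¹ := by
  rw [inftyChart, plane_eq_lineChart hε f hy, one_div]

/-- The chart misses only the line c = 0, and continuity of the chart at infinity recovers the
values there. -/
lemma lineChart_injective (hε : ε₁ (-1) * ε₂ (-1) = (-1) ^ m) {f f' : PS m ε₁ ε₂}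
    (h : lineChart f = lineChart f') : f = f' := by
  have h1 : inftyChart f = inftyChart f' := by
    refine Continuous.ext_on (s := {0}ᶜ) (dense_compl_singleton 0)
      (contDiff_inftyChart hε f).continuous (contDiff_inftyChart hε f').continuous fun y hy => ?_
    rw [inftyChart_eq hε f hy, inftyChart_eq hε f' hy, h]
  refine plane_ext ?_
  rintro ⟨c, d⟩ hv
  by_cases hc : c = 0
  · have hd : d ≠ 0 := by
      rintro rfl
      exact hv (by rw [hc]; rfl)
    rw [plane_eq_inftyChart hε f hd, plane_eq_inftyChart hε f' hd, h1]
  · rw [plane_eq_lineChart hε f hc, plane_eq_lineChart hε f' hc, h]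

/-- The homogeneous function on the plane attached to a Schwartz function on the line. -/
def planeOfLine (m : ℕ) (F : ℝ → ℂ) (v : ℝ × ℝ) : ℂ :=
  if v.1 = 0 then 0 else ((v.1 : ℂ) ^ m)⁻¹ * F (v.2 / v.1)

/-- Near the line c = 0 the function is d^{-m} times the inversion of x^m F(x) at c/d. That
inversion is flat at 0, so the value 0 on the line is the smooth extension. -/
lemma isHomogeneousPlane_planeOfLine (m : ℕ) (F : 𝓢(ℝ, ℂ)) :
    IsHomogeneousPlane m (planeOfLine m F) where
  contDiffOn := by
    rintro ⟨c, d⟩ hv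
    refine ContDiffAt.contDiffWithinAt ?_
    by_cases hc : c = 0
    · have hd : d ≠ 0 := by
        rintro rfl
        exact hv (by rw [hc]; rfl)
      have h1 : ContDiffAt ℝ ∞ (fun v : ℝ × ℝ => ((v.2 : ℂ) ^ m)⁻¹ *
          inversion (powMul m F) (v.1 / v.2)) (c, d) := by
        refine ContDiffAt.mul (ContDiffAt.inv ?_ (pow_ne_zero _ (by simpa using hd))) ?_
        · exact (Complex.ofRealCLM.contDiff.comp contDiff_snd).contDiffAt.pow m
        · exact ((isFlat_inversion (powMul m F)).contDiff.contDiffAt).comp (c, d)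
            (contDiff_fst.contDiffAt.div contDiff_snd.contDiffAt hd)
      refine h1.congr_of_eventuallyEq ?_
      have : ∀ᶠ v : ℝ × ℝ in 𝓝 (c, d), v.2 ≠ 0 :=
        continuous_snd.continuousAt.eventually_ne hd
      filter_upwards [this] with v hv2
      rw [planeOfLine, inversion]
      by_cases hv1 : v.1 = 0
      · simp [hv1]
      · rw [if_neg hv1, if_neg (div_ne_zero hv1 hv2), powMul_apply, inv_div]
        have h2 : ((v.2 : ℝ) : ℂ) ≠ 0 := by simpa using hv2
        have h3 : ((v.1 : ℝ) : ℂ) ≠ 0 := by simpa using hv1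
        push_cast
        rw [div_pow]
        field_simp
    · have h1 : ContDiffAt ℝ ∞ (fun v : ℝ × ℝ => ((v.1 : ℂ) ^ m)⁻¹ * F (v.2 / v.1)) (c, d) := by
        refine ContDiffAt.mul (ContDiffAt.inv ?_ (pow_ne_zero _ (by simpa using hc))) ?_
        · exact (Complex.ofRealCLM.contDiff.comp contDiff_fst).contDiffAt.pow m
        · exact (F.smooth'.contDiffAt).comp (c, d)
            (contDiff_snd.contDiffAt.div contDiff_fst.contDiffAt hc)
      refine h1.congr_of_eventuallyEq ?_
      have : ∀ᶠ v : ℝ × ℝ in 𝓝 (c, d), v.1 ≠ 0 :=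
        continuous_fst.continuousAt.eventually_ne hc
      filter_upwards [this] with v hv
      rw [planeOfLine, if_neg hv]
  smul t v ht hv := by
    simp only [planeOfLine, Prod.smul_fst, Prod.smul_snd, smul_eq_mul]
    by_cases hv1 : v.1 = 0
    · simp [hv1]
    · rw [if_neg hv1, if_neg (mul_ne_zero ht hv1), mul_div_mul_left _ _ ht]
      push_cast
      rw [mul_pow, mul_inv, mul_assoc]

/-- The embedding of the Schwartz space of the big cell into the principal series. -/
def ofSchwartz (hε : ε₁ (-1) * ε₂ (-1) = (-1) ^ m) : 𝓢(ℝ, ℂ) →ₗ[ℂ] PS m ε₁ ε₂ where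
  toFun F := ofPlane hε _ (isHomogeneousPlane_planeOfLine m F)
  map_add' F F' := plane_ext fun v hv => by
    rw [plane_add, plane_ofPlane hε _ hv, plane_ofPlane hε _ hv, plane_ofPlane hε _ hv]
    simp only [planeOfLine]
    split_ifs
    · simp
    · exact mul_add _ _ _
  map_smul' c F := plane_ext fun v hv => by
    rw [plane_ofPlane hε _ hv, RingHom.id_apply, plane_smul, plane_ofPlane hε _ hv]
    simp only [planeOfLine]
    split_ifs
    · simp
    · exact mul_left_comm _ _ _

lemma lineChart_ofSchwartz (hε : ε₁ (-1) * ε₂ (-1) = (-1) ^ m) (F : 𝓢(ℝ, ℂ)) :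
    lineChart (ofSchwartz hε F : PS m ε₁ ε₂) = F := by
  funext x
  refine (plane_ofPlane hε (isHomogeneousPlane_planeOfLine m F) (one_mk_ne_zero x)).trans ?_
  simp [planeOfLine]

lemma isFlat_inftyChart_ofSchwartz (hε : ε₁ (-1) * ε₂ (-1) = (-1) ^ m) (F : 𝓢(ℝ, ℂ)) :
    IsFlat (inftyChart (ofSchwartz hε F : PS m ε₁ ε₂)) := by
  convert isFlat_inversion (powMul m F) using 1
  funext y
  refine (plane_ofPlane hε (isHomogeneousPlane_planeOfLine m F) (mk_one_ne_zero y)).trans ?_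
  simp only [planeOfLine, inversion]
  split_ifs
  · rfl
  · rw [powMul_apply]
    push_cast
    rw [inv_pow, one_div]

/-- If the chart at infinity is flat, then the function on the big cell is a Schwartz function. -/
lemma exists_schwartz (hε : ε₁ (-1) * ε₂ (-1) = (-1) ^ m) {f : PS m ε₁ ε₂}
    (hf : IsFlat (inftyChart f)) : ∃ F : 𝓢(ℝ, ℂ), ofSchwartz hε F = f := by
  have ha : ContDiff ℝ ∞ (fun y : ℝ => (y : ℂ) ^ m) := Complex.ofRealCLM.contDiff.pow m
  have hb := fun n => exists_bound_of_flat_at_infinity n (contDiff_lineChart hε f)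
    (IsFlat.mul ha hf) fun x hx => by
      rw [lineChart_eq hε f hx]
      push_cast
      rw [inv_pow]
  refine ⟨schwartzOfBound (lineChart f) (contDiff_lineChart hε f) hb, lineChart_injective hε ?_⟩
  rw [lineChart_ofSchwartz]
  rfl

end

section

open Filter Topology MeasureTheory

variable {m : ℕ} {ε₁ ε₂ : ℝˣ →* ℤˣ}

/-! ### Integration of homogeneous functions of degree `-2` -/

/-- Continuous functions on the punctured plane which are homogeneous of degree `-2`. -/
structure IsDensity (Θ : ℝ × ℝ → ℂ) : Prop where
  continuousOn : ContinuousOn Θ {0}ᶜ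
  smul : ∀ (t : ℝ) (v : ℝ × ℝ), t ≠ 0 → v ≠ 0 → Θ (t • v) = ((t : ℂ) ^ 2)⁻¹ * Θ v

/-- The invariant integral of a homogeneous function of degree `-2`. -/
def densityIntegral (Θ : ℝ × ℝ → ℂ) : ℂ :=
  ∫ α in (0 : ℝ)..Real.pi, Θ (-Real.sin α, Real.cos α)

lemma IsDensity.continuous_circle {Θ : ℝ × ℝ → ℂ} (h : IsDensity Θ) :
    Continuous fun α => Θ (-Real.sin α, Real.cos α) := by
  rw [← continuousOn_univ]
  exact h.continuousOn.comp (by fun_prop) fun α _ => sin_cos_ne_zero α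

lemma IsDensity.continuous_line {Θ : ℝ × ℝ → ℂ} (h : IsDensity Θ) :
    Continuous fun x => Θ (1, x) := by
  rw [← continuousOn_univ]
  exact h.continuousOn.comp (by fun_prop) fun x _ => one_mk_ne_zero x

lemma IsDensity.periodic {Θ : ℝ × ℝ → ℂ} (h : IsDensity Θ) :
    Function.Periodic (fun α => Θ (-Real.sin α, Real.cos α)) Real.pi := fun α => by
  have := h.smul (-1) _ (by simp) (sin_cos_ne_zero α)
  simp only [Prod.smul_mk, smul_eq_mul, neg_mul, one_mul, neg_neg] at this
  simp only [Real.sin_add_pi, Real.cos_add_pi, neg_neg, this]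
  norm_num

lemma IsDensity.line_eq {Θ : ℝ × ℝ → ℂ} (h : IsDensity Θ) (x : ℝ) :
    Θ (1, x) = (((1 + x ^ 2)⁻¹ : ℝ) : ℂ) * Θ (-Real.sin (Real.arctan x + Real.pi / 2),
      Real.cos (Real.arctan x + Real.pi / 2)) := by
  have hpos : 0 < Real.cos (Real.arctan x) := Real.cos_arctan_pos x
  rw [Real.sin_add_pi_div_two, Real.cos_add_pi_div_two]
  have e : ((-Real.cos (Real.arctan x), -Real.sin (Real.arctan x)) : ℝ × ℝ) =
      (-Real.cos (Real.arctan x)) • (1, x) := by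
    have h1 : Real.sin (Real.arctan x) = Real.cos (Real.arctan x) * x := by
      conv_rhs => rw [← Real.tan_arctan x, Real.arctan_tan (Real.neg_pi_div_two_lt_arctan x)
        (Real.arctan_lt_pi_div_two x), Real.tan_eq_sin_div_cos]
      field_simp
    ext
    · simp
    · simp [h1]
  rw [e, h.smul _ _ (by linarith) (one_mk_ne_zero x),
    show (1 + x ^ 2)⁻¹ = Real.cos (Real.arctan x) ^ 2 by rw [Real.cos_sq_arctan, one_div]]
  have : ((Real.cos (Real.arctan x) : ℝ) : ℂ) ≠ 0 := by exact_mod_cast hpos.ne'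
  push_cast
  push_cast at this
  field_simp

lemma IsDensity.integrable_line {Θ : ℝ × ℝ → ℂ} (h : IsDensity Θ) :
    Integrable fun x => Θ (1, x) := by
  obtain ⟨C, hC⟩ := exists_bound_of_periodic Real.pi_pos h.periodic h.continuous_circle
  refine (integrable_inv_one_add_sq.mul_const C).mono'
    h.continuous_line.aestronglyMeasurable (Eventually.of_forall fun x => ?_)
  rw [h.line_eq x, norm_mul, Complex.norm_real, Real.norm_eq_abs,
    abs_of_nonneg (by positivity : (0 : ℝ) ≤ (1 + x ^ 2)⁻¹)]
  gcongr
  exact hC _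

/-- The substitution α = arctan x + π/2 carries the affine line to a half circle, and its Jacobian
(1 + x²)^{-1} is exactly the factor coming from homogeneity of degree -2. -/
lemma IsDensity.integral_line {Θ : ℝ × ℝ → ℂ} (h : IsDensity Θ) :
    ∫ x, Θ (1, x) = densityIntegral Θ := by
  set c : ℝ → ℂ := fun α => Θ (-Real.sin (α + Real.pi / 2), Real.cos (α + Real.pi / 2)) with hc
  have hcc : Continuous c := h.continuous_circle.comp (continuous_add_const _)
  have h1 : ∀ R : ℝ, ∫ x in -R..R, Θ (1, x) =
      ∫ α in -Real.arctan R..Real.arctan R, c α := by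
    intro R
    have h2 := intervalIntegral.integral_deriv_smul_comp (a := -R) (b := R) (f := Real.arctan)
      (f' := fun x => (1 + x ^ 2)⁻¹) (g := c)
      (fun x _ => by simpa using Real.hasDerivAt_arctan x)
      (Continuous.continuousOn (Continuous.inv₀ (by fun_prop) fun x => by positivity)) hcc
    rw [Real.arctan_neg] at h2
    rw [← h2]
    refine intervalIntegral.integral_congr fun x _ => ?_
    simp only [Function.comp_apply, Complex.real_smul]
    exact h.line_eq x
  have h2 := intervalIntegral_tendsto_integral h.integrable_line tendsto_neg_atTop_atBot tendsto_id
  have h3 : Tendsto (fun R : ℝ => ∫ x in -R..R, Θ (1, x)) atTop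
      (𝓝 (∫ α in -(Real.pi / 2)..(Real.pi / 2), c α)) := by
    simp only [h1]
    have hF : Continuous fun r : ℝ => ∫ α in -r..r, c α := by
      have e : (fun r : ℝ => ∫ α in -r..r, c α) =
          fun r : ℝ => (∫ α in (0 : ℝ)..r, c α) - ∫ α in (0 : ℝ)..-r, c α := by
        funext r
        rw [intervalIntegral.integral_interval_sub_left] <;> exact hcc.intervalIntegrable _ _
      rw [e]
      have := intervalIntegral.continuous_primitive (fun a b => hcc.intervalIntegrable a b) 0
        (μ := volume)
      exact this.sub (this.comp continuous_neg)
    exact (hF.tendsto _).comp ((Real.tendsto_arctan_atTop).mono_right nhdsWithin_le_nhds)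
  have h4 := tendsto_nhds_unique h2 h3
  rw [h4, densityIntegral, hc, intervalIntegral.integral_comp_add_right
    (fun α => Θ (-Real.sin α, Real.cos α))]
  congr 1 <;> ring

lemma IsDensity.comp_rowMul {Θ : ℝ × ℝ → ℂ} (h : IsDensity Θ) (g : GL (Fin 2) ℝ) :
    IsDensity fun v => Θ (rowMul v g) where
  continuousOn := h.continuousOn.comp (by unfold rowMul; fun_prop) fun v hv => rowMul_ne_zero hv g
  smul t v ht hv := by
    rw [← h.smul t _ ht (rowMul_ne_zero hv g)]
    congr 1
    ext <;> simp [rowMul] <;> ring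

/-- The integral of densities is relatively invariant under `GL₂(ℝ)`. -/
lemma exists_densityIntegral_comp (g : GL (Fin 2) ℝ) : ∃ c : ℂ, ∀ Θ, IsDensity Θ →
    densityIntegral (fun v => Θ (rowMul v g)) = c * densityIntegral Θ := by
  have hmul : ∀ g g' : GL (Fin 2) ℝ,
      (∃ c : ℂ, ∀ Θ, IsDensity Θ → densityIntegral (fun v => Θ (rowMul v g)) =
        c * densityIntegral Θ) →
      (∃ c : ℂ, ∀ Θ, IsDensity Θ → densityIntegral (fun v => Θ (rowMul v g')) =
        c * densityIntegral Θ) →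
      ∃ c : ℂ, ∀ Θ, IsDensity Θ → densityIntegral (fun v => Θ (rowMul v (g * g'))) =
        c * densityIntegral Θ := by
    rintro g g' ⟨c, hc⟩ ⟨c', hc'⟩
    refine ⟨c * c', fun Θ hΘ => ?_⟩
    rw [mul_assoc, ← hc' Θ hΘ, ← hc _ (hΘ.comp_rowMul g')]
    congr 1
    funext v
    congr 1
    ext <;> simp [rowMul, Units.val_mul, Matrix.mul_apply, Fin.sum_univ_two] <;> ring
  -- Invariance is checked on generators: a Borel element is an affine substitution in the line
  -- integral, and a rotation is a shift in the integral over a period.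
  have hborel : ∀ (a d : ℝˣ) (x : ℝ), ∃ c : ℂ, ∀ Θ, IsDensity Θ →
      densityIntegral (fun v => Θ (rowMul v (borelElt a d x))) = c * densityIntegral Θ := by
    intro a d x
    have ha : (a : ℝ) ≠ 0 := a.ne_zero
    refine ⟨(((a : ℝ) : ℂ) ^ 2)⁻¹ * (|((d : ℝ) / a)⁻¹| : ℝ), fun Θ hΘ => ?_⟩
    rw [← (hΘ.comp_rowMul _).integral_line, ← hΘ.integral_line]
    have e : ∀ y : ℝ, Θ (rowMul (1, y) (borelElt a d x)) =
        (((a : ℝ) : ℂ) ^ 2)⁻¹ * Θ (1, (d : ℝ) / a * y + x / a) := by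
      intro y
      rw [← hΘ.smul a _ ha (one_mk_ne_zero _)]
      congr 1
      ext <;> simp [rowMul, coe_borelElt]
      field_simp
      ring
    simp only [e]
    rw [integral_const_mul, Measure.integral_comp_mul_left (fun z => Θ (1, z + x / a)),
      integral_add_right_eq_self (fun z => Θ (1, z)), Complex.real_smul, mul_assoc]
  have hrot : ∀ β : ℝ, ∃ c : ℂ, ∀ Θ, IsDensity Θ →
      densityIntegral (fun v => Θ (rowMul v (rot β))) = c * densityIntegral Θ := by
    refine fun β => ⟨1, fun Θ hΘ => ?_⟩
    rw [one_mul, densityIntegral, densityIntegral]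
    have e : ∀ α : ℝ, rowMul (-Real.sin α, Real.cos α) (rot β) =
        (-Real.sin (α + β), Real.cos (α + β)) := by
      intro α
      have hr : (rot β : Matrix (Fin 2) (Fin 2) ℝ) =
        !![Real.cos β, Real.sin β; -Real.sin β, Real.cos β] := rfl
      rw [Real.sin_add, Real.cos_add]
      ext <;> simp [rowMul, hr] <;> ring
    simp only [e]
    rw [intervalIntegral.integral_comp_add_right (fun α => Θ (-Real.sin α, Real.cos α))]
    have := hΘ.periodic.intervalIntegral_add_eq β 0
    rw [zero_add] at this
    rw [zero_add, add_comm, this]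
  obtain ⟨x, hx⟩ := eq_borelElt_mul_sectionGL g
  obtain ⟨r, hr, α, hv⟩ := exists_polar (bottomRow_ne_zero g)
  -- Polar coordinates of the bottom row exhibit the section as diag(r⁻¹, r) times a rotation, so g
  -- is a product of the generators treated above.
  have h2 : sectionGL (bottomRow g) (bottomRow_ne_zero g) =
      borelElt (Units.mk0 r hr.ne')⁻¹ (Units.mk0 r hr.ne') 0 * rot α := by
    apply entries_injective
    rw [entries_sectionGL, hv]
    have h3 := Real.sin_sq_add_cos_sq α
    funext i j
    have hr' : (rot α : Matrix (Fin 2) (Fin 2) ℝ) =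
        !![Real.cos α, Real.sin α; -Real.sin α, Real.cos α] := rfl
    rw [entries, Units.val_mul, Matrix.mul_apply, Fin.sum_univ_two, coe_borelElt, hr']
    have h4 : (r * Real.sin α) ^ 2 + (r * Real.cos α) ^ 2 = r ^ 2 := by
      rw [mul_pow, mul_pow, ← mul_add, h3, mul_one]
    fin_cases i <;> fin_cases j <;> simp [sectionEntries, h4] <;> field_simp
  rw [hx, h2]
  exact hmul _ _ (hborel _ _ _) (hmul _ _ (hborel _ _ _) (hrot α))

end

section

open Filter Topology MeasureTheory

variable {m : ℕ} {ε₁ ε₂ : ℝˣ →* ℤˣ}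

/-! ### The subrepresentation `δ(m)` -/

/-- A product of linear forms on the plane. -/
def linearFormProd {n : ℕ} (a b : Fin n → ℂ) (v : ℝ × ℝ) : ℂ :=
  ∏ i, (a i * (v.1 : ℂ) + b i * (v.2 : ℂ))

lemma continuous_linearFormProd {n : ℕ} (a b : Fin n → ℂ) : Continuous (linearFormProd a b) := by
  unfold linearFormProd
  fun_prop

lemma linearFormProd_smul {n : ℕ} (a b : Fin n → ℂ) (t : ℝ) (v : ℝ × ℝ) :
    linearFormProd a b (t • v) = (t : ℂ) ^ n * linearFormProd a b v := by
  rw [linearFormProd, linearFormProd]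
  have : ∀ i, a i * (((t • v).1 : ℝ) : ℂ) + b i * (((t • v).2 : ℝ) : ℂ) =
      (t : ℂ) * (a i * (v.1 : ℂ) + b i * (v.2 : ℂ)) := fun i => by
    simp only [Prod.smul_fst, Prod.smul_snd, smul_eq_mul]
    push_cast
    ring
  simp only [this, Finset.prod_mul_distrib, Finset.prod_const, Finset.card_univ, Fintype.card_fin]

lemma rowMul_rowMul (v : ℝ × ℝ) (g g' : GL (Fin 2) ℝ) :
    rowMul (rowMul v g) g' = rowMul v (g * g') := by
  ext <;> simp [rowMul, Units.val_mul, Matrix.mul_apply, Fin.sum_univ_two] <;> ring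

lemma rowMul_one (v : ℝ × ℝ) : rowMul v 1 = v := by
  ext <;> simp [rowMul]

lemma exists_linearFormProd_rowMul {n : ℕ} (a b : Fin n → ℂ) (g : GL (Fin 2) ℝ) :
    ∃ a' b' : Fin n → ℂ, ∀ v, linearFormProd a b v = linearFormProd a' b' (rowMul v g) := by
  set h := g⁻¹ with hh
  refine ⟨fun i => a i * (h 0 0 : ℝ) + b i * (h 0 1 : ℝ),
    fun i => a i * (h 1 0 : ℝ) + b i * (h 1 1 : ℝ), fun v => ?_⟩
  have hv : v = rowMul (rowMul v g) h := by rw [rowMul_rowMul, hh, mul_inv_cancel, rowMul_one]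
  conv_lhs => rw [hv]
  refine Finset.prod_congr rfl fun i _ => ?_
  simp only [rowMul]
  push_cast
  ring

lemma isDensity_plane_mul (hε : ε₁ (-1) * ε₂ (-1) = (-1) ^ m) (f : PS m ε₁ ε₂) {n : ℕ}
    (hn : n + 2 = m) (a b : Fin n → ℂ) :
    IsDensity fun v => plane f v * linearFormProd a b v where
  continuousOn := (isHomogeneousPlane hε f).contDiffOn.continuousOn.mul
    (continuous_linearFormProd a b).continuousOn
  smul t v ht hv := by
    have ht' : (t : ℂ) ≠ 0 := by simpa using ht
    have e : (t : ℂ) ^ m = (t : ℂ) ^ n * (t : ℂ) ^ 2 := by rw [← hn, pow_add]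
    rw [(isHomogeneousPlane hε f).smul t v ht hv, linearFormProd_smul, e]
    field_simp

/-- The pairing of the principal series with products of linear forms. -/
def formPairing (hε : ε₁ (-1) * ε₂ (-1) = (-1) ^ m) {n : ℕ} (hn : n + 2 = m)
    (a b : Fin n → ℂ) : PS m ε₁ ε₂ →ₗ[ℂ] ℂ where
  toFun f := densityIntegral fun v => plane f v * linearFormProd a b v
  map_add' f f' := by
    rw [densityIntegral, densityIntegral, densityIntegral, ← intervalIntegral.integral_add
      ((isDensity_plane_mul hε f hn a b).continuous_circle.intervalIntegrable _ _)
      ((isDensity_plane_mul hε f' hn a b).continuous_circle.intervalIntegrable _ _)]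
    simp only [plane_add, add_mul]
  map_smul' c f := by
    rw [densityIntegral, densityIntegral, RingHom.id_apply, smul_eq_mul,
      ← intervalIntegral.integral_const_mul]
    simp only [plane_smul, mul_assoc]

/-- The discrete series `δ(m)`: the annihilator of the homogeneous polynomials of degree
`m - 2`. -/
def delta (hε : ε₁ (-1) * ε₂ (-1) = (-1) ^ m) : Subrepresentation (psAction m ε₁ ε₂) where
  -- Writing the degree as n with n + 2 = m avoids truncated subtraction: for m = 1 there is no such
  -- n and the intersection is the whole space.
  toSubmodule := ⨅ (n : ℕ) (hn : n + 2 = m) (a : Fin n → ℂ) (b : Fin n → ℂ),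
    LinearMap.ker (formPairing hε hn a b)
  apply_mem_toSubmodule g f hf := by
    simp only [Submodule.mem_iInf, LinearMap.mem_ker] at hf ⊢
    intro n hn a b
    -- Translating f amounts to translating the form by g⁻¹, up to scalars, and products of linear
    -- forms are stable under this.
    obtain ⟨a', b', h'⟩ := exists_linearFormProd_rowMul a b g
    obtain ⟨c, hc⟩ := exists_densityIntegral_comp g
    have h1 := hc _ (isDensity_plane_mul hε f hn a' b')
    rw [show densityIntegral (fun v => plane f v * linearFormProd a' b' v) = 0 from
      hf n hn a' b', mul_zero] at h1
    change densityIntegral (fun v => plane (psAction m ε₁ ε₂ g f) v * linearFormProd a b v) = 0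
    have h2 : densityIntegral (fun v => plane (psAction m ε₁ ε₂ g f) v * linearFormProd a b v) =
        detChar m ε₁ g.det * densityIntegral
          (fun v => plane f (rowMul v g) * linearFormProd a' b' (rowMul v g)) := by
      rw [densityIntegral, densityIntegral, ← intervalIntegral.integral_const_mul]
      refine intervalIntegral.integral_congr fun α _ => ?_
      simp only [plane_psAction g f (sin_cos_ne_zero α), h', mul_assoc]
    rw [h2, h1, mul_zero]

lemma mem_delta (hε : ε₁ (-1) * ε₂ (-1) = (-1) ^ m) {f : PS m ε₁ ε₂} :
    f ∈ (delta hε).toSubmodule ↔ ∀ (n : ℕ), n + 2 = m → ∀ a b : Fin n → ℂ,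
      densityIntegral (fun v => plane f v * linearFormProd a b v) = 0 := by
  simp only [delta, Submodule.mem_iInf, LinearMap.mem_ker]
  rfl

/-- Integrals of an element of the principal series along a curve on the circle. -/
lemma continuous_integral_circle (θ : ℝ → ℝ) (w : ℝ → ℂ) (hθ : Continuous θ)
    (hw : Continuous w) (a b : ℝ) :
    Continuous fun f : PS m ε₁ ε₂ => ∫ x in a..b, circle f (θ x) * w x := by
  have hi : ∀ f : PS m ε₁ ε₂, IntervalIntegrable (fun x => circle f (θ x) * w x) volume a b :=
    fun f => (((contDiff_circle f).continuous.comp hθ).mul hw).intervalIntegrable _ _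
  let L : PS m ε₁ ε₂ →+ ℂ := AddMonoidHom.mk' (fun f => ∫ x in a..b, circle f (θ x) * w x)
    fun f f' => by
      rw [← intervalIntegral.integral_add (hi f) (hi f')]
      simp only [circle_add, Pi.add_apply, add_mul]
  obtain ⟨C, hC⟩ := (isCompact_uIcc (a := a) (b := b)).exists_bound_of_continuousOn
    hw.continuousOn
  refine continuous_of_continuousAt_zero L ?_
  rw [ContinuousAt, map_zero]
  refine squeeze_zero_norm (a := fun f => circleSeminorm 0 f * C * |b - a|) (fun f => ?_) ?_
  · refine intervalIntegral.norm_integral_le_of_norm_le_const fun x hx => ?_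
    rw [norm_mul]
    have h1 := norm_le_circleSeminorm f 0 (θ x)
    rw [iteratedDeriv_zero] at h1
    exact mul_le_mul h1 (hC x (Set.uIoc_subset_uIcc hx)) (norm_nonneg _) (apply_nonneg _ _)
  · have := (((continuous_circleSeminorm (m := m) (ε₁ := ε₁) (ε₂ := ε₂) 0).tendsto 0).mul_const
      C).mul_const |b - a|
    simpa using this

lemma isClosed_delta (hε : ε₁ (-1) * ε₂ (-1) = (-1) ^ m) :
    IsClosed ((delta hε : Subrepresentation (psAction m ε₁ ε₂)).toSubmodule :
      Set (PS m ε₁ ε₂)) := by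
  have hc : ∀ (n : ℕ) (hn : n + 2 = m) (a b : Fin n → ℂ),
      Continuous (formPairing (ε₁ := ε₁) (ε₂ := ε₂) hε hn a b) := by
    intro n hn a b
    have := continuous_integral_circle (m := m) (ε₁ := ε₁) (ε₂ := ε₂) id
      (fun α => linearFormProd a b (-Real.sin α, Real.cos α)) continuous_id
      ((continuous_linearFormProd a b).comp (by fun_prop)) 0 Real.pi
    simp only [circle_eq_plane] at this
    exact this
  simp only [delta, Submodule.coe_iInf]
  refine isClosed_iInter fun n => isClosed_iInter fun hn => isClosed_iInter fun a =>
    isClosed_iInter fun b => ?_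
  exact isClosed_singleton.preimage (hc n hn a b)

/-! ### Taylor coefficients at infinity -/

lemma inftyChart_add (f f' : PS m ε₁ ε₂) :
    inftyChart (f + f') = inftyChart f + inftyChart f' :=
  funext fun _ => plane_add f f' _

lemma inftyChart_smul (c : ℂ) (f : PS m ε₁ ε₂) : inftyChart (c • f) = c • inftyChart f :=
  funext fun _ => plane_smul c f _

/-- The derivatives of the chart at infinity. -/
def inftyDeriv (hε : ε₁ (-1) * ε₂ (-1) = (-1) ^ m) (l : ℕ) (y : ℝ) : PS m ε₁ ε₂ →ₗ[ℂ] ℂ where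
  toFun f := iteratedDeriv l (inftyChart f) y
  map_add' f f' := by
    rw [inftyChart_add, iteratedDeriv_add
      ((contDiff_inftyChart hε f).of_le (by exact_mod_cast le_top)).contDiffAt
      ((contDiff_inftyChart hε f').of_le (by exact_mod_cast le_top)).contDiffAt]
  map_smul' c f := by
    rw [inftyChart_smul, iteratedDeriv_const_smul_field]
    rfl

lemma inftyDeriv_apply (hε : ε₁ (-1) * ε₂ (-1) = (-1) ^ m) (l : ℕ) (y : ℝ) (f : PS m ε₁ ε₂) :
    inftyDeriv hε l y f = iteratedDeriv l (inftyChart f) y := rfl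

/-- A derivative is a pointwise limit of difference quotients, so Banach–Steinhaus gives continuity
by induction, without estimates for the change of chart. -/
lemma continuous_inftyDeriv (hε : ε₁ (-1) * ε₂ (-1) = (-1) ^ m) (l : ℕ) (y : ℝ) :
    Continuous (inftyDeriv hε l y : PS m ε₁ ε₂ →ₗ[ℂ] ℂ) := by
  induction l generalizing y with
  | zero =>
    have : ⇑(inftyDeriv hε 0 y : PS m ε₁ ε₂ →ₗ[ℂ] ℂ) = fun f => plane f (y, 1) := by
      funext f
      rw [inftyDeriv_apply, iteratedDeriv_zero]
      rfl
    rw [this]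
    exact continuous_plane_apply hε _
  | succ l ih =>
    refine (isFrechet_PS hε).continuous_of_tendsto
      (fun n : ℕ => ((n : ℂ) + 1) •
        (inftyDeriv hε l (y + 1 / ((n : ℝ) + 1)) - inftyDeriv hε l y)) (fun n => ?_) _ fun f => ?_
    · have := ((ih (y + 1 / ((n : ℝ) + 1))).sub (ih y)).const_smul ((n : ℂ) + 1)
      exact this
    · have hd : HasDerivAt (iteratedDeriv l (inftyChart f))
          (iteratedDeriv (l + 1) (inftyChart f) y) y := by
        rw [iteratedDeriv_succ]
        exact ((contDiff_inftyChart hε f).differentiable_iteratedDeriv l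
          (by exact_mod_cast ENat.natCast_lt_top l) y).hasDerivAt
      have h1 : Tendsto (fun n : ℕ => 1 / ((n : ℝ) + 1)) atTop (𝓝[≠] 0) := by
        refine tendsto_nhdsWithin_iff.2 ⟨tendsto_one_div_add_atTop_nhds_zero_nat,
          Eventually.of_forall fun n => ?_⟩
        have : (0 : ℝ) < (n : ℝ) + 1 := by positivity
        exact (one_div_pos.2 this).ne'
      have h2 := hd.tendsto_slope_zero.comp h1
      refine h2.congr fun n => ?_
      simp only [Function.comp_apply, LinearMap.smul_apply, LinearMap.sub_apply, inftyDeriv_apply,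
        one_div, inv_inv, smul_eq_mul, Complex.real_smul]
      push_cast
      rfl

lemma inftyChart_embGL1 (t : ℝˣ) (f : PS m ε₁ ε₂) :
    inftyChart (psAction m ε₁ ε₂ (embGL1 t) f) =
      fun y => detChar m ε₁ t * inftyChart f ((t : ℝ) * y) :=
  funext fun y => plane_embGL1 t f (mk_one_ne_zero y)

lemma inftyDeriv_embGL1 (hε : ε₁ (-1) * ε₂ (-1) = (-1) ^ m) (l : ℕ) (t : ℝˣ)
    (f : PS m ε₁ ε₂) : inftyDeriv hε l 0 (psAction m ε₁ ε₂ (embGL1 t) f) =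
      detChar m ε₁ t * (t : ℂ) ^ l * inftyDeriv hε l 0 f := by
  rw [inftyDeriv_apply, inftyDeriv_apply, inftyChart_embGL1]
  have h1 : ContDiff ℝ l (inftyChart f) :=
    (contDiff_inftyChart hε f).of_le (by exact_mod_cast le_top)
  have h2 := congrFun (iteratedDeriv_comp_const_smul h1 (t : ℝ)) 0
  have h3 : (fun y => detChar m ε₁ t * inftyChart f ((t : ℝ) * y)) =
      detChar m ε₁ t • fun y => inftyChart f ((t : ℝ) * y) := rfl
  rw [h3, iteratedDeriv_const_smul_field, h2, mul_zero, smul_eq_mul, Complex.real_smul, mul_assoc]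
  push_cast
  rfl

end

section

open Filter Topology MeasureTheory

variable {m : ℕ} {ε₁ ε₂ : ℝˣ →* ℤˣ}

/-! ### Moments -/

lemma lineChart_add (f f' : PS m ε₁ ε₂) :
    lineChart (f + f') = lineChart f + lineChart f' :=
  funext fun _ => plane_add f f' _

lemma lineChart_smul (c : ℂ) (f : PS m ε₁ ε₂) : lineChart (c • f) = c • lineChart f :=
  funext fun _ => plane_smul c f _

lemma lineChart_eq_circle (hε : ε₁ (-1) * ε₂ (-1) = (-1) ^ m) (f : PS m ε₁ ε₂) (x : ℝ) :
    lineChart f x = circle f (Real.arctan x + Real.pi / 2) *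
      ((-Real.cos (Real.arctan x) : ℝ) : ℂ) ^ m := by
  have hpos : 0 < Real.cos (Real.arctan x) := Real.cos_arctan_pos x
  have hne : ((-Real.cos (Real.arctan x) : ℝ) : ℂ) ≠ 0 := by
    exact_mod_cast (neg_neg_of_pos hpos).ne
  rw [circle_eq_plane, Real.sin_add_pi_div_two, Real.cos_add_pi_div_two,
    plane_eq_lineChart hε f (by linarith), neg_div_neg_eq, ← Real.tan_eq_sin_div_cos,
    Real.tan_arctan, mul_comm, ← mul_assoc, mul_inv_cancel₀ (pow_ne_zero _ hne), one_mul]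

/-- The truncated moments of the chart on the affine line. -/
def momentTrunc (hε : ε₁ (-1) * ε₂ (-1) = (-1) ^ m) (k : ℕ) (R : ℝ) : PS m ε₁ ε₂ →ₗ[ℂ] ℂ where
  toFun f := ∫ x in -R..R, (x : ℂ) ^ k * lineChart f x
  map_add' f f' := by
    have h := fun f : PS m ε₁ ε₂ => (contDiff_lineChart hε f).continuous
    rw [← intervalIntegral.integral_add]
    · simp only [lineChart_add, Pi.add_apply, mul_add]
    · have := h f
      exact Continuous.intervalIntegrable (by fun_prop) _ _
    · have := h f'
      exact Continuous.intervalIntegrable (by fun_prop) _ _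
  map_smul' c f := by
    rw [RingHom.id_apply, smul_eq_mul, ← intervalIntegral.integral_const_mul]
    simp only [lineChart_smul, Pi.smul_apply, smul_eq_mul]
    congr 1
    funext x
    ring

lemma momentTrunc_apply (hε : ε₁ (-1) * ε₂ (-1) = (-1) ^ m) (k : ℕ) (R : ℝ) (f : PS m ε₁ ε₂) :
    momentTrunc hε k R f = ∫ x in -R..R, (x : ℂ) ^ k * lineChart f x := rfl

lemma continuous_momentTrunc (hε : ε₁ (-1) * ε₂ (-1) = (-1) ^ m) (k : ℕ) (R : ℝ) :
    Continuous (momentTrunc hε k R : PS m ε₁ ε₂ →ₗ[ℂ] ℂ) := by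
  have := continuous_integral_circle (m := m) (ε₁ := ε₁) (ε₂ := ε₂)
    (fun x => Real.arctan x + Real.pi / 2)
    (fun x => ((-Real.cos (Real.arctan x) : ℝ) : ℂ) ^ m * (x : ℂ) ^ k) (by fun_prop)
    (by fun_prop) (-R) R
  refine this.congr fun f => ?_
  rw [momentTrunc_apply]
  refine intervalIntegral.integral_congr fun x _ => ?_
  simp only [lineChart_eq_circle hε f x]
  ring

lemma lineChart_embGL1 (hε : ε₁ (-1) * ε₂ (-1) = (-1) ^ m) (t : ℝˣ) (f : PS m ε₁ ε₂) (x : ℝ) :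
    lineChart (psAction m ε₁ ε₂ (embGL1 t) f) x =
      detChar m ε₁ t * ((t : ℂ) ^ m)⁻¹ * lineChart f (x / t) := by
  rw [lineChart, plane_embGL1 t f (one_mk_ne_zero x), mul_one, plane_eq_lineChart hε f t.ne_zero,
    mul_assoc]

lemma momentTrunc_embGL1 (hε : ε₁ (-1) * ε₂ (-1) = (-1) ^ m) (k : ℕ) (R : ℝ) (t : ℝˣ)
    (f : PS m ε₁ ε₂) : momentTrunc hε k R (psAction m ε₁ ε₂ (embGL1 t) f) =
      detChar m ε₁ t * ((t : ℂ) ^ m)⁻¹ * (t : ℂ) ^ k * ((|(t : ℝ)| : ℝ) : ℂ) *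
        momentTrunc hε k (R / |(t : ℝ)|) f := by
  have ht : (t : ℝ) ≠ 0 := t.ne_zero
  have ht' : ((t : ℝ) : ℂ) ≠ 0 := by exact_mod_cast ht
  rw [momentTrunc_apply, momentTrunc_apply]
  have e : ∀ x : ℝ, (x : ℂ) ^ k * lineChart (psAction m ε₁ ε₂ (embGL1 t) f) x =
      (detChar m ε₁ t * ((t : ℂ) ^ m)⁻¹ * (t : ℂ) ^ k) *
        (fun u : ℝ => (u : ℂ) ^ k * lineChart f u) (x / t) := by
    intro x
    rw [lineChart_embGL1 hε]
    push_cast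
    rw [div_pow]
    field_simp
  simp only [e]
  rw [intervalIntegral.integral_const_mul,
    intervalIntegral.integral_comp_div (fun u : ℝ => (u : ℂ) ^ k * lineChart f u) ht]
  rcases lt_or_gt_of_ne ht with h | h
  · rw [abs_of_neg h, div_neg, neg_div, neg_neg, intervalIntegral.integral_symm (R / (t : ℝ)),
      Complex.real_smul]
    push_cast
    ring
  · rw [abs_of_pos h, neg_div, Complex.real_smul]
    ring

/-- The `k`-th moment of `f` exists, as a principal value, and equals `a`. -/
def HasMoment (hε : ε₁ (-1) * ε₂ (-1) = (-1) ^ m) (k : ℕ) (f : PS m ε₁ ε₂) (a : ℂ) : Prop :=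
  Tendsto (fun R : ℝ => momentTrunc hε k R f) atTop (𝓝 a)

lemma HasMoment.embGL1 {hε : ε₁ (-1) * ε₂ (-1) = (-1) ^ m} {k : ℕ} {f : PS m ε₁ ε₂} {a : ℂ}
    (h : HasMoment hε k f a) (t : ℝˣ) : HasMoment hε k (psAction m ε₁ ε₂ (embGL1 t) f)
      (detChar m ε₁ t * ((t : ℂ) ^ m)⁻¹ * (t : ℂ) ^ k * ((|(t : ℝ)| : ℝ) : ℂ) * a) := by
  simp only [HasMoment, momentTrunc_embGL1]
  refine Tendsto.const_mul _ (Tendsto.comp (g := fun R => momentTrunc hε k R f) h ?_)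
  exact tendsto_id.atTop_div_const (abs_pos.2 t.ne_zero)

lemma iteratedDeriv_reflect {G : ℝ → ℂ} (n : ℕ) :
    iteratedDeriv n (fun y => G (-y)) 0 = (-1) ^ n * iteratedDeriv n G 0 := by
  rw [iteratedDeriv_comp_neg, neg_zero, Complex.real_smul]
  push_cast
  rfl

/-- The moment of order `m + l - 1` exists once the chart at infinity vanishes to order `l`. -/
lemma exists_hasMoment (hε : ε₁ (-1) * ε₂ (-1) = (-1) ^ m) {k l : ℕ} (hk : k + 1 = m + l)
    {f : PS m ε₁ ε₂} (hf : ∀ j < l, inftyDeriv hε j 0 f = 0) : ∃ a, HasMoment hε k f a := by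
  set G := inftyChart f with hG
  have hGs : ContDiff ℝ ∞ G := contDiff_inftyChart hε f
  -- The combination for which x^k F(x) + (-x)^k F(-x) = x^{k-m} g(1/x).
  set g : ℝ → ℂ := fun y => G y + (-1) ^ (k + m) * G (-y) with hg
  have hgs : ContDiff ℝ ∞ g := hGs.add (contDiff_const.mul (hGs.comp contDiff_neg))
  have hg0 : ∀ j < l + 1, iteratedDeriv j g 0 = 0 := by
    intro j hj
    have hle : ContDiff ℝ j G := hGs.of_le (by exact_mod_cast le_top)
    have h1 : iteratedDeriv j g 0 = iteratedDeriv j G 0 +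
        (-1) ^ (k + m) * ((-1) ^ j * iteratedDeriv j G 0) := by
      have e : g = G + (-1 : ℂ) ^ (k + m) • fun y => G (-y) := rfl
      have h2 : ContDiff ℝ j ((-1 : ℂ) ^ (k + m) • fun y => G (-y)) :=
        (hle.comp contDiff_neg).const_smul ((-1 : ℂ) ^ (k + m))
      rw [e, iteratedDeriv_add hle.contDiffAt h2.contDiffAt, iteratedDeriv_const_smul_field,
        iteratedDeriv_reflect, smul_eq_mul]
    rcases Nat.lt_succ_iff_lt_or_eq.1 hj with hj' | rfl
    · rw [h1, show iteratedDeriv j G 0 = 0 from hf j hj']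
      simp
    -- The order l coefficient, responsible for a term of size 1/x, cancels between x and -x because
    -- k + m + l = 2k + 1 is odd. This is why a principal value suffices.
    · have : (-1 : ℂ) ^ (k + m) * (-1) ^ j = -1 := by
        rw [← pow_add]
        exact Odd.neg_one_pow ⟨k, by omega⟩
      rw [h1, ← mul_assoc, this]
      ring
  obtain ⟨C, hC⟩ := exists_bound_of_iteratedDeriv_eq_zero hgs (l + 1) hg0
  set H : ℝ → ℂ := fun x => (x : ℂ) ^ k * lineChart f x with hH
  have hHc : Continuous H := by
    have := (contDiff_lineChart hε f).continuous
    fun_prop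
  -- The integral of H over [-R, R] is that of S over [0, R], and S is O(x^{-2}), hence integrable.
  set S : ℝ → ℂ := fun x => H x + H (-x) with hS
  have hSc : Continuous S := hHc.add (hHc.comp continuous_neg)
  have hSb : ∀ x : ℝ, 1 ≤ x → ‖S x‖ ≤ (1 + x ^ 2)⁻¹ * (2 * C) := by
    intro x hx
    have hx0 : x ≠ 0 := by positivity
    have hxc : (x : ℂ) ≠ 0 := by exact_mod_cast hx0
    have e : S x = (x : ℂ) ^ k * ((x : ℂ) ^ m)⁻¹ * g x⁻¹ := by
      simp only [hS, hH, hg]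
      rw [lineChart_eq hε f hx0, lineChart_eq hε f (neg_ne_zero.2 hx0), inv_neg, pow_add]
      have h2 : ((((-x : ℝ) : ℂ)) ^ m)⁻¹ = (-1) ^ m * ((x : ℂ) ^ m)⁻¹ := by
        push_cast
        rw [neg_pow, mul_inv]
        congr 1
        rcases neg_one_pow_eq_or ℂ m with h | h <;> rw [h] <;> norm_num
      rw [h2]
      push_cast
      rw [neg_pow (x : ℂ) k]
      ring
    have h3 : ‖(x : ℂ) ^ k * ((x : ℂ) ^ m)⁻¹‖ = x ^ l * x⁻¹ := by
      have : x ^ k * (x ^ m)⁻¹ = x ^ l * x⁻¹ := by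
        have h4 : x ^ k * x = x ^ m * x ^ l := by rw [← pow_succ, hk, pow_add]
        field_simp
        linarith
      rw [norm_mul, norm_inv, norm_pow, norm_pow, Complex.norm_real, Real.norm_eq_abs,
        abs_of_nonneg (by linarith), this]
    have h5 := hC x⁻¹ (by
      rw [abs_of_nonneg (by positivity)]
      exact inv_le_one_of_one_le₀ hx)
    have hC0 : 0 ≤ C := by
      have := hC 1 (by simp)
      simp only [abs_one, one_pow, mul_one] at this
      exact (norm_nonneg _).trans this
    rw [e, norm_mul, h3]
    calc x ^ l * x⁻¹ * ‖g x⁻¹‖ ≤ x ^ l * x⁻¹ * (C * |x⁻¹| ^ (l + 1)) := by gcongr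
      _ = C * (x ^ 2)⁻¹ := by
        rw [abs_of_nonneg (by positivity), inv_pow, pow_succ]
        field_simp
      _ ≤ (1 + x ^ 2)⁻¹ * (2 * C) := by
        have : (x ^ 2)⁻¹ ≤ (1 + x ^ 2)⁻¹ * 2 := by
          rw [← one_div, ← one_div, one_div_mul_eq_div, div_le_div_iff₀ (by positivity)
            (by positivity)]
          nlinarith
        nlinarith
  have hint : IntegrableOn S (Set.Ioi 0) := by
    have h1 : IntegrableOn S (Set.Ioi 1) := by
      refine ((integrable_inv_one_add_sq.mul_const (2 * C)).integrableOn).mono'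
        hSc.aestronglyMeasurable ?_
      refine (ae_restrict_iff' measurableSet_Ioi).2 (Eventually.of_forall fun x hx => ?_)
      exact hSb x (le_of_lt hx)
    have h2 : IntegrableOn S (Set.Icc 0 1) := hSc.continuousOn.integrableOn_Icc
    refine (h2.union h1).mono_set fun x hx => ?_
    rcases le_or_gt x 1 with h | h
    · exact Or.inl ⟨le_of_lt hx, h⟩
    · exact Or.inr h
  refine ⟨_, (intervalIntegral_tendsto_integral_Ioi 0 hint tendsto_id).congr fun R => ?_⟩
  have hi := fun a b => hHc.intervalIntegrable (μ := volume) a b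
  have h1 : ∫ x in (0 : ℝ)..R, S x = (∫ x in (0 : ℝ)..R, H x) + ∫ x in (0 : ℝ)..R, H (-x) :=
    intervalIntegral.integral_add (hi _ _) ((hHc.comp continuous_neg).intervalIntegrable _ _)
  rw [momentTrunc_apply, id, h1, intervalIntegral.integral_comp_neg H,
    neg_zero, add_comm, intervalIntegral.integral_add_adjacent_intervals (hi _ _) (hi _ _)]

lemma linearFormProd_one_eq {n : ℕ} (a b : Fin n → ℂ) : ∃ c : ℕ → ℂ, ∀ x : ℝ,
    linearFormProd a b (1, x) = ∑ k ∈ Finset.range (n + 1), c k * (x : ℂ) ^ k := by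
  open Polynomial in
  set p : ℂ[X] := ∏ i, (C (a i) + C (b i) * X) with hp
  have hd : p.natDegree < n + 1 := by
    refine Nat.lt_succ_of_le ((natDegree_prod_le _ _).trans ?_)
    calc ∑ i, (C (a i) + C (b i) * X).natDegree ≤ ∑ _i : Fin n, 1 := by
          refine Finset.sum_le_sum fun i _ => ?_
          compute_degree
      _ = n := by simp
  refine ⟨p.coeff, fun x => ?_⟩
  rw [← eval_eq_sum_range' hd, hp, eval_prod]
  simp [linearFormProd]

/-- The moments of order at most `m - 2` are pairings with monomials. -/
lemma hasMoment_of_add_two_le (hε : ε₁ (-1) * ε₂ (-1) = (-1) ^ m) {k n : ℕ} (hn : n + 2 = m)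
    (hk : k ≤ n) (f : PS m ε₁ ε₂) : ∃ a b : Fin n → ℂ, HasMoment hε k f
      (densityIntegral fun v => plane f v * linearFormProd a b v) := by
  -- The form d^k c^{n-k}, which becomes x^k at (1, x).
  refine ⟨fun i => if (i : ℕ) < k then 0 else 1, fun i => if (i : ℕ) < k then 1 else 0, ?_⟩
  set a : Fin n → ℂ := fun i => if (i : ℕ) < k then 0 else 1
  set b : Fin n → ℂ := fun i => if (i : ℕ) < k then 1 else 0
  have h1 : ∀ x : ℝ, linearFormProd a b (1, x) = (x : ℂ) ^ k := by
    intro x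
    have : ∀ i : Fin n, a i * ((1 : ℝ) : ℂ) + b i * (x : ℂ) = if (i : ℕ) < k then (x : ℂ) else 1 := by
      intro i
      by_cases h : (i : ℕ) < k <;> simp [a, b, h]
    simp only [linearFormProd, this]
    rw [Fin.prod_univ_eq_prod_range (fun i => if i < k then (x : ℂ) else 1) n,
      ← Finset.prod_subset (Finset.range_subset_range.2 hk)
        (fun i _ hi => by simp at hi; simp [hi]),
      Finset.prod_congr rfl (g := fun _ => (x : ℂ)) (fun i hi => by simp at hi; simp [hi])]
    simp
  have hd := isDensity_plane_mul hε f hn a b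
  rw [← hd.integral_line]
  refine (intervalIntegral_tendsto_integral hd.integrable_line tendsto_neg_atTop_atBot
    tendsto_id).congr fun R => ?_
  rw [momentTrunc_apply]
  refine intervalIntegral.integral_congr fun x _ => ?_
  simp only [h1]
  rw [mul_comm]
  rfl

/-- At (1, x) a product of m - 2 linear forms is a polynomial in x of degree at most m - 2, and
every monomial of such degree arises; so annihilating the forms means vanishing of these moments. -/
lemma mem_delta_iff_hasMoment (hε : ε₁ (-1) * ε₂ (-1) = (-1) ^ m) {f : PS m ε₁ ε₂} :
    f ∈ (delta hε).toSubmodule ↔ ∀ k : ℕ, k + 2 ≤ m → HasMoment hε k f 0 := by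
  rw [mem_delta]
  constructor
  · intro h k hk
    obtain ⟨n, hn⟩ := Nat.exists_eq_add_of_le' (show 2 ≤ m by omega)
    obtain ⟨a, b, hab⟩ := hasMoment_of_add_two_le hε hn.symm (show k ≤ n by omega) f
    rwa [h n hn.symm a b] at hab
  · intro h n hn a b
    obtain ⟨c, hc⟩ := linearFormProd_one_eq a b
    have hd := isDensity_plane_mul hε f hn a b
    rw [← hd.integral_line]
    refine tendsto_nhds_unique (intervalIntegral_tendsto_integral hd.integrable_line
      tendsto_neg_atTop_atBot tendsto_id) ?_
    have h1 : Tendsto (fun R : ℝ => ∑ k ∈ Finset.range (n + 1), c k * momentTrunc hε k R f) atTop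
        (𝓝 (∑ k ∈ Finset.range (n + 1), c k * 0)) := by
      refine tendsto_finsetSum _ fun k hk => (h k ?_).const_mul _
      simp at hk
      omega
    simp only [mul_zero, Finset.sum_const_zero] at h1
    refine h1.congr fun R => ?_
    have hcont := (contDiff_lineChart hε f).continuous
    simp only [momentTrunc_apply, ← intervalIntegral.integral_const_mul, id]
    rw [← intervalIntegral.integral_finsetSum fun k _ =>
      Continuous.intervalIntegrable (by fun_prop) _ _]
    refine intervalIntegral.integral_congr fun x _ => ?_
    simp only [hc, Finset.mul_sum]
    refine Finset.sum_congr rfl fun k _ => ?_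
    change _ = lineChart f x * _
    ring

end

section

open Filter Topology MeasureTheory

variable {m : ℕ} {ε₁ ε₂ : ℝˣ →* ℤˣ}

/-! ### Explicit elements of `δ(m)` -/

lemma ofReal_add_mul_ne_zero {w : ℂ} (hw : w ^ 2 = -1) {c d : ℝ} (h : c ≠ 0 ∨ d ≠ 0) :
    (d : ℂ) + w * (c : ℂ) ≠ 0 := by
  intro h0
  have h1 : ((d ^ 2 + c ^ 2 : ℝ) : ℂ) = 0 := by
    have : ((d : ℂ) + w * c) * ((d : ℂ) - w * c) = 0 := by rw [h0, zero_mul]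
    push_cast
    linear_combination this + (c : ℂ) ^ 2 * hw
  have h2 : d ^ 2 + c ^ 2 = 0 := by exact_mod_cast h1
  rcases h with h | h <;> nlinarith [sq_nonneg c, sq_nonneg d, sq_pos_of_ne_zero h]

lemma ofReal_add_ne_zero {w : ℂ} (hw : w ^ 2 = -1) (x : ℝ) : (x : ℂ) + w ≠ 0 := by
  simpa using ofReal_add_mul_ne_zero hw (c := 1) (d := x) (Or.inl one_ne_zero)

lemma continuous_kernel {w : ℂ} (hw : w ^ 2 = -1) (k p : ℕ) :
    Continuous fun x : ℝ => (x : ℂ) ^ k * (((x : ℂ) + w) ^ p)⁻¹ := by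
  refine Continuous.mul (by fun_prop) (Continuous.inv₀ (by fun_prop) fun x => ?_)
  exact pow_ne_zero _ (ofReal_add_ne_zero hw x)

lemma tendsto_kernel_boundary (w : ℂ) {p : ℕ} (hp : p ≠ 0) {l : Filter ℝ}
    (hl : l ≤ cocompact ℝ) : Tendsto (fun x : ℝ => (((x : ℂ) + w) ^ p)⁻¹) l (𝓝 0) := by
  have h1 : Tendsto (fun x : ℝ => ‖(x : ℂ) + w‖) l atTop := by
    refine tendsto_atTop_mono (f := fun x : ℝ => ‖x‖ - ‖w‖) (fun x => ?_)
      (tendsto_atTop_add_const_right _ _ ((tendsto_norm_cocompact_atTop (E := ℝ)).mono_left hl))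
    have := norm_sub_norm_le (x : ℂ) (-w)
    rwa [norm_neg, sub_neg_eq_add, Complex.norm_real] at this
  refine tendsto_zero_iff_norm_tendsto_zero.2 ?_
  simp only [norm_inv, norm_pow]
  exact ((tendsto_pow_atTop hp).comp h1).inv_tendsto_atTop

/-- Here w is i or -i. For k = 0 there is a primitive vanishing at both ends, and writing one factor
x as (x + w) - w lowers k. -/
lemma tendsto_integral_kernel {w : ℂ} (hw : w ^ 2 = -1) (k : ℕ) : ∀ {p : ℕ}, k + 2 ≤ p →
    Tendsto (fun R : ℝ => ∫ x in -R..R, (x : ℂ) ^ k * (((x : ℂ) + w) ^ p)⁻¹) atTop (𝓝 0) := by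
  induction k with
  | zero =>
    intro p hp
    obtain ⟨q, rfl⟩ : ∃ q, p = q + 2 := ⟨p - 2, by omega⟩
    have hq : ((q : ℂ) + 1) ≠ 0 := by exact_mod_cast Nat.succ_ne_zero q
    have hd : ∀ x : ℝ, HasDerivAt (fun x : ℝ => -((q : ℂ) + 1)⁻¹ * (((x : ℂ) + w) ^ (q + 1))⁻¹)
        ((x : ℂ) ^ 0 * (((x : ℂ) + w) ^ (q + 2))⁻¹) x := by
      intro x
      have hne := ofReal_add_ne_zero hw x
      have h1 : HasDerivAt (fun x : ℝ => (x : ℂ) + w) 1 x :=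
        (Complex.ofRealCLM.hasDerivAt (x := x)).add_const w
      have h2 := ((h1.pow (q + 1)).inv (pow_ne_zero _ hne)).const_mul (-((q : ℂ) + 1)⁻¹)
      refine HasDerivAt.congr_deriv h2 ?_
      simp only [Pi.pow_apply]
      push_cast
      field_simp
      ring
    have h3 : ∀ R : ℝ, ∫ x in -R..R, (x : ℂ) ^ 0 * (((x : ℂ) + w) ^ (q + 2))⁻¹ =
        -((q : ℂ) + 1)⁻¹ * (((R : ℂ) + w) ^ (q + 1))⁻¹ -
          -((q : ℂ) + 1)⁻¹ * ((((-R : ℝ) : ℂ) + w) ^ (q + 1))⁻¹ := fun R =>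
      intervalIntegral.integral_eq_sub_of_hasDerivAt (fun x _ => hd x)
        ((continuous_kernel hw 0 (q + 2)).intervalIntegrable _ _)
    simp only [h3]
    have h4 := (tendsto_kernel_boundary w q.succ_ne_zero (l := atTop)
      atTop_le_cocompact).const_mul (-((q : ℂ) + 1)⁻¹)
    have h5 := ((tendsto_kernel_boundary w q.succ_ne_zero (l := atBot)
      atBot_le_cocompact).comp tendsto_neg_atTop_atBot).const_mul (-((q : ℂ) + 1)⁻¹)
    simpa using h4.sub h5
  | succ k ih =>
    intro p hp
    obtain ⟨q, rfl⟩ : ∃ q, p = q + 1 := ⟨p - 1, by omega⟩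
    have h1 := (ih (p := q) (by omega)).sub ((ih (p := q + 1) (by omega)).const_mul w)
    simp only [mul_zero, sub_zero] at h1
    refine h1.congr fun R => ?_
    rw [← intervalIntegral.integral_const_mul, ← intervalIntegral.integral_sub
      ((continuous_kernel hw k q).intervalIntegrable _ _)
      (((continuous_kernel hw k (q + 1)).intervalIntegrable _ _).const_mul w)]
    refine intervalIntegral.integral_congr fun x _ => ?_
    have hne := ofReal_add_ne_zero hw x
    field_simp
    ring

/-- For k = 0 the integrand 1/(x + w) = (x - w)/(x² + 1) has primitive log(1 + x²)/2 - w arctan x.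
The even logarithm cancels over [-R, R] and the arctangent leaves -wπ. For larger k the extra terms
tend to 0 by the previous lemma. The dependence on w is what separates moments from Taylor
coefficients later. -/
lemma tendsto_integral_kernel_succ {w : ℂ} (hw : w ^ 2 = -1) (k : ℕ) :
    Tendsto (fun R : ℝ => ∫ x in -R..R, (x : ℂ) ^ k * (((x : ℂ) + w) ^ (k + 1))⁻¹) atTop
      (𝓝 (-w * Real.pi)) := by
  induction k with
  | zero =>
    have hd : ∀ x : ℝ, HasDerivAt
        (fun x : ℝ => ((Real.log (1 + x ^ 2) / 2 : ℝ) : ℂ) - w * ((Real.arctan x : ℝ) : ℂ))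
        ((x : ℂ) ^ 0 * (((x : ℂ) + w) ^ (0 + 1))⁻¹) x := by
      intro x
      have hne := ofReal_add_ne_zero hw x
      have hpos : (1 + x ^ 2 : ℝ) ≠ 0 := by positivity
      have h1 : HasDerivAt (fun x : ℝ => Real.log (1 + x ^ 2) / 2) (2 * x / (1 + x ^ 2) / 2) x := by
        have := (((hasDerivAt_pow 2 x).const_add 1).log hpos).div_const 2
        simpa using this
      have h2 := h1.ofReal_comp.sub ((Real.hasDerivAt_arctan x).ofReal_comp.const_mul w)
      refine HasDerivAt.congr_deriv h2 ?_
      have hposc : (1 + (x : ℂ) ^ 2) ≠ 0 := by exact_mod_cast hpos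
      push_cast
      field_simp
      linear_combination -hw
    have h3 : ∀ R : ℝ, ∫ x in -R..R, (x : ℂ) ^ 0 * (((x : ℂ) + w) ^ (0 + 1))⁻¹ =
        -w * ((2 * Real.arctan R : ℝ) : ℂ) := by
      intro R
      rw [intervalIntegral.integral_eq_sub_of_hasDerivAt (fun x _ => hd x)
        ((continuous_kernel hw 0 (0 + 1)).intervalIntegrable _ _), Real.arctan_neg, neg_sq]
      push_cast
      ring
    simp only [h3]
    have h4 := ((Real.tendsto_arctan_atTop).mono_right nhdsWithin_le_nhds).const_mul 2
    have h5 := ((Complex.continuous_ofReal.tendsto _).comp h4).const_mul (-w)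
    rw [show (2 : ℝ) * (Real.pi / 2) = Real.pi by ring] at h5
    exact h5
  | succ k ih =>
    have h1 := ih.sub ((tendsto_integral_kernel hw k (p := k + 2) le_rfl).const_mul w)
    simp only [mul_zero, sub_zero] at h1
    refine h1.congr fun R => ?_
    rw [← intervalIntegral.integral_const_mul, ← intervalIntegral.integral_sub
      ((continuous_kernel hw k (k + 1)).intervalIntegrable _ _)
      (((continuous_kernel hw k (k + 2)).intervalIntegrable _ _).const_mul w)]
    refine intervalIntegral.integral_congr fun x _ => ?_
    have hne := ofReal_add_ne_zero hw x
    field_simp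
    ring

lemma iteratedDeriv_pow_mul (l : ℕ) : ∀ {u : ℝ → ℂ}, ContDiff ℝ ∞ u →
    (∀ j < l, iteratedDeriv j (fun y : ℝ => (y : ℂ) ^ l * u y) 0 = 0) ∧
      iteratedDeriv l (fun y : ℝ => (y : ℂ) ^ l * u y) 0 = (l.factorial : ℂ) * u 0 := by
  induction l with
  | zero =>
    intro u hu
    simp
  | succ l ih =>
    intro u hu
    set v : ℝ → ℂ := fun y => ((l : ℂ) + 1) * u y + (y : ℂ) * deriv u y with hv
    have hvs : ContDiff ℝ ∞ v := (contDiff_const.mul hu).add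
      (Complex.ofRealCLM.contDiff.mul (contDiff_deriv hu))
    have hd : deriv (fun y : ℝ => (y : ℂ) ^ (l + 1) * u y) = fun y : ℝ => (y : ℂ) ^ l * v y := by
      funext y
      have h1 : HasDerivAt (fun y : ℝ => (y : ℂ)) 1 y := Complex.ofRealCLM.hasDerivAt
      have h2 : HasDerivAt u (deriv u y) y := (hu.differentiable (by simp) y).hasDerivAt
      have h3 := ((h1.pow (l + 1)).mul h2).deriv
      refine Eq.trans h3 ?_
      simp only [hv, Nat.cast_add, Nat.cast_one, Nat.add_sub_cancel, Pi.pow_apply]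
      ring
    obtain ⟨h1, h2⟩ := ih hvs
    refine ⟨fun j hj => ?_, ?_⟩
    · cases j with
      | zero => simp
      | succ j =>
        rw [iteratedDeriv_succ', hd]
        exact h1 j (by omega)
    · rw [iteratedDeriv_succ', hd, h2, hv, Nat.factorial_succ]
      push_cast
      ring

lemma isHomogeneousPlane_kernel {w : ℂ} (hw : w ^ 2 = -1) (m l : ℕ) :
    IsHomogeneousPlane m fun v : ℝ × ℝ =>
      (v.1 : ℂ) ^ l * (((v.2 : ℂ) + w * (v.1 : ℂ)) ^ (m + l))⁻¹ where
  contDiffOn := by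
    have h1 : ContDiff ℝ ∞ fun v : ℝ × ℝ => (v.1 : ℂ) := Complex.ofRealCLM.contDiff.comp contDiff_fst
    have h2 : ContDiff ℝ ∞ fun v : ℝ × ℝ => (v.2 : ℂ) := Complex.ofRealCLM.contDiff.comp contDiff_snd
    refine (h1.pow l).contDiffOn.mul (ContDiffOn.inv
      ((h2.add (contDiff_const.mul h1)).pow (m + l)).contDiffOn fun v hv => ?_)
    refine pow_ne_zero _ (ofReal_add_mul_ne_zero hw ?_)
    by_contra! h
    exact hv (Prod.ext h.1 h.2)
  smul t v ht hv := by
    have ht' : (t : ℂ) ≠ 0 := by exact_mod_cast ht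
    have hne : (v.2 : ℂ) + w * (v.1 : ℂ) ≠ 0 := by
      refine ofReal_add_mul_ne_zero hw ?_
      by_contra! h
      exact hv (Prod.ext h.1 h.2)
    simp only [Prod.smul_fst, Prod.smul_snd, smul_eq_mul]
    push_cast
    rw [show (t : ℂ) * v.2 + w * (t * v.1) = t * (v.2 + w * v.1) by ring, mul_pow, mul_pow, pow_add]
    field_simp

/-- The element of the principal series given by `(c, d) ↦ c^l (d + w c)^{-m-l}`. -/
def kernelElt (hε : ε₁ (-1) * ε₂ (-1) = (-1) ^ m) {w : ℂ} (hw : w ^ 2 = -1) (l : ℕ) :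
    PS m ε₁ ε₂ := ofPlane hε _ (isHomogeneousPlane_kernel hw m l)

lemma lineChart_kernelElt (hε : ε₁ (-1) * ε₂ (-1) = (-1) ^ m) {w : ℂ} (hw : w ^ 2 = -1) (l : ℕ)
    (x : ℝ) : lineChart (kernelElt hε hw l : PS m ε₁ ε₂) x = (((x : ℂ) + w) ^ (m + l))⁻¹ := by
  refine (plane_ofPlane hε (isHomogeneousPlane_kernel hw m l) (one_mk_ne_zero x)).trans ?_
  simp

lemma inftyChart_kernelElt (hε : ε₁ (-1) * ε₂ (-1) = (-1) ^ m) {w : ℂ} (hw : w ^ 2 = -1) (l : ℕ) :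
    inftyChart (kernelElt hε hw l : PS m ε₁ ε₂) =
      fun y : ℝ => (y : ℂ) ^ l * ((1 + w * (y : ℂ)) ^ (m + l))⁻¹ := by
  funext y
  refine (plane_ofPlane hε (isHomogeneousPlane_kernel hw m l) (mk_one_ne_zero y)).trans ?_
  simp

lemma hasMoment_kernelElt (hε : ε₁ (-1) * ε₂ (-1) = (-1) ^ m) {w : ℂ} (hw : w ^ 2 = -1) {k l : ℕ}
    (hk : k + 2 ≤ m + l) : HasMoment hε k (kernelElt hε hw l : PS m ε₁ ε₂) 0 := by
  simp only [HasMoment, momentTrunc_apply, lineChart_kernelElt]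
  exact tendsto_integral_kernel hw k hk

lemma hasMoment_kernelElt_top (hε : ε₁ (-1) * ε₂ (-1) = (-1) ^ m) {w : ℂ} (hw : w ^ 2 = -1)
    {k l : ℕ} (hk : k + 1 = m + l) :
    HasMoment hε k (kernelElt hε hw l : PS m ε₁ ε₂) (-w * Real.pi) := by
  simp only [HasMoment, momentTrunc_apply, lineChart_kernelElt, ← hk]
  exact tendsto_integral_kernel_succ hw k

lemma inftyDeriv_kernelElt (hε : ε₁ (-1) * ε₂ (-1) = (-1) ^ m) {w : ℂ} (hw : w ^ 2 = -1) (l : ℕ) :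
    (∀ j < l, inftyDeriv hε j 0 (kernelElt hε hw l : PS m ε₁ ε₂) = 0) ∧
      inftyDeriv hε l 0 (kernelElt hε hw l : PS m ε₁ ε₂) = l.factorial := by
  have hs : ContDiff ℝ ∞ fun y : ℝ => ((1 + w * (y : ℂ)) ^ (m + l))⁻¹ := by
    refine ContDiff.inv ((contDiff_const.add
      (contDiff_const.mul Complex.ofRealCLM.contDiff)).pow (m + l)) fun y => ?_
    have := ofReal_add_mul_ne_zero hw (c := y) (d := 1) (Or.inr one_ne_zero)
    simp only [Complex.ofReal_one] at this
    exact pow_ne_zero _ this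
  have h := iteratedDeriv_pow_mul l hs
  simp only [inftyDeriv_apply, inftyChart_kernelElt]
  refine ⟨h.1, h.2.trans (by simp)⟩

lemma kernelElt_mem_delta (hε : ε₁ (-1) * ε₂ (-1) = (-1) ^ m) {w : ℂ} (hw : w ^ 2 = -1) (l : ℕ) :
    (kernelElt hε hw l : PS m ε₁ ε₂) ∈ (delta hε).toSubmodule :=
  (mem_delta_iff_hasMoment hε).2 fun _ hk => hasMoment_kernelElt hε hw (by omega)

/-! ### The filtration of `δ(m)` -/

lemma HasMoment.add {hε : ε₁ (-1) * ε₂ (-1) = (-1) ^ m} {k : ℕ} {f f' : PS m ε₁ ε₂} {a a' : ℂ}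
    (h : HasMoment hε k f a) (h' : HasMoment hε k f' a') : HasMoment hε k (f + f') (a + a') := by
  simp only [HasMoment, map_add]
  exact Tendsto.add h h'

lemma HasMoment.smul {hε : ε₁ (-1) * ε₂ (-1) = (-1) ^ m} {k : ℕ} {f : PS m ε₁ ε₂} {a : ℂ}
    (h : HasMoment hε k f a) (c : ℂ) : HasMoment hε k (c • f) (c * a) := by
  simp only [HasMoment, map_smul, smul_eq_mul]
  exact Tendsto.const_mul c h

/-- The functionals that cut out the filtration: the Taylor coefficients at infinity (`b = true`)
and the moments (`b = false`). -/
def HasCoeff (hε : ε₁ (-1) * ε₂ (-1) = (-1) ^ m) (b : Bool) (l : ℕ) (f : PS m ε₁ ε₂) (a : ℂ) :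
    Prop :=
  match b with
  | true => inftyDeriv hε l 0 f = a
  -- Order m - 1 is the first one not already killed by `delta`; the truncated subtraction is
  -- harmless for m ≥ 1.
  | false => HasMoment hε (m + l - 1) f a

lemma HasCoeff.add {hε : ε₁ (-1) * ε₂ (-1) = (-1) ^ m} {b : Bool} {l : ℕ} {f f' : PS m ε₁ ε₂}
    {a a' : ℂ} (h : HasCoeff hε b l f a) (h' : HasCoeff hε b l f' a') :
    HasCoeff hε b l (f + f') (a + a') := by
  cases b with
  | true => exact (map_add _ _ _).trans (congrArg₂ _ h h')
  | false => exact HasMoment.add h h'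

lemma HasCoeff.smul {hε : ε₁ (-1) * ε₂ (-1) = (-1) ^ m} {b : Bool} {l : ℕ} {f : PS m ε₁ ε₂}
    {a : ℂ} (h : HasCoeff hε b l f a) (c : ℂ) : HasCoeff hε b l (c • f) (c * a) := by
  cases b with
  | true => exact (map_smul _ _ _).trans (congrArg _ h)
  | false => exact HasMoment.smul h c

lemma HasCoeff.unique {hε : ε₁ (-1) * ε₂ (-1) = (-1) ^ m} {b : Bool} {l : ℕ} {f : PS m ε₁ ε₂}
    {a a' : ℂ} (h : HasCoeff hε b l f a) (h' : HasCoeff hε b l f a') : a = a' := by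
  cases b with
  | true => exact Eq.trans (Eq.symm h) h'
  | false => exact tendsto_nhds_unique h h'

/-- The character through which `ℝˣ` acts on the functionals `HasCoeff`. -/
def coeffChar (m : ℕ) (ε₁ : ℝˣ →* ℤˣ) (b : Bool) (l : ℕ) (t : ℝˣ) : ℂ :=
  match b with
  | true => detChar m ε₁ t * (t : ℂ) ^ l
  | false => detChar m ε₁ t * ((t : ℂ) ^ m)⁻¹ * (t : ℂ) ^ (m + l - 1) * ((|(t : ℝ)| : ℝ) : ℂ)

lemma HasCoeff.embGL1 {hε : ε₁ (-1) * ε₂ (-1) = (-1) ^ m} {b : Bool} {l : ℕ} {f : PS m ε₁ ε₂}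
    {a : ℂ} (h : HasCoeff hε b l f a) (t : ℝˣ) :
    HasCoeff hε b l (psAction m ε₁ ε₂ (embGL1 t) f) (coeffChar m ε₁ b l t * a) := by
  cases b with
  | true => exact (inftyDeriv_embGL1 hε l t f).trans (congrArg _ h)
  | false => exact HasMoment.embGL1 h t

/-- The submodule on which a coefficient vanishes. -/
def kerCoeff (hε : ε₁ (-1) * ε₂ (-1) = (-1) ^ m) (b : Bool) (l : ℕ) :
    Submodule ℂ (PS m ε₁ ε₂) where
  carrier := {f | HasCoeff hε b l f 0}
  add_mem' h h' := by simpa using HasCoeff.add h h'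
  zero_mem' := by
    cases b with
    | true => exact map_zero _
    | false =>
      change HasMoment hε _ 0 0
      simp only [HasMoment, map_zero]
      exact tendsto_const_nhds
  smul_mem' c f h := by simpa using HasCoeff.smul h c

lemma mem_kerCoeff {hε : ε₁ (-1) * ε₂ (-1) = (-1) ^ m} {b : Bool} {l : ℕ} {f : PS m ε₁ ε₂} :
    f ∈ kerCoeff hε b l ↔ HasCoeff hε b l f 0 := Iff.rfl

/-- Whether the `n`-th step of the filtration is given by a Taylor coefficient or a moment. -/
def stepKind (ε₁ : ℝˣ →* ℤˣ) (n : ℕ) : Bool := decide (ε₁ (-1) * (-1) ^ (n / 2) * (-1) ^ n = 1)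

/-- For a given l the Taylor coefficient and the moment transform by characters differing by sgn.
The sign in `stepKind` selects the one carrying sgn^n |t|^{m/2+l}, so the steps 2l and 2l + 1 use
each of them once. -/
lemma stepKind_two_mul_add_one (ε₁ : ℝˣ →* ℤˣ) (l : ℕ) :
    stepKind ε₁ (2 * l + 1) = !stepKind ε₁ (2 * l) := by
  have h1 : (2 * l + 1) / 2 = l := by omega
  have h2 : (2 * l) / 2 = l := by omega
  rw [stepKind, stepKind, h1, h2, pow_succ, pow_mul, neg_one_sq, one_pow]
  rcases Int.units_eq_one_or (ε₁ (-1) * (-1) ^ l) with h | h <;> rw [h] <;> decide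

/-- The character `sgn^n |t|^{m/2 + ⌊n/2⌋}`. -/
def stepChar (m n : ℕ) (t : ℝˣ) : ℂ := sgn t ^ n * absPow ((m : ℂ) / 2 + (n / 2 : ℕ)) t

lemma sgn_mul_abs (t : ℝˣ) : sgn t * ((|(t : ℝ)| : ℝ) : ℂ) = (t : ℂ) := by
  rw [sgn, ← Complex.ofReal_mul]
  rcases lt_or_gt_of_ne t.ne_zero with h | h
  · simp [Real.sign_of_neg h, abs_of_neg h]
  · simp [Real.sign_of_pos h, abs_of_pos h]

lemma sgn_mul_self (t : ℝˣ) : sgn t * sgn t = 1 := by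
  rw [sgn]
  rcases lt_or_gt_of_ne t.ne_zero with h | h
  · simp [Real.sign_of_neg h]
  · simp [Real.sign_of_pos h]

lemma stepChar_ne_zero (m n : ℕ) (t : ℝˣ) : stepChar m n t ≠ 0 := by
  refine mul_ne_zero (pow_ne_zero _ fun h => ?_) ?_
  · have := sgn_mul_self t
    simp [h] at this
  · rw [absPow, Complex.cpow_def_of_ne_zero (by simp)]
    exact Complex.exp_ne_zero _

/-- Since t^{-m} t^{m+l-1} |t| = t^l sgn t, the two kinds have characters ε₁ sgn^l |t|^{m/2+l} and
this times sgn; `stepKind` was chosen so that the sign becomes sgn^n. -/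
lemma coeffChar_stepKind (hm : 1 ≤ m) (ε₁ : ℝˣ →* ℤˣ) (n : ℕ) (t : ℝˣ) :
    coeffChar m ε₁ (stepKind ε₁ n) (n / 2) t = stepChar m n t := by
  set l := n / 2 with hl
  have ht : (t : ℂ) ≠ 0 := by exact_mod_cast t.ne_zero
  have h0 : ((|(t : ℝ)| : ℝ) : ℂ) ≠ 0 := by simp
  have h1 : absPow ((m : ℂ) / 2 + l) t = absPow ((m : ℂ) / 2) t * ((|(t : ℝ)| : ℝ) : ℂ) ^ l := by
    rw [absPow_add]
    congr 1
    rw [absPow, Complex.cpow_natCast]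
  have h2 : coeffChar m ε₁ false l t = coeffChar m ε₁ true l t * sgn t := by
    simp only [coeffChar]
    have e : (t : ℂ) ^ (m + l - 1) * t = t ^ m * t ^ l := by
      rw [← pow_succ, ← pow_add]
      congr 1
      omega
    have e2 : ((|(t : ℝ)| : ℝ) : ℂ) = t * sgn t := by
      rw [← sgn_mul_abs t, mul_right_comm, sgn_mul_self, one_mul]
    rw [e2, mul_assoc _ _ ((t : ℂ) * sgn t), ← mul_assoc _ (t : ℂ), e]
    field_simp
  have h3 : coeffChar m ε₁ true l t =
      ((ε₁ t : ℤ) : ℂ) * sgn t ^ l * absPow ((m : ℂ) / 2 + l) t := by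
    simp only [coeffChar]
    rw [detChar_units, h1]
    have e : (t : ℂ) ^ l = sgn t ^ l * ((|(t : ℝ)| : ℝ) : ℂ) ^ l := by
      rw [← mul_pow, sgn_mul_abs]
    rw [e]
    ring
  rw [stepChar, ← hl]
  have key : ∀ b : Bool, stepKind ε₁ n = b →
      ((ε₁ t : ℤ) : ℂ) * sgn t ^ l * (match b with | true => 1 | false => sgn t) = sgn t ^ n := by
    intro b hb
    rcases lt_or_gt_of_ne t.ne_zero with h | h
    · have hs : sgn t = -1 := by simp [sgn, Real.sign_of_neg h]
      rw [quadChar_of_neg ε₁ h, hs]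
      have e : ((ε₁ (-1) : ℤ) : ℂ) * (-1) ^ l * (-1) ^ n =
          (((ε₁ (-1) * (-1) ^ l * (-1) ^ n : ℤˣ) : ℤ) : ℂ) := by push_cast; rfl
      have e2 : ((-1 : ℂ) ^ n) * (-1) ^ n = 1 := by rw [← mul_pow]; simp
      cases b with
      | true =>
        have hb' : ε₁ (-1) * (-1) ^ l * (-1) ^ n = 1 := of_decide_eq_true hb
        rw [hb'] at e
        simp only [Units.val_one, Int.cast_one] at e
        linear_combination (-1) ^ n * e - ((ε₁ (-1) : ℤ) : ℂ) * (-1) ^ l * e2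
      | false =>
        have hb' : ε₁ (-1) * (-1) ^ l * (-1) ^ n = -1 :=
          (Int.units_eq_one_or _).resolve_left (of_decide_eq_false hb)
        rw [hb'] at e
        simp only [Units.val_neg, Units.val_one, Int.cast_neg, Int.cast_one] at e
        simp only
        linear_combination -(-1) ^ n * e + ((ε₁ (-1) : ℤ) : ℂ) * (-1) ^ l * e2
    · have hs : sgn t = 1 := by simp [sgn, Real.sign_of_pos h]
      rw [quadChar_of_pos ε₁ h, hs]
      cases b <;> simp
  cases hb : stepKind ε₁ n with
  | true =>
    rw [h3, ← key true hb]
    ring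
  | false =>
    rw [h2, h3, ← key false hb]
    ring

/-- The filtration of `δ(m)`. -/
def level (hε : ε₁ (-1) * ε₂ (-1) = (-1) ^ m) (n : ℕ) : Submodule ℂ (PS m ε₁ ε₂) :=
  (delta hε).toSubmodule ⊓ ⨅ (j : ℕ) (_ : j < n), kerCoeff hε (stepKind ε₁ j) (j / 2)

lemma mem_level {hε : ε₁ (-1) * ε₂ (-1) = (-1) ^ m} {n : ℕ} {f : PS m ε₁ ε₂} :
    f ∈ level hε n ↔ f ∈ (delta hε).toSubmodule ∧
      ∀ j < n, HasCoeff hε (stepKind ε₁ j) (j / 2) f 0 := by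
  simp only [level, Submodule.mem_inf, Submodule.mem_iInf, mem_kerCoeff]

lemma level_le_delta (hε : ε₁ (-1) * ε₂ (-1) = (-1) ^ m) (n : ℕ) :
    level (ε₁ := ε₁) (ε₂ := ε₂) hε n ≤ (delta hε).toSubmodule := inf_le_left

lemma antitone_level (hε : ε₁ (-1) * ε₂ (-1) = (-1) ^ m) :
    Antitone (level (ε₁ := ε₁) (ε₂ := ε₂) hε) := fun _ _ hab _ hf =>
  mem_level.2 ⟨(mem_level.1 hf).1, fun j hj => (mem_level.1 hf).2 j (hj.trans_le hab)⟩

lemma mem_level_succ {hε : ε₁ (-1) * ε₂ (-1) = (-1) ^ m} {n : ℕ} {f : PS m ε₁ ε₂} :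
    f ∈ level hε (n + 1) ↔ f ∈ level hε n ∧ HasCoeff hε (stepKind ε₁ n) (n / 2) f 0 := by
  rw [mem_level, mem_level, and_assoc]
  refine and_congr_right fun _ => ⟨fun h => ⟨fun j hj => h j (hj.trans n.lt_succ_self),
    h n n.lt_succ_self⟩, fun h j hj => ?_⟩
  rcases Nat.lt_succ_iff_lt_or_eq.1 hj with hj | rfl
  exacts [h.1 j hj, h.2]

lemma level_embGL1 {hε : ε₁ (-1) * ε₂ (-1) = (-1) ^ m} {n : ℕ} {f : PS m ε₁ ε₂}
    (hf : f ∈ level hε n) (t : ℝˣ) : psAction m ε₁ ε₂ (embGL1 t) f ∈ level hε n :=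
  mem_level.2 ⟨(delta hε).apply_mem_toSubmodule _ (mem_level.1 hf).1, fun j hj => by
    simpa using ((mem_level.1 hf).2 j hj).embGL1 t⟩

/-- Both kinds of coefficients of order less than `n / 2` vanish on the `n`-th step. -/
lemma hasCoeff_of_mem_level {hε : ε₁ (-1) * ε₂ (-1) = (-1) ^ m} {n : ℕ} {f : PS m ε₁ ε₂}
    (hf : f ∈ level hε n) (b : Bool) {l : ℕ} (hl : 2 * l + 1 < n) : HasCoeff hε b l f 0 := by
  have h1 := (mem_level.1 hf).2 (2 * l) (by omega)
  have h2 := (mem_level.1 hf).2 (2 * l + 1) hl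
  rw [stepKind_two_mul_add_one, show (2 * l + 1) / 2 = l by omega] at h2
  rw [show 2 * l / 2 = l by omega] at h1
  by_cases h : stepKind ε₁ (2 * l) = b
  · rwa [h] at h1
  · rwa [Bool.eq_not.2 h, Bool.not_not] at h2

/-- A moment exists only after the Taylor coefficients of lower order vanish, and the earlier steps
have imposed precisely that. -/
lemma exists_hasCoeff (hm : 1 ≤ m) {hε : ε₁ (-1) * ε₂ (-1) = (-1) ^ m} {n : ℕ} {f : PS m ε₁ ε₂}
    (hf : f ∈ level hε n) : ∃ a, HasCoeff hε (stepKind ε₁ n) (n / 2) f a := by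
  cases h : stepKind ε₁ n with
  | true => exact ⟨_, rfl⟩
  | false => exact exists_hasMoment hε (k := m + n / 2 - 1) (l := n / 2) (by omega) fun j hj =>
      hasCoeff_of_mem_level hf true (by omega)

/-- The functional defining the next step of the filtration. -/
def levelCoeff (hm : 1 ≤ m) (hε : ε₁ (-1) * ε₂ (-1) = (-1) ^ m) (n : ℕ) :
    level (ε₁ := ε₁) (ε₂ := ε₂) hε n →ₗ[ℂ] ℂ where
  toFun f := (exists_hasCoeff hm f.2).choose
  map_add' f f' := HasCoeff.unique (exists_hasCoeff hm (f + f').2).choose_spec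
    ((exists_hasCoeff hm f.2).choose_spec.add (exists_hasCoeff hm f'.2).choose_spec)
  map_smul' c f := HasCoeff.unique (exists_hasCoeff hm (c • f).2).choose_spec
    ((exists_hasCoeff hm f.2).choose_spec.smul c)

lemma hasCoeff_levelCoeff (hm : 1 ≤ m) (hε : ε₁ (-1) * ε₂ (-1) = (-1) ^ m) (n : ℕ)
    (f : level (ε₁ := ε₁) (ε₂ := ε₂) hε n) :
    HasCoeff hε (stepKind ε₁ n) (n / 2) f (levelCoeff hm hε n f) :=
  (exists_hasCoeff hm f.2).choose_spec

lemma levelCoeff_eq_zero_iff (hm : 1 ≤ m) (hε : ε₁ (-1) * ε₂ (-1) = (-1) ^ m) (n : ℕ)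
    (f : level (ε₁ := ε₁) (ε₂ := ε₂) hε n) :
    levelCoeff hm hε n f = 0 ↔ (f : PS m ε₁ ε₂) ∈ level hε (n + 1) := by
  have h := hasCoeff_levelCoeff hm hε n f
  rw [mem_level_succ]
  refine ⟨fun h0 => ⟨f.2, h0 ▸ h⟩, fun h0 => h.unique h0.2⟩

lemma levelCoeff_embGL1 (hm : 1 ≤ m) (hε : ε₁ (-1) * ε₂ (-1) = (-1) ^ m) (n : ℕ)
    (f : level (ε₁ := ε₁) (ε₂ := ε₂) hε n) (t : ℝˣ) :
    levelCoeff hm hε n ⟨psAction m ε₁ ε₂ (embGL1 t) f, level_embGL1 f.2 t⟩ =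
      stepChar m n t * levelCoeff hm hε n f := by
  rw [← coeffChar_stepKind hm ε₁ n t]
  exact HasCoeff.unique (hasCoeff_levelCoeff hm hε n _)
    ((hasCoeff_levelCoeff hm hε n f).embGL1 t)

/-- A principal value is a pointwise limit of continuous truncated moments, so Banach–Steinhaus
applies on the n-th step once that step is closed, hence complete. Closedness and continuity are
thus proved alternately along the filtration. -/
lemma continuous_levelCoeff (hm : 1 ≤ m) (hε : ε₁ (-1) * ε₂ (-1) = (-1) ^ m) (n : ℕ)
    (hcl : IsClosed (level (ε₁ := ε₁) (ε₂ := ε₂) hε n : Set (PS m ε₁ ε₂))) :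
    Continuous (levelCoeff (ε₁ := ε₁) (ε₂ := ε₂) hm hε n) := by
  have h := hasCoeff_levelCoeff (ε₁ := ε₁) (ε₂ := ε₂) hm hε n
  cases hb : stepKind ε₁ n with
  | true =>
    rw [hb] at h
    exact ((continuous_inftyDeriv hε (n / 2) 0).comp continuous_subtype_val).congr h
  | false =>
    rw [hb] at h
    refine ((isFrechet_PS hε).of_isClosed hcl).continuous_of_tendsto
      (fun R : ℕ => momentTrunc hε (m + n / 2 - 1) R ∘ₗ (level hε n).subtype) (fun R => ?_) _
      fun f => ?_
    · exact (continuous_momentTrunc hε _ _).comp continuous_subtype_val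
    · exact Tendsto.comp (h f) tendsto_natCast_atTop_atTop

lemma isClosed_level (hm : 1 ≤ m) (hε : ε₁ (-1) * ε₂ (-1) = (-1) ^ m) (n : ℕ) :
    IsClosed (level (ε₁ := ε₁) (ε₂ := ε₂) hε n : Set (PS m ε₁ ε₂)) := by
  induction n with
  | zero =>
    convert isClosed_delta (ε₁ := ε₁) (ε₂ := ε₂) hε using 1
    ext f
    simp [mem_level]
  | succ n ih =>
    have h1 := (isClosed_singleton (x := (0 : ℂ))).preimage (continuous_levelCoeff hm hε n ih)
    have h2 := ih.isClosedEmbedding_subtypeVal.isClosedMap _ h1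
    convert h2 using 1
    ext f
    simp only [SetLike.mem_coe, Set.mem_image, Set.mem_preimage, Set.mem_singleton_iff,
      Subtype.exists]
    constructor
    · intro hf
      exact ⟨f, antitone_level hε n.le_succ hf, (levelCoeff_eq_zero_iff hm hε n _).2 hf, rfl⟩
    · rintro ⟨f', hf', h0, rfl⟩
      exact (levelCoeff_eq_zero_iff hm hε n _).1 h0

/-- The kernel elements for w = i and w = -i have the same Taylor coefficient l! but opposite
moments -iπ and iπ. Their sum isolates the Taylor coefficient, their difference the moment; all
lower coefficients vanish. -/
lemma exists_hasCoeff_eq (hm : 1 ≤ m) (hε : ε₁ (-1) * ε₂ (-1) = (-1) ^ m) (b : Bool) (l : ℕ)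
    (c : ℂ) : ∃ f ∈ (delta (ε₁ := ε₁) (ε₂ := ε₂) hε).toSubmodule,
      (∀ b', ∀ j < l, HasCoeff hε b' j f 0) ∧ HasCoeff hε b l f c ∧ HasCoeff hε (!b) l f 0 := by
  have hI : Complex.I ^ 2 = -1 := Complex.I_sq
  have hI' : (-Complex.I) ^ 2 = -1 := by rw [neg_sq, hI]
  have hlow : ∀ {w : ℂ} (hw : w ^ 2 = -1) b', ∀ j < l,
      HasCoeff hε b' j (kernelElt hε hw l : PS m ε₁ ε₂) 0 := by
    intro w hw b' j hj
    cases b' with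
    | true => exact (inftyDeriv_kernelElt hε hw l).1 j hj
    | false => exact hasMoment_kernelElt hε hw (by omega)
  have htop : ∀ {w : ℂ} (hw : w ^ 2 = -1) b', HasCoeff hε b' l (kernelElt hε hw l : PS m ε₁ ε₂)
      (match b' with | true => l.factorial | false => -w * Real.pi) := by
    intro w hw b'
    cases b' with
    | true => exact (inftyDeriv_kernelElt hε hw l).2
    | false => exact hasMoment_kernelElt_top hε hw (by omega)
  set p : PS m ε₁ ε₂ := kernelElt hε hI l with hp
  set q : PS m ε₁ ε₂ := kernelElt hε hI' l with hq
  have hpi : (Real.pi : ℂ) ≠ 0 := by exact_mod_cast Real.pi_ne_zero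
  have hfac : (l.factorial : ℂ) ≠ 0 := by exact_mod_cast l.factorial_ne_zero
  have main : ∀ x y : ℂ, (x • p + y • q) ∈ (delta hε).toSubmodule ∧
      (∀ b', ∀ j < l, HasCoeff hε b' j (x • p + y • q) 0) ∧
      ∀ b', HasCoeff hε b' l (x • p + y • q)
        (x * (match b' with | true => l.factorial | false => -Complex.I * Real.pi) +
          y * (match b' with | true => l.factorial | false => -(-Complex.I) * Real.pi)) := by
    intro x y
    refine ⟨Submodule.add_mem _ (Submodule.smul_mem _ _ (kernelElt_mem_delta hε hI l))
      (Submodule.smul_mem _ _ (kernelElt_mem_delta hε hI' l)), fun b' j hj => ?_, fun b' => ?_⟩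
    · simpa using ((hlow hI b' j hj).smul x).add ((hlow hI' b' j hj).smul y)
    · exact ((htop hI b').smul x).add ((htop hI' b').smul y)
  cases b with
  | true =>
    obtain ⟨h1, h2, h3⟩ := main (c / (2 * l.factorial)) (c / (2 * l.factorial))
    refine ⟨_, h1, h2, ?_, ?_⟩
    · convert h3 true using 1
      field_simp
      ring
    · convert h3 false using 1
      · rfl
      · simp only
        ring
  | false =>
    obtain ⟨h1, h2, h3⟩ := main (-c / (2 * Complex.I * Real.pi)) (c / (2 * Complex.I * Real.pi))
    refine ⟨_, h1, h2, ?_, ?_⟩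
    · convert h3 false using 1
      field_simp
      ring
    · convert h3 true using 1
      · rfl
      · simp only
        ring

lemma surjective_levelCoeff (hm : 1 ≤ m) (hε : ε₁ (-1) * ε₂ (-1) = (-1) ^ m) (n : ℕ) :
    Function.Surjective (levelCoeff (ε₁ := ε₁) (ε₂ := ε₂) hm hε n) := by
  intro c
  obtain ⟨f, hf, h1, h2, h3⟩ :=
    exists_hasCoeff_eq (ε₁ := ε₁) (ε₂ := ε₂) hm hε (stepKind ε₁ n) (n / 2) c
  have hmem : f ∈ level hε n := by
    refine mem_level.2 ⟨hf, fun j hj => ?_⟩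
    rcases lt_or_ge (j / 2) (n / 2) with h | h
    · exact h1 _ _ h
    -- With j < n and equal halves, j and n are the two steps belonging to one l, so j concerns the
    -- other kind of coefficient, arranged to vanish.
    · obtain ⟨l, rfl⟩ : ∃ l, j = 2 * l := ⟨j / 2, by omega⟩
      obtain rfl : n = 2 * l + 1 := by omega
      rw [stepKind_two_mul_add_one, Bool.not_not, show (2 * l + 1) / 2 = l by omega] at h3
      rwa [show 2 * l / 2 = l by omega]
  exact ⟨⟨f, hmem⟩, HasCoeff.unique (hasCoeff_levelCoeff hm hε n ⟨f, hmem⟩) h2⟩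

lemma norm_stepChar (m n : ℕ) {t : ℝˣ} (ht : 0 < (t : ℝ)) :
    ‖stepChar m n t‖ = (t : ℝ) ^ ((m : ℝ) / 2) * (t : ℝ) ^ (n / 2) := by
  have h1 : ‖sgn t‖ = 1 := by simp [sgn, Real.sign_of_pos ht]
  rw [stepChar, norm_mul, norm_pow, h1, one_pow, one_mul, absPow, abs_of_pos ht,
    Complex.norm_cpow_eq_rpow_re_of_pos ht, ← Real.rpow_natCast, ← Real.rpow_add ht]
  congr 1
  simp

/-- The rescaled dilations contract the deep steps of the filtration. -/
lemma exists_psSeminorm_dilation_lt (hε : ε₁ (-1) * ε₂ (-1) = (-1) ^ m) (N : ℕ) {n : ℕ}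
    (hn : 2 * N + 2 ≤ n) (f : PS m ε₁ ε₂) {δ : ℝ} (hδ : 0 < δ) :
    ∃ t : ℝˣ, psSeminorm N ((stepChar m n t)⁻¹ • psAction m ε₁ ε₂ (embGL1 t) f) < δ := by
  obtain ⟨C, hC⟩ := exists_psSeminorm_growth_bound hε f N
  -- Any s ≥ 1 exceeding |C|/δ works: then C s^N < δ s^{N+1} ≤ δ s^{⌊n/2⌋}.
  set s : ℝ := max 1 (|C| / δ + 1) with hs
  have hs1 : 1 ≤ s := le_max_left _ _
  have hs0 : 0 < s := by linarith
  set t : ℝˣ := Units.mk0 s hs0.ne' with ht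
  have hts : (t : ℝ) = s := rfl
  refine ⟨t, ?_⟩
  have h1 := hC t hs1
  rw [map_smul_eq_mul, norm_inv, norm_stepChar m n hs0, hts]
  rw [hts] at h1
  have hr : 0 < s ^ ((m : ℝ) / 2) := Real.rpow_pos_of_pos hs0 _
  have h2 : C * s ^ N < δ * s ^ (n / 2) := by
    calc C * s ^ N ≤ |C| * s ^ N := by gcongr; exact le_abs_self C
      _ < δ * s * s ^ N := by
        gcongr
        have : |C| / δ + 1 ≤ s := le_max_right _ _
        have h3 : |C| / δ < s := by linarith
        rw [div_lt_iff₀ hδ] at h3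
        linarith
      _ = δ * s ^ (N + 1) := by ring
      _ ≤ δ * s ^ (n / 2) := by
        have : N + 1 ≤ n / 2 := by omega
        gcongr
  rw [inv_mul_lt_iff₀ (by positivity)]
  calc _ ≤ s ^ ((m : ℝ) / 2) * (C * s ^ N) := h1
    _ < s ^ ((m : ℝ) / 2) * (δ * s ^ (n / 2)) := by gcongr
    _ = _ := by ring

end

section

open Filter Topology MeasureTheory
open scoped FourierTransform

variable {m : ℕ} {ε₁ ε₂ : ℝˣ →* ℤˣ}

/-! ### The intersection of the filtration -/

lemma hasMoment_ofSchwartz_iff (hε : ε₁ (-1) * ε₂ (-1) = (-1) ^ m) (k : ℕ) (F : 𝓢(ℝ, ℂ)) (a : ℂ) :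
    HasMoment hε k (ofSchwartz hε F : PS m ε₁ ε₂) a ↔ ∫ x : ℝ, (x : ℂ) ^ k * F x = a := by
  have hi : Integrable fun x : ℝ => (x : ℂ) ^ k * F x := by
    refine ((powMul k F).integrable (μ := volume)).congr (Eventually.of_forall fun x => ?_)
    exact powMul_apply k F x
  have h := intervalIntegral_tendsto_integral hi tendsto_neg_atTop_atBot tendsto_id
  simp only [HasMoment, momentTrunc_apply, lineChart_ofSchwartz]
  exact ⟨fun h' => tendsto_nhds_unique h h', fun h' => h' ▸ h⟩

/-- The k-th derivative of the Fourier transform at 0 is (-2πi)^k times the k-th moment. -/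
lemma fourier_mem_schwartzUnits_iff (F : 𝓢(ℝ, ℂ)) :
    𝓕 F ∈ schwartzUnits ↔ ∀ k : ℕ, ∫ x : ℝ, (x : ℂ) ^ k * F x = 0 := by
  have hi : ∀ n : ℕ, Integrable fun x : ℝ => x ^ n • F x := by
    intro n
    have := (powMul n F).integrable (μ := volume)
    refine this.congr (Eventually.of_forall fun x => ?_)
    simp only [powMul_apply, Complex.real_smul]
    push_cast
    rfl
  refine forall_congr' fun k => ?_
  have h1 : iteratedDeriv k (𝓕 F : 𝓢(ℝ, ℂ)) 0 =
      (-2 * Real.pi * Complex.I) ^ k * ∫ x : ℝ, (x : ℂ) ^ k * F x := by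
    rw [SchwartzMap.fourier_coe, Real.iteratedDeriv_fourier (N := ⊤) (fun n _ => hi n) le_top,
      Real.fourier_real_eq, ← integral_const_mul]
    refine integral_congr_ae (Eventually.of_forall fun x => ?_)
    simp only [mul_zero, neg_zero, AddChar.map_zero_eq_one, one_smul, smul_eq_mul]
    rw [mul_pow, mul_assoc]
  rw [h1]
  have h2 : (-2 * Real.pi * Complex.I : ℂ) ^ k ≠ 0 := by
    refine pow_ne_zero _ (mul_ne_zero (mul_ne_zero (by norm_num) ?_) Complex.I_ne_zero)
    exact_mod_cast Real.pi_ne_zero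
  simp

/-- For a Schwartz chart the Taylor conditions at infinity hold automatically, so only moments
remain: those of order at most m - 2 come from `delta`, the others from the steps of the filtration.
-/
lemma ofSchwartz_mem_iInf_level_iff (hm : 1 ≤ m) (hε : ε₁ (-1) * ε₂ (-1) = (-1) ^ m)
    (F : 𝓢(ℝ, ℂ)) : (ofSchwartz hε F : PS m ε₁ ε₂) ∈ ⨅ n, level hε n ↔ 𝓕 F ∈ schwartzUnits := by
  rw [fourier_mem_schwartzUnits_iff, Submodule.mem_iInf]
  simp only [← hasMoment_ofSchwartz_iff (ε₁ := ε₁) (ε₂ := ε₂) hε]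
  constructor
  · intro h k
    rcases le_or_gt (k + 2) m with hk | hk
    · exact (mem_delta_iff_hasMoment hε).1 (level_le_delta hε 0 (h 0)) k hk
    · obtain ⟨l, rfl⟩ : ∃ l, k = m + l - 1 := ⟨k + 1 - m, by omega⟩
      exact hasCoeff_of_mem_level (h (2 * l + 2)) false (by omega)
  · refine fun h n => mem_level.2 ⟨(mem_delta_iff_hasMoment hε).2 fun k _ => h k, fun j _ => ?_⟩
    cases stepKind ε₁ j with
    | true => exact (isFlat_inftyChart_ofSchwartz hε F).iteratedDeriv_zero _
    | false => exact h _

lemma exists_schwartz_of_mem_iInf_level {hε : ε₁ (-1) * ε₂ (-1) = (-1) ^ m} {f : PS m ε₁ ε₂}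
    (hf : f ∈ ⨅ n, level hε n) : ∃ F : 𝓢(ℝ, ℂ), ofSchwartz hε F = f :=
  exists_schwartz hε ⟨contDiff_inftyChart hε f, fun l =>
    hasCoeff_of_mem_level ((Submodule.mem_iInf _).1 hf (2 * l + 2)) true (by omega)⟩

/-! ### The equivariant isomorphism of 𝓢(ℝˣ) with the intersection of the filtration. -/

lemma continuous_signPowMul (c : ℂ) (s : ℝ) : Continuous (signPowMul c s) := by
  refine isFrechet_schwartzUnits.continuous_of_closed_graph isFrechet_schwartzUnits _
    fun u φ ψ hu hψ => Subtype.ext (SchwartzMap.ext fun x => ?_)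
  have he : Continuous fun φ : schwartzUnits => φ.1 x :=
    (continuous_iteratedDeriv_apply 0 x).comp continuous_subtype_val
  have h1 := ((he.tendsto φ).comp hu).const_mul (signPow c s x)
  exact tendsto_nhds_unique ((he.tendsto ψ).comp hψ) h1

lemma continuous_lineChart_apply (hε : ε₁ (-1) * ε₂ (-1) = (-1) ^ m) (x : ℝ) :
    Continuous fun f : PS m ε₁ ε₂ => lineChart f x := continuous_plane_apply hε (1, x)

/-- Evaluations at points of the line are continuous on both sides and separate elements, so the
graph is closed and no seminorm estimate is needed. -/
lemma continuous_ofSchwartz (hε : ε₁ (-1) * ε₂ (-1) = (-1) ^ m) :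
    Continuous (ofSchwartz hε : 𝓢(ℝ, ℂ) →ₗ[ℂ] PS m ε₁ ε₂) := by
  refine isFrechet_schwartz.continuous_of_closed_graph (isFrechet_PS hε) _
    fun u F f hu hf => lineChart_injective hε (funext fun x => ?_)
  have h1 := ((continuous_lineChart_apply hε x).tendsto f).comp hf
  simp only [Function.comp_def, lineChart_ofSchwartz] at h1 ⊢
  exact tendsto_nhds_unique h1 (((continuous_iteratedDeriv_apply 0 x).tendsto F).comp hu)

/-- The sign of the twist in the embedding of `𝓢(ℝˣ)` into `δ(m)`. -/
def twistSign (m : ℕ) (ε₁ : ℝˣ →* ℤˣ) : ℂ := ((ε₁ (-1) : ℤ) : ℂ) * (-1) ^ m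

lemma twistSign_mul_self (m : ℕ) (ε₁ : ℝˣ →* ℤˣ) : twistSign m ε₁ * twistSign m ε₁ = 1 := by
  rw [twistSign, mul_mul_mul_comm, ← mul_pow]
  rcases Int.units_eq_one_or (ε₁ (-1)) with h | h <;> simp [h]

/-- The embedding of `𝓢(ℝˣ)` into the principal series: a twist followed by the inverse Fourier
transform. -/
def ofSchwartzUnits (hε : ε₁ (-1) * ε₂ (-1) = (-1) ^ m) : schwartzUnits →ₗ[ℂ] PS m ε₁ ε₂ where
  toFun φ := ofSchwartz hε (𝓕⁻ (signPowMul (twistSign m ε₁) ((m : ℝ) / 2 - 1) φ).1)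
  map_add' φ ψ := by
    rw [map_add, Submodule.coe_add, FourierTransform.fourierInv_add, map_add]
  map_smul' c φ := by
    rw [map_smul, Submodule.coe_smul, FourierTransform.fourierInv_smul, map_smul]
    rfl

lemma ofSchwartzUnits_apply (hε : ε₁ (-1) * ε₂ (-1) = (-1) ^ m) (φ : schwartzUnits) :
    (ofSchwartzUnits hε φ : PS m ε₁ ε₂) =
      ofSchwartz hε (𝓕⁻ (signPowMul (twistSign m ε₁) ((m : ℝ) / 2 - 1) φ).1) := rfl

lemma continuous_ofSchwartzUnits (hε : ε₁ (-1) * ε₂ (-1) = (-1) ^ m) :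
    Continuous (ofSchwartzUnits hε : schwartzUnits →ₗ[ℂ] PS m ε₁ ε₂) :=
  (continuous_ofSchwartz hε).comp (FourierTransform.continuous_fourierInv.comp
    (continuous_subtype_val.comp (continuous_signPowMul _ _)))

lemma signPowMul_signPowMul {c c' : ℂ} (h : c * c' = 1) {s s' : ℝ} (hs : s + s' = 0)
    (φ : schwartzUnits) : signPowMul c s (signPowMul c' s' φ) = φ := by
  refine Subtype.ext (SchwartzMap.ext fun x => ?_)
  rw [signPowMul_apply, signPowMul_apply]
  by_cases hx : x = 0
  · rw [hx, (schwartzUnits_isFlat φ.2).apply_zero, mul_zero, mul_zero]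
  · rw [← mul_assoc, signPow_mul _ _ _ _ hx, h, hs, signPow_one_zero, one_mul]

lemma ofSchwartz_injective (hε : ε₁ (-1) * ε₂ (-1) = (-1) ^ m) :
    Function.Injective (ofSchwartz hε : 𝓢(ℝ, ℂ) →ₗ[ℂ] PS m ε₁ ε₂) := fun F F' h => by
  have := congrArg lineChart h
  rw [lineChart_ofSchwartz, lineChart_ofSchwartz] at this
  exact DFunLike.coe_injective this

lemma ofSchwartzUnits_injective (hε : ε₁ (-1) * ε₂ (-1) = (-1) ^ m) :
    Function.Injective (ofSchwartzUnits hε : schwartzUnits →ₗ[ℂ] PS m ε₁ ε₂) := fun φ ψ h => by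
  have h1 := congrArg (𝓕 : 𝓢(ℝ, ℂ) → 𝓢(ℝ, ℂ)) (ofSchwartz_injective hε h)
  rw [FourierTransform.fourier_fourierInv_eq, FourierTransform.fourier_fourierInv_eq] at h1
  have h2 := congrArg (signPowMul (twistSign m ε₁) (1 - (m : ℝ) / 2)) (Subtype.ext h1)
  rwa [signPowMul_signPowMul (twistSign_mul_self m ε₁) (by ring),
    signPowMul_signPowMul (twistSign_mul_self m ε₁) (by ring)] at h2

lemma range_ofSchwartzUnits (hm : 1 ≤ m) (hε : ε₁ (-1) * ε₂ (-1) = (-1) ^ m) :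
    LinearMap.range (ofSchwartzUnits hε : schwartzUnits →ₗ[ℂ] PS m ε₁ ε₂) = ⨅ n, level hε n := by
  ext f
  constructor
  · rintro ⟨φ, rfl⟩
    rw [ofSchwartzUnits_apply, ofSchwartz_mem_iInf_level_iff hm hε,
      FourierTransform.fourier_fourierInv_eq]
    exact Subtype.property _
  · intro hf
    obtain ⟨F, rfl⟩ := exists_schwartz_of_mem_iInf_level hf
    have hF := (ofSchwartz_mem_iInf_level_iff hm hε F).1 hf
    refine ⟨signPowMul (twistSign m ε₁) (1 - (m : ℝ) / 2) ⟨𝓕 F, hF⟩, ?_⟩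
    rw [ofSchwartzUnits_apply, signPowMul_signPowMul (twistSign_mul_self m ε₁) (by ring),
      FourierTransform.fourierInv_fourier_eq]

lemma signPow_mul_arg {c : ℂ} (hc : c * c = 1) (s : ℝ) {x y : ℝ} (hx : x ≠ 0) (hy : y ≠ 0) :
    signPow c s (x * y) = signPow c s x * signPow c s y := by
  rw [signPow, signPow, signPow, abs_mul, Real.mul_rpow (abs_nonneg _) (abs_nonneg _)]
  push_cast
  rcases lt_or_gt_of_ne hx with h1 | h1 <;> rcases lt_or_gt_of_ne hy with h2 | h2
  · rw [if_pos (mul_pos_of_neg_of_neg h1 h2), if_neg h1.not_gt, if_neg h2.not_gt]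
    linear_combination -(((|x| ^ s : ℝ) : ℂ) * ((|y| ^ s : ℝ) : ℂ)) * hc
  · rw [if_neg (mul_neg_of_neg_of_pos h1 h2).not_gt, if_neg h1.not_gt, if_pos h2]
    ring
  · rw [if_neg (mul_neg_of_pos_of_neg h1 h2).not_gt, if_pos h1, if_neg h2.not_gt]
    ring
  · rw [if_pos (mul_pos h1 h2), if_pos h1, if_pos h2]
    ring

/-- This identity dictates the twist. On the chart the torus acts by F(x) ↦ `detChar`(t) t^{-m}
F(x/t); on the Fourier side this is dilation by t with factor `detChar`(t) t^{-m} |t|, and the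
multiplicativity of `signPow` supplies the inverse factor. -/
lemma detChar_mul_signPow (m : ℕ) (ε₁ : ℝˣ →* ℤˣ) (t : ℝˣ) :
    detChar m ε₁ t * ((t : ℂ) ^ m)⁻¹ * ((|(t : ℝ)| : ℝ) : ℂ) *
      signPow (twistSign m ε₁) ((m : ℝ) / 2 - 1) t = 1 := by
  have ht : (t : ℝ) ≠ 0 := t.ne_zero
  have h1 : detChar m ε₁ t = signPow ((ε₁ (-1) : ℤ) : ℂ) ((m : ℝ) / 2) t := rfl
  have h2 : ((t : ℂ) ^ m)⁻¹ = signPow ((-1) ^ m) (-(m : ℝ)) t := by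
    rw [signPow, Real.rpow_neg (abs_nonneg _), Real.rpow_natCast]
    rcases lt_or_gt_of_ne ht with h | h
    · rw [if_neg h.not_gt, abs_of_neg h]
      push_cast
      rw [neg_pow (t : ℂ) m, mul_inv, ← mul_assoc]
      rcases neg_one_pow_eq_or ℂ m with h | h <;> rw [h] <;> norm_num
    · rw [if_pos h, abs_of_pos h]
      push_cast
      ring
  have h3 : ((|(t : ℝ)| : ℝ) : ℂ) = signPow 1 1 t := by simp [signPow]
  rw [h1, h2, h3, signPow_mul _ _ _ _ ht, signPow_mul _ _ _ _ ht, signPow_mul _ _ _ _ ht]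
  have e1 : ((ε₁ (-1) : ℤ) : ℂ) * (-1) ^ m * 1 * twistSign m ε₁ = 1 := by
    rw [mul_one]
    exact twistSign_mul_self m ε₁
  rw [e1, show (m : ℝ) / 2 + -(m : ℝ) + 1 + ((m : ℝ) / 2 - 1) = 0 by ring, signPow_one_zero]

lemma ofSchwartzUnits_unitsTranslation (hε : ε₁ (-1) * ε₂ (-1) = (-1) ^ m) (t : ℝˣ)
    (φ : schwartzUnits) : (ofSchwartzUnits hε (unitsTranslation t φ) : PS m ε₁ ε₂) =
      psAction m ε₁ ε₂ (embGL1 t) (ofSchwartzUnits hε φ) := by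
  refine lineChart_injective hε (funext fun x => ?_)
  have ht : (t : ℝ) ≠ 0 := t.ne_zero
  rw [lineChart_embGL1 hε, ofSchwartzUnits_apply, ofSchwartzUnits_apply, lineChart_ofSchwartz,
    lineChart_ofSchwartz, SchwartzMap.fourierInv_coe, SchwartzMap.fourierInv_coe,
    Real.fourierInv_eq', Real.fourierInv_eq']
  set c := twistSign m ε₁
  set s := (m : ℝ) / 2 - 1
  set g : ℝ → ℂ := fun v => Complex.exp ((((2 * Real.pi * inner ℝ v (x / t)) : ℝ) : ℂ) * Complex.I) •
    (signPowMul c s φ).1 v with hg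
  have h1 := Measure.integral_comp_mul_right g (t : ℝ)
  have h2 : ∫ v, g v = ((|(t : ℝ)| : ℝ) : ℂ) * ∫ v, g (v * t) := by
    rw [h1, Complex.real_smul, ← mul_assoc, ← Complex.ofReal_mul, abs_inv,
      mul_inv_cancel₀ (abs_ne_zero.2 ht), Complex.ofReal_one, one_mul]
  rw [h2, ← mul_assoc, ← integral_const_mul]
  refine integral_congr_ae (Eventually.of_forall fun v => ?_)
  simp only [hg, signPowMul_apply, unitsTranslation_apply, smul_eq_mul]
  have e : (inner ℝ (v * (t : ℝ)) (x / t) : ℝ) = inner ℝ v x := by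
    simp only [RCLike.inner_apply, conj_trivial]
    field_simp
  rw [e]
  by_cases hv : v = 0
  · simp [hv, (schwartzUnits_isFlat φ.2).apply_zero]
  · rw [signPow_mul_arg (twistSign_mul_self m ε₁) _ hv ht]
    have := detChar_mul_signPow m ε₁ t
    linear_combination -(Complex.exp ((((2 * Real.pi * inner ℝ v x) : ℝ) : ℂ) * Complex.I) *
      (signPow c s v * φ.1 (v * t))) * this

/-- The intersection of the filtration, as a subspace of `δ(m)`. -/
def bottomStep (hε : ε₁ (-1) * ε₂ (-1) = (-1) ^ m) :
    Submodule ℂ (delta (ε₁ := ε₁) (ε₂ := ε₂) hε).toSubmodule :=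
  (⨅ n, level hε n).comap (delta hε).toSubmodule.subtype

lemma isClosed_bottomStep (hm : 1 ≤ m) (hε : ε₁ (-1) * ε₂ (-1) = (-1) ^ m) :
    IsClosed (bottomStep hε : Set (delta (ε₁ := ε₁) (ε₂ := ε₂) hε).toSubmodule) := by
  have : IsClosed ((⨅ n, level hε n : Submodule ℂ (PS m ε₁ ε₂)) : Set (PS m ε₁ ε₂)) := by
    rw [Submodule.coe_iInf]
    exact isClosed_iInter fun n => isClosed_level hm hε n
  exact this.preimage continuous_subtype_val

/-- The bottom step of `δ(m)` is `𝓢(ℝˣ)`. -/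
theorem exists_schwartzUnits_equiv (hm : 1 ≤ m) (hε : ε₁ (-1) * ε₂ (-1) = (-1) ^ m) :
    ∃ e : schwartzUnits ≃L[ℂ] bottomStep (ε₁ := ε₁) (ε₂ := ε₂) hε, ∀ φ,
      ((e φ : (delta hε).toSubmodule) : PS m ε₁ ε₂) = ofSchwartzUnits hε φ := by
  have hle : (⨅ n, level (ε₁ := ε₁) (ε₂ := ε₂) hε n) ≤ (delta hε).toSubmodule :=
    (iInf_le _ 0).trans (level_le_delta hε 0)
  have hmem : ∀ φ : schwartzUnits, (ofSchwartzUnits hε φ : PS m ε₁ ε₂) ∈ ⨅ n, level hε n :=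
    fun φ => range_ofSchwartzUnits hm hε ▸ LinearMap.mem_range_self _ φ
  let T : schwartzUnits →ₗ[ℂ] bottomStep (ε₁ := ε₁) (ε₂ := ε₂) hε :=
    LinearMap.codRestrict _ (LinearMap.codRestrict _ (ofSchwartzUnits hε) fun φ => hle (hmem φ))
      hmem
  have hTv : ∀ φ, ((T φ : (delta hε).toSubmodule) : PS m ε₁ ε₂) = ofSchwartzUnits hε φ :=
    fun φ => rfl
  have hT : Function.Bijective T := by
    refine ⟨fun φ ψ h => ofSchwartzUnits_injective hε ?_, fun x => ?_⟩
    · rw [← hTv, ← hTv, h]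
    · have hx : ((x : (delta hε).toSubmodule) : PS m ε₁ ε₂) ∈ ⨅ n, level hε n :=
        x.2
      rw [← range_ofSchwartzUnits hm hε] at hx
      obtain ⟨φ, hφ⟩ := hx
      exact ⟨φ, Subtype.ext (Subtype.ext hφ)⟩
  have hXF : IsFrechet (bottomStep (ε₁ := ε₁) (ε₂ := ε₂) hε) :=
    ((isFrechet_PS hε).of_isClosed (isClosed_delta hε)).of_isClosed (isClosed_bottomStep hm hε)
  refine ⟨isFrechet_schwartzUnits.continuousLinearEquiv hXF (LinearEquiv.ofBijective T hT)
    fun u φ y hu hy => ?_, fun φ => rfl⟩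
  refine Subtype.ext (Subtype.ext (lineChart_injective hε (funext fun x => ?_)))
  have hc : Continuous fun z : bottomStep hε =>
      lineChart ((z : (delta hε).toSubmodule) : PS m ε₁ ε₂) x :=
    (continuous_lineChart_apply hε x).comp (continuous_subtype_val.comp continuous_subtype_val)
  have h1 := (hc.tendsto y).comp hy
  have h2 := (((continuous_lineChart_apply hε x).comp
    (continuous_ofSchwartzUnits hε)).tendsto φ).comp hu
  exact tendsto_nhds_unique h1 h2

end

section

open Filter Topology MeasureTheory

/-! ### Fourier series of smooth periodic functions -/

/-- The function `x ↦ e^{ikx}`. -/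
def expChar (k : ℤ) (x : ℝ) : ℂ := Complex.exp (k * x * Complex.I)

lemma expChar_add_int (k l : ℤ) (x : ℝ) : expChar (k + l) x = expChar k x * expChar l x := by
  rw [expChar, expChar, expChar, ← Complex.exp_add]
  push_cast
  ring_nf

lemma expChar_add (k : ℤ) (x y : ℝ) : expChar k (x + y) = expChar k x * expChar k y := by
  rw [expChar, expChar, expChar, ← Complex.exp_add]
  push_cast
  ring_nf

lemma expChar_zero (x : ℝ) : expChar 0 x = 1 := by simp [expChar]

lemma norm_expChar (k : ℤ) (x : ℝ) : ‖expChar k x‖ = 1 := by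
  rw [expChar, show (k : ℂ) * x * Complex.I = ((k * x : ℝ) : ℂ) * Complex.I by push_cast; ring,
    Complex.norm_exp_ofReal_mul_I]

lemma hasDerivAt_expChar (k : ℤ) (x : ℝ) :
    HasDerivAt (expChar k) (k * Complex.I * expChar k x) x := by
  have h1 : HasDerivAt (fun x : ℝ => (k : ℂ) * x * Complex.I) (k * Complex.I) x := by
    have := ((Complex.ofRealCLM.hasDerivAt (x := x)).const_mul (k : ℂ)).mul_const Complex.I
    simpa using this
  refine h1.cexp.congr_deriv ?_
  rw [expChar, mul_comm]

lemma contDiff_expChar (k : ℤ) : ContDiff ℝ ∞ (expChar k) := by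
  unfold expChar
  exact ((contDiff_const.mul Complex.ofRealCLM.contDiff).mul contDiff_const).cexp

lemma continuous_expChar (k : ℤ) : Continuous (expChar k) := (contDiff_expChar k).continuous

lemma expChar_pi (k : ℤ) : expChar k Real.pi = (-1) ^ k := by
  rw [expChar, mul_assoc, Complex.exp_int_mul, Complex.exp_pi_mul_I]

lemma periodic_expChar (k : ℤ) : Function.Periodic (expChar k) (2 * Real.pi) := fun x => by
  rw [expChar_add, two_mul, expChar_add, expChar_pi, ← mul_zpow]
  simp

lemma iteratedDeriv_expChar (k : ℤ) (n : ℕ) (x : ℝ) :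
    iteratedDeriv n (expChar k) x = (k * Complex.I) ^ n * expChar k x := by
  induction n generalizing x with
  | zero => simp
  | succ n ih =>
    rw [iteratedDeriv_succ, funext ih, deriv_const_mul _ (hasDerivAt_expChar k x).differentiableAt,
      (hasDerivAt_expChar k x).deriv, pow_succ]
    ring

/-- The Fourier coefficients of a function of period `2π`. -/
def circleCoeff (k : ℤ) (h : ℝ → ℂ) : ℂ :=
  ((2 * Real.pi : ℝ) : ℂ)⁻¹ * ∫ x in (0 : ℝ)..2 * Real.pi, h x * expChar (-k) x

lemma circleCoeff_deriv {h : ℝ → ℂ} (hh : Function.Periodic h (2 * Real.pi))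
    (hs : ContDiff ℝ ∞ h) (k : ℤ) :
    circleCoeff k (deriv h) = k * Complex.I * circleCoeff k h := by
  have h1 := intervalIntegral.integral_mul_deriv_eq_deriv_mul (a := 0) (b := 2 * Real.pi)
    (u := expChar (-k)) (v := h) (u' := fun x => ((-k : ℤ) : ℂ) * Complex.I * expChar (-k) x)
    (v' := deriv h) (fun x _ => hasDerivAt_expChar (-k) x)
    (fun x _ => (hs.differentiable (by simp) x).hasDerivAt)
    (Continuous.intervalIntegrable (continuous_const.mul (continuous_expChar _)) _ _)
    ((contDiff_deriv hs).continuous.intervalIntegrable _ _)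
  have h2 : expChar (-k) (2 * Real.pi) = expChar (-k) 0 := by
    simpa using periodic_expChar (-k) 0
  have h3 : h (2 * Real.pi) = h 0 := by simpa using hh 0
  rw [h2, h3, sub_self, zero_sub] at h1
  rw [circleCoeff, circleCoeff]
  simp only [mul_comm _ (expChar (-k) _)]
  simp only [mul_assoc] at h1
  rw [h1, intervalIntegral.integral_const_mul, intervalIntegral.integral_const_mul]
  push_cast
  ring

lemma circleCoeff_iteratedDeriv {h : ℝ → ℂ} (hh : Function.Periodic h (2 * Real.pi))
    (hs : ContDiff ℝ ∞ h) (k : ℤ) (n : ℕ) :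
    circleCoeff k (iteratedDeriv n h) = (k * Complex.I) ^ n * circleCoeff k h := by
  induction n with
  | zero => simp
  | succ n ih =>
    have hsn : ContDiff ℝ ∞ (iteratedDeriv n h) := by
      refine contDiff_infty.2 fun j => ?_
      exact (hs.of_le (m := ((j + n : ℕ) : ℕ∞)) (by exact_mod_cast le_top)).iterate_deriv' j n |>
        fun h' => by simpa [iteratedDeriv_eq_iterate] using h'
    rw [iteratedDeriv_succ, circleCoeff_deriv (periodic_iteratedDeriv hh n) hsn, ih, pow_succ]
    ring

lemma exists_norm_circleCoeff_le {h : ℝ → ℂ} (hh : Function.Periodic h (2 * Real.pi))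
    (hc : Continuous h) : ∃ C, ∀ k, ‖circleCoeff k h‖ ≤ C := by
  obtain ⟨C, hC⟩ := exists_bound_of_periodic Real.two_pi_pos hh hc
  refine ⟨‖((2 * Real.pi : ℝ) : ℂ)⁻¹‖ * (C * |2 * Real.pi - 0|), fun k => ?_⟩
  rw [circleCoeff, norm_mul]
  gcongr
  refine intervalIntegral.norm_integral_le_of_norm_le_const fun x _ => ?_
  rw [norm_mul, norm_expChar, mul_one]
  exact hC x

/-- The coefficients of the second derivative are bounded, so those of h are O(k^{-2}). -/
lemma summable_circleCoeff {h : ℝ → ℂ} (hh : Function.Periodic h (2 * Real.pi))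
    (hs : ContDiff ℝ ∞ h) : Summable fun k => circleCoeff k h := by
  obtain ⟨C, hC⟩ := exists_norm_circleCoeff_le (periodic_iteratedDeriv hh 2)
    (hs.continuous_iteratedDeriv 2 (WithTop.coe_le_coe.2 le_top))
  have hsum : Summable fun k : ℤ => C * ‖(1 : ℝ) / (k : ℝ) ^ 2‖ :=
    ((Real.summable_one_div_int_pow.2 one_lt_two).norm).mul_left C
  refine Summable.of_norm_bounded_eventually hsum ?_
  have h0 : ∀ᶠ k : ℤ in cofinite, k ≠ 0 := (Set.finite_singleton (0 : ℤ)).eventually_cofinite_notMem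
  filter_upwards [h0] with k hk
  have hk' : (0 : ℝ) < (k : ℝ) ^ 2 := by positivity
  have h1 := hC k
  rw [circleCoeff_iteratedDeriv hh hs, norm_mul, norm_pow, norm_mul, Complex.norm_I, mul_one,
    Complex.norm_intCast, sq_abs] at h1
  rw [Real.norm_eq_abs, abs_of_pos (by positivity), mul_one_div, le_div_iff₀ hk']
  linarith

/-- The Fourier series of a smooth periodic function converges uniformly. -/
lemma tendstoUniformly_fourierSeries {h : ℝ → ℂ} (hh : Function.Periodic h (2 * Real.pi))
    (hs : ContDiff ℝ ∞ h) : TendstoUniformly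
      (fun (s : Finset ℤ) x => ∑ k ∈ s, circleCoeff k h * expChar k x) h atTop := by
  have : Fact (0 < 2 * Real.pi) := ⟨Real.two_pi_pos⟩
  let H : C(AddCircle (2 * Real.pi), ℂ) := ⟨hh.lift, hs.continuous.quotient_liftOn' _⟩
  have hchar : ∀ (k : ℤ) (x : ℝ), fourier (T := 2 * Real.pi) k (x : AddCircle (2 * Real.pi)) =
      expChar k x := by
    intro k x
    have hpi : (Real.pi : ℂ) ≠ 0 := by exact_mod_cast Real.pi_ne_zero
    rw [fourier_coe_apply, expChar]
    congr 1
    push_cast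
    field_simp
  have hcoeff : ∀ k, fourierCoeff H k = circleCoeff k h := by
    intro k
    rw [fourierCoeff_eq_intervalIntegral _ _ 0, circleCoeff, zero_add, Complex.real_smul]
    congr 1
    · push_cast
      rw [one_div]
    · refine intervalIntegral.integral_congr fun x _ => ?_
      simp only [hchar, smul_eq_mul]
      rw [mul_comm]
      rfl
  have hsum : Summable (fourierCoeff H) := by
    rw [funext hcoeff]
    exact summable_circleCoeff hh hs
  have h1 := hasSum_fourier_series_of_summable hsum
  rw [HasSum, SummationFilter.unconditional_filter] at h1
  have h2 := ContinuousMap.tendsto_iff_tendstoUniformly.1 h1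
  have h3 : TendstoUniformly (fun (s : Finset ℤ) (x : ℝ) => (∑ k ∈ s, fourierCoeff H k • fourier k :
      C(AddCircle (2 * Real.pi), ℂ)) (x : AddCircle (2 * Real.pi))) h atTop :=
    h2.comp fun x : ℝ => (x : AddCircle (2 * Real.pi))
  convert h3 using 3 with s x
  simp only [ContinuousMap.coe_sum, Finset.sum_apply, ContinuousMap.coe_smul,
    Pi.smul_apply, smul_eq_mul, hchar, hcoeff]

/-- Splitting the period at π shows that weights of the wrong parity vanish, and expresses the
others by the integral over [0, π] used in `densityIntegral`. -/
lemma circleCoeff_eq_of_antiperiodic {h : ℝ → ℂ} (hc : Continuous h) {m : ℕ}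
    (hpi : ∀ x, h (x + Real.pi) = (-1) ^ m * h x) (k : ℤ) :
    circleCoeff k h = ((2 * Real.pi : ℝ) : ℂ)⁻¹ * ((1 + (-1) ^ m * (-1) ^ k) *
      ∫ x in (0 : ℝ)..Real.pi, h x * expChar (-k) x) := by
  have hg : Continuous fun x => h x * expChar (-k) x := hc.mul (continuous_expChar _)
  rw [circleCoeff, ← intervalIntegral.integral_add_adjacent_intervals (b := Real.pi)
    (hg.intervalIntegrable _ _) (hg.intervalIntegrable _ _), add_mul, one_mul]
  congr 2
  have h1 := intervalIntegral.integral_comp_add_right (a := 0) (b := Real.pi)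
    (fun x => h x * expChar (-k) x) Real.pi
  rw [zero_add, ← two_mul] at h1
  rw [← h1, ← intervalIntegral.integral_const_mul]
  refine intervalIntegral.integral_congr fun x _ => ?_
  simp only [hpi, expChar_add, expChar_pi, zpow_neg]
  rw [← inv_zpow, inv_neg, inv_one]
  ring

lemma circleCoeff_eq_zero_of_parity {h : ℝ → ℂ} (hc : Continuous h) {m : ℕ}
    (hpi : ∀ x, h (x + Real.pi) = (-1) ^ m * h x) {k : ℤ} (hk : Odd (k + m)) :
    circleCoeff k h = 0 := by
  have : (-1 : ℂ) ^ m * (-1) ^ k = -1 := by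
    rw [← zpow_natCast, ← zpow_add₀ (by norm_num), add_comm, hk.neg_one_zpow]
  rw [circleCoeff_eq_of_antiperiodic hc hpi, this]
  simp

/-! ### Riemann sums -/

/-- The error depends on g only through a Lipschitz constant, which makes the convergence uniform
over all translates of a fixed function. -/
lemma norm_integral_sub_riemannSum_le {g : ℝ → ℂ} (hg : Continuous g) {M : ℝ}
    (hM : ∀ x y, ‖g x - g y‖ ≤ M * |x - y|) {n : ℕ} (hn : 0 < n) :
    ‖((2 * Real.pi : ℝ) : ℂ)⁻¹ * (∫ x in (0 : ℝ)..2 * Real.pi, g x) -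
      (n : ℂ)⁻¹ * ∑ j ∈ Finset.range n, g (2 * Real.pi * j / n)‖ ≤ M * (2 * Real.pi) / n := by
  have hn' : (0 : ℝ) < n := by exact_mod_cast hn
  set T : ℝ := 2 * Real.pi with hT
  have hTpos : 0 < T := Real.two_pi_pos
  have hM0 : 0 ≤ M := by
    have := (norm_nonneg _).trans (hM 1 0)
    simpa using this
  set b : ℕ → ℝ := fun j => T * j / n with hb
  have hstep : ∀ j, b (j + 1) - b j = T / n := by
    intro j
    simp only [hb]
    push_cast
    field_simp
    ring
  have h1 : ∫ x in (0 : ℝ)..T, g x = ∑ j ∈ Finset.range n, ∫ x in b j..b (j + 1), g x := by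
    rw [intervalIntegral.sum_integral_adjacent_intervals fun j _ => hg.intervalIntegrable _ _]
    congr 1
    · simp [hb]
    · simp only [hb]
      field_simp
  have h2 : ∀ j, ‖(∫ x in b j..b (j + 1), g x) - ((T / n : ℝ) : ℂ) * g (b j)‖ ≤
      M * (T / n) * (T / n) := by
    intro j
    have e : ((T / n : ℝ) : ℂ) * g (b j) = ∫ _x in b j..b (j + 1), g (b j) := by
      rw [intervalIntegral.integral_const, hstep, Complex.real_smul]
    rw [e, ← intervalIntegral.integral_sub (hg.intervalIntegrable _ _)
      (continuous_const.intervalIntegrable _ _)]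
    have hle : b j ≤ b (j + 1) := by
      have := hstep j
      have : 0 < T / n := by positivity
      linarith
    calc _ ≤ M * (T / n) * |b (j + 1) - b j| := by
          refine intervalIntegral.norm_integral_le_of_norm_le_const fun x hx => ?_
          rw [Set.uIoc_of_le hle] at hx
          refine (hM x (b j)).trans ?_
          gcongr
          rw [abs_of_nonneg (by linarith [hx.1]), ← hstep j]
          linarith [hx.2]
      _ = _ := by rw [hstep, abs_of_pos (by positivity)]
  have h3 : (T : ℂ)⁻¹ * (∫ x in (0 : ℝ)..T, g x) - (n : ℂ)⁻¹ * ∑ j ∈ Finset.range n, g (b j) =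
      (T : ℂ)⁻¹ * ∑ j ∈ Finset.range n,
        ((∫ x in b j..b (j + 1), g x) - ((T / n : ℝ) : ℂ) * g (b j)) := by
    have hTc : (T : ℂ) ≠ 0 := by exact_mod_cast hTpos.ne'
    rw [h1, Finset.sum_sub_distrib, mul_sub, ← Finset.mul_sum]
    congr 1
    push_cast
    field_simp
  rw [h3, norm_mul, norm_inv, Complex.norm_real, Real.norm_eq_abs, abs_of_pos hTpos]
  calc T⁻¹ * _ ≤ T⁻¹ * ∑ j ∈ Finset.range n, M * (T / n) * (T / n) := by
        gcongr
        exact (norm_sum_le _ _).trans (Finset.sum_le_sum fun j _ => h2 j)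
    _ = M * T / n := by
        rw [Finset.sum_const, Finset.card_range, nsmul_eq_mul]
        field_simp

/-- Averaging the rotates of h against a character projects onto the corresponding weight. -/
lemma integral_expChar_mul_translate {h : ℝ → ℂ} (hh : Function.Periodic h (2 * Real.pi))
    (k : ℤ) (α : ℝ) :
    ((2 * Real.pi : ℝ) : ℂ)⁻¹ * (∫ x in (0 : ℝ)..2 * Real.pi, expChar (-k) x * h (α + x)) =
      circleCoeff k h * expChar k α := by
  have hper : Function.Periodic (fun x => h x * expChar (-k) x) (2 * Real.pi) := fun x => by
    simp only [hh x, periodic_expChar (-k) x]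
  have h1 := intervalIntegral.integral_comp_add_left (a := 0) (b := 2 * Real.pi)
    (fun x => h x * expChar (-k) x) α
  rw [add_zero, hper.intervalIntegral_add_eq α 0, zero_add] at h1
  rw [circleCoeff, ← h1, mul_assoc, ← intervalIntegral.integral_mul_const]
  congr 2
  funext x
  have : expChar (-k) α * expChar k α = 1 := by
    rw [← expChar_add_int, neg_add_cancel, expChar_zero]
  rw [expChar_add]
  linear_combination -(expChar (-k) x * h (α + x)) * this

/-- A Riemann sum is a finite combination of rotates of h, hence stays in any rotation-invariant
subspace; this keeps the weight projection inside a closed one without vector-valued integrals. The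
shift to n + 1 avoids an empty subdivision. -/
lemma tendstoUniformly_riemannSum {h : ℝ → ℂ} (hh : Function.Periodic h (2 * Real.pi))
    (hs : ContDiff ℝ ∞ h) (k : ℤ) :
    TendstoUniformly (fun (n : ℕ) α => ((n + 1 : ℕ) : ℂ)⁻¹ * ∑ j ∈ Finset.range (n + 1),
      expChar (-k) (2 * Real.pi * j / (n + 1 : ℕ)) * h (α + 2 * Real.pi * j / (n + 1 : ℕ)))
      (fun α => circleCoeff k h * expChar k α) atTop := by
  obtain ⟨A, hA⟩ := exists_bound_of_periodic Real.two_pi_pos hh hs.continuous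
  have hd : Function.Periodic (deriv h) (2 * Real.pi) := by
    simpa using periodic_iteratedDeriv hh 1
  obtain ⟨B, hB⟩ := exists_bound_of_periodic Real.two_pi_pos hd (contDiff_deriv hs).continuous
  set M := |(k : ℝ)| * A + B with hM
  have key : ∀ α x y, ‖expChar (-k) x * h (α + x) - expChar (-k) y * h (α + y)‖ ≤ M * |x - y| := by
    intro α x y
    have hder : ∀ z : ℝ, HasDerivAt (fun z => expChar (-k) z * h (α + z))
        ((-k : ℤ) * Complex.I * expChar (-k) z * h (α + z) + expChar (-k) z * deriv h (α + z)) z := by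
      intro z
      have h2 : HasDerivAt (fun z => h (α + z)) (deriv h (α + z)) z := by
        have h1 := (hs.differentiable (by simp) (α + z)).hasDerivAt
        exact h1.comp_const_add α z
      exact (hasDerivAt_expChar (-k) z).mul h2
    have := Convex.norm_image_sub_le_of_norm_hasDerivWithin_le (s := Set.univ) (C := M)
      (fun z _ => (hder z).hasDerivWithinAt) (fun z _ => ?_) convex_univ (Set.mem_univ y)
      (Set.mem_univ x)
    · simpa using this
    · refine (norm_add_le _ _).trans ?_
      rw [norm_mul, norm_mul, norm_mul, norm_mul, norm_expChar, Complex.norm_I, one_mul, mul_one,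
        mul_one, Complex.norm_intCast, hM]
      push_cast
      rw [abs_neg]
      gcongr
      · exact hA _
      · exact hB _
  rw [Metric.tendstoUniformly_iff]
  intro δ hδ
  have hlim : Tendsto (fun n : ℕ => M * (2 * Real.pi) / ((n + 1 : ℕ) : ℝ)) atTop (𝓝 0) :=
    (tendsto_const_div_atTop_nhds_zero_nat _).comp (tendsto_add_atTop_nat 1)
  filter_upwards [hlim.eventually (gt_mem_nhds hδ)] with n hn α
  refine lt_of_le_of_lt ?_ hn
  rw [dist_eq_norm, ← integral_expChar_mul_translate hh]
  have := norm_integral_sub_riemannSum_le (g := fun x => expChar (-k) x * h (α + x))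
    ((continuous_expChar _).mul (hs.continuous.comp (continuous_const_add α))) (key α) n.succ_pos
  exact this

end

section

open Filter Topology MeasureTheory

variable {m : ℕ} {ε₁ ε₂ : ℝˣ →* ℤˣ}

/-! ### The weight vectors of the principal series -/

lemma contDiffOn_zpow {E : Type*} [NormedAddCommGroup E] [NormedSpace ℝ E] {u : E → ℂ} {s : Set E}
    (hu : ContDiffOn ℝ ∞ u s) (h0 : ∀ x ∈ s, u x ≠ 0) (a : ℤ) :
    ContDiffOn ℝ ∞ (fun x => u x ^ a) s := by
  cases a with
  | ofNat n => simpa using hu.pow n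
  | negSucc n =>
    simp only [zpow_negSucc]
    exact (hu.pow (n + 1)).inv fun x hx => pow_ne_zero _ (h0 x hx)

lemma sub_I_mul_ne_zero {v : ℝ × ℝ} (hv : v ≠ 0) : (v.2 : ℂ) - Complex.I * (v.1 : ℂ) ≠ 0 := by
  have := ofReal_add_mul_ne_zero (w := -Complex.I) (by rw [neg_sq, Complex.I_sq])
    (c := v.1) (d := v.2) (by
      by_contra! h
      exact hv (Prod.ext h.1 h.2))
  rwa [neg_mul, ← sub_eq_add_neg] at this

lemma add_I_mul_ne_zero {v : ℝ × ℝ} (hv : v ≠ 0) : (v.2 : ℂ) + Complex.I * (v.1 : ℂ) ≠ 0 :=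
  ofReal_add_mul_ne_zero Complex.I_sq (by
    by_contra! h
    exact hv (Prod.ext h.1 h.2))

lemma isHomogeneousPlane_weight (m : ℕ) (a : ℤ) : IsHomogeneousPlane m fun v : ℝ × ℝ =>
    ((v.2 : ℂ) - Complex.I * (v.1 : ℂ)) ^ a * ((v.2 : ℂ) + Complex.I * (v.1 : ℂ)) ^ (-(m : ℤ) - a)
    where
  contDiffOn := by
    have h1 : ContDiff ℝ ∞ fun v : ℝ × ℝ => (v.1 : ℂ) := Complex.ofRealCLM.contDiff.comp contDiff_fst
    have h2 : ContDiff ℝ ∞ fun v : ℝ × ℝ => (v.2 : ℂ) := Complex.ofRealCLM.contDiff.comp contDiff_snd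
    exact (contDiffOn_zpow (h2.sub (contDiff_const.mul h1)).contDiffOn
      (fun v hv => sub_I_mul_ne_zero hv) a).mul (contDiffOn_zpow
        (h2.add (contDiff_const.mul h1)).contDiffOn (fun v hv => add_I_mul_ne_zero hv) _)
  smul t v ht hv := by
    have ht' : (t : ℂ) ≠ 0 := by exact_mod_cast ht
    simp only [Prod.smul_fst, Prod.smul_snd, smul_eq_mul]
    push_cast
    rw [show (t : ℂ) * v.2 - Complex.I * (t * v.1) = t * (v.2 - Complex.I * v.1) by ring,
      show (t : ℂ) * v.2 + Complex.I * (t * v.1) = t * (v.2 + Complex.I * v.1) by ring,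
      mul_zpow, mul_zpow]
    have e : (t : ℂ) ^ a * (t : ℂ) ^ (-(m : ℤ) - a) = ((t : ℂ) ^ m)⁻¹ := by
      rw [← zpow_add₀ ht', ← zpow_natCast, ← zpow_neg]
      congr 1
      ring
    rw [← e]
    ring

/-- The weight vector of weight `2a + m`. -/
def weightVec (hε : ε₁ (-1) * ε₂ (-1) = (-1) ^ m) (a : ℤ) : PS m ε₁ ε₂ :=
  ofPlane hε _ (isHomogeneousPlane_weight m a)

lemma plane_weightVec (hε : ε₁ (-1) * ε₂ (-1) = (-1) ^ m) (a : ℤ) {v : ℝ × ℝ} (hv : v ≠ 0) :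
    plane (weightVec hε a : PS m ε₁ ε₂) v = ((v.2 : ℂ) - Complex.I * (v.1 : ℂ)) ^ a *
      ((v.2 : ℂ) + Complex.I * (v.1 : ℂ)) ^ (-(m : ℤ) - a) :=
  plane_ofPlane hε (isHomogeneousPlane_weight m a) hv

lemma expChar_one_eq (α : ℝ) :
    expChar 1 α = (Real.cos α : ℂ) - Complex.I * ((-Real.sin α : ℝ) : ℂ) := by
  rw [expChar, Int.cast_one, one_mul, Complex.exp_mul_I]
  push_cast
  ring

lemma expChar_neg_one_eq (α : ℝ) :
    expChar (-1) α = (Real.cos α : ℂ) + Complex.I * ((-Real.sin α : ℝ) : ℂ) := by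
  rw [expChar, Int.cast_neg, Int.cast_one, neg_mul, one_mul, Complex.exp_mul_I, Complex.cos_neg,
    Complex.sin_neg]
  push_cast
  ring

lemma expChar_zpow (k n : ℤ) (α : ℝ) : expChar k α ^ n = expChar (n * k) α := by
  rw [expChar, expChar, ← Complex.exp_int_mul]
  push_cast
  ring_nf

lemma circle_weightVec (hε : ε₁ (-1) * ε₂ (-1) = (-1) ^ m) (a : ℤ) :
    circle (weightVec hε a : PS m ε₁ ε₂) = expChar (2 * a + m) := by
  funext α
  rw [circle_eq_plane, plane_weightVec hε a (sin_cos_ne_zero α), ← expChar_one_eq,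
    ← expChar_neg_one_eq, expChar_zpow, expChar_zpow, ← expChar_add_int]
  congr 1
  ring

lemma rot_mul_rot (α β : ℝ) : rot α * rot β = rot (α + β) := by
  ext i j
  fin_cases i <;> fin_cases j <;>
    simp [rot, Matrix.GeneralLinearGroup.mkOfDetNeZero, Matrix.mul_apply, Fin.sum_univ_two,
      Real.cos_add, Real.sin_add] <;> ring

lemma circle_rot (β : ℝ) (f : PS m ε₁ ε₂) :
    circle (psAction m ε₁ ε₂ (rot β) f) = fun α => circle f (α + β) :=
  funext fun α => congrArg f.toFun (rot_mul_rot α β)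

lemma iteratedDeriv_circle_rot (β : ℝ) (f : PS m ε₁ ε₂) (n : ℕ) (α : ℝ) :
    iteratedDeriv n (circle (psAction m ε₁ ε₂ (rot β) f)) α =
      iteratedDeriv n (circle f) (α + β) := by
  rw [circle_rot]
  exact congrFun (iteratedDeriv_comp_add_const n (circle f) β) α

lemma iteratedDeriv_circle_sum {ι : Type*} (s : Finset ι) (c : ι → ℂ) (u : ι → PS m ε₁ ε₂) (n : ℕ)
    (α : ℝ) : iteratedDeriv n (circle (∑ i ∈ s, c i • u i)) α =
      ∑ i ∈ s, c i * iteratedDeriv n (circle (u i)) α := by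
  classical
  induction s using Finset.induction_on with
  | empty =>
    have := iteratedDeriv_circle_smul 0 (0 : PS m ε₁ ε₂) n α
    rw [zero_smul, zero_mul] at this
    simpa using this
  | insert i s hi ih =>
    rw [Finset.sum_insert hi, Finset.sum_insert hi, iteratedDeriv_circle_add,
      iteratedDeriv_circle_smul, ih]

lemma contDiff_iteratedDeriv_circle (f : PS m ε₁ ε₂) (n : ℕ) :
    ContDiff ℝ ∞ (iteratedDeriv n (circle f)) := by
  induction n with
  | zero => simpa using contDiff_circle f
  | succ n ih =>
    rw [iteratedDeriv_succ]
    exact contDiff_deriv ih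

/-- A closed invariant subspace contains the weight components of its elements. -/
lemma circleCoeff_smul_weightVec_mem (hε : ε₁ (-1) * ε₂ (-1) = (-1) ^ m)
    {U : Subrepresentation (psAction m ε₁ ε₂)} (hU : IsClosed (U : Set (PS m ε₁ ε₂)))
    {f : PS m ε₁ ε₂} (hf : f ∈ U.toSubmodule) (a : ℤ) :
    circleCoeff (2 * a + m) (circle f) • weightVec hε a ∈ U.toSubmodule := by
  set k : ℤ := 2 * a + m with hk
  let u : ℕ → PS m ε₁ ε₂ := fun n => ∑ j ∈ Finset.range (n + 1),
    (((n + 1 : ℕ) : ℂ)⁻¹ * expChar (-k) (2 * Real.pi * j / (n + 1 : ℕ))) •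
      psAction m ε₁ ε₂ (rot (2 * Real.pi * j / (n + 1 : ℕ))) f
  have hu : ∀ n, u n ∈ (U : Set (PS m ε₁ ε₂)) := fun n =>
    Submodule.sum_mem U.toSubmodule fun j _ => Submodule.smul_mem _ _
      (U.apply_mem_toSubmodule _ hf)
  refine hU.mem_of_tendsto (f := u) (b := atTop) (tendsto_iff_circle.2 fun p => ?_)
    (Eventually.of_forall hu)
  have h1 := tendstoUniformly_riemannSum (periodic_iteratedDeriv (circle_periodic f) p)
    (contDiff_iteratedDeriv_circle f p) k
  convert h1 using 1
  · funext n α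
    simp only [u]
    rw [iteratedDeriv_circle_sum, Finset.mul_sum]
    refine Finset.sum_congr rfl fun j _ => ?_
    rw [iteratedDeriv_circle_rot, mul_assoc]
  · funext α
    rw [iteratedDeriv_circle_smul, circle_weightVec, iteratedDeriv_expChar,
      circleCoeff_iteratedDeriv (circle_periodic f) (contDiff_circle f)]
    ring

/-- Every element of the principal series is the sum of its weight components. -/
lemma tendsto_sum_weightVec (hε : ε₁ (-1) * ε₂ (-1) = (-1) ^ m) (f : PS m ε₁ ε₂) :
    Tendsto (fun s : Finset ℤ => ∑ a ∈ s, circleCoeff (2 * a + m) (circle f) • weightVec hε a)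
      atTop (𝓝 f) := by
  refine tendsto_iff_circle.2 fun p => ?_
  have h1 := tendstoUniformly_fourierSeries (periodic_iteratedDeriv (circle_periodic f) p)
    (contDiff_iteratedDeriv_circle f p)
  have hinj : Function.Injective fun a : ℤ => 2 * a + (m : ℤ) := fun a b h => by
    simp only at h
    omega
  rw [Metric.tendstoUniformly_iff] at h1 ⊢
  intro δ hδ
  obtain ⟨s₀, hs₀⟩ := eventually_atTop.1 (h1 δ hδ)
  refine eventually_atTop.2 ⟨s₀.preimage _ hinj.injOn, fun s hs α => ?_⟩
  -- Frequencies of `s₀` not of the form 2a + m have the wrong parity and coefficient 0, so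
  -- including them changes nothing.
  have h2 := hs₀ (s₀ ∪ s.map ⟨_, hinj⟩) Finset.subset_union_left α
  convert h2 using 2
  rw [iteratedDeriv_circle_sum]
  have h3 : ∑ k ∈ s.map ⟨_, hinj⟩, circleCoeff k (iteratedDeriv p (circle f)) * expChar k α =
      ∑ k ∈ s₀ ∪ s.map ⟨_, hinj⟩, circleCoeff k (iteratedDeriv p (circle f)) * expChar k α := by
    refine Finset.sum_subset Finset.subset_union_right fun k hk hk' => ?_
    have hk0 : k ∈ s₀ := (Finset.mem_union.1 hk).resolve_right hk'
    rw [circleCoeff_iteratedDeriv (circle_periodic f) (contDiff_circle f)]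
    rcases Int.even_or_odd (k + m) with he | ho
    · exfalso
      obtain ⟨j, hj⟩ := he
      have hj' : 2 * (j - m) + (m : ℤ) = k := by omega
      refine hk' (Finset.mem_map.2 ⟨j - m, hs (Finset.mem_preimage.2 ?_), hj'⟩)
      rwa [hj']
    · rw [circleCoeff_eq_zero_of_parity (contDiff_circle f).continuous (circle_add_pi hε f) ho]
      ring
  rw [← h3, Finset.sum_map]
  refine Finset.sum_congr rfl fun a _ => ?_
  rw [circle_weightVec, iteratedDeriv_expChar]
  simp only [Function.Embedding.coeFn_mk]
  rw [circleCoeff_iteratedDeriv (circle_periodic f) (contDiff_circle f)]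
  ring

lemma exists_circleCoeff_ne_zero (hε : ε₁ (-1) * ε₂ (-1) = (-1) ^ m) {f : PS m ε₁ ε₂}
    (hf : f ≠ 0) : ∃ a : ℤ, circleCoeff (2 * a + m) (circle f) ≠ 0 := by
  by_contra! h
  refine hf (circle_ext hε (funext fun α => ?_))
  have h1 := ((continuous_circle_apply (m := m) (ε₁ := ε₁) (ε₂ := ε₂) α).tendsto f).comp
    (tendsto_sum_weightVec hε f)
  simp only [Function.comp_def, h, zero_smul, Finset.sum_const_zero] at h1
  exact tendsto_nhds_unique h1 tendsto_const_nhds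

/-! ### Weight shifting -/

/-- For k ≠ l, computing the coefficient of the derivative in two ways shows that l - k annihilates
it. -/
lemma circleCoeff_expChar (k l : ℤ) : circleCoeff k (expChar l) = if k = l then 1 else 0 := by
  split_ifs with h
  · subst h
    have h1 : ∀ x, expChar k x * expChar (-k) x = 1 := fun x => by
      rw [← expChar_add_int, add_neg_cancel, expChar_zero]
    have h2 : ((2 * Real.pi : ℝ) : ℂ) ≠ 0 := by exact_mod_cast Real.two_pi_pos.ne'
    simp only [circleCoeff, h1]
    rw [intervalIntegral.integral_const, sub_zero, Complex.real_smul, mul_one, inv_mul_cancel₀ h2]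
  · have h1 := circleCoeff_deriv (periodic_expChar l) (contDiff_expChar l) k
    have h2 : deriv (expChar l) = fun x => (l * Complex.I) * expChar l x :=
      funext fun x => (hasDerivAt_expChar l x).deriv
    have h3 : circleCoeff k (fun x => (l * Complex.I) * expChar l x) =
        l * Complex.I * circleCoeff k (expChar l) := by
      simp only [circleCoeff, mul_assoc]
      rw [intervalIntegral.integral_const_mul, intervalIntegral.integral_const_mul]
      ring
    rw [h2, h3] at h1
    have h4 : ((l : ℂ) - k) ≠ 0 := sub_ne_zero.2 (by exact_mod_cast Ne.symm h)
    have h5 : ((l : ℂ) - k) * (Complex.I * circleCoeff k (expChar l)) = 0 := by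
      linear_combination h1
    rcases mul_eq_zero.1 h5 with h6 | h6
    · exact absurd h6 h4
    · exact (mul_eq_zero.1 h6).resolve_left Complex.I_ne_zero

lemma circleCoeff_add {h h' : ℝ → ℂ} (hc : Continuous h) (hc' : Continuous h') (k : ℤ) :
    circleCoeff k (fun x => h x + h' x) = circleCoeff k h + circleCoeff k h' := by
  have hi : ∀ {h : ℝ → ℂ}, Continuous h → IntervalIntegrable (fun x => h x * expChar (-k) x) volume
      0 (2 * Real.pi) := fun hc => (hc.mul (continuous_expChar _)).intervalIntegrable _ _
  rw [circleCoeff, circleCoeff, circleCoeff, ← mul_add,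
    ← intervalIntegral.integral_add (hi hc) (hi hc')]
  simp only [add_mul]

lemma circleCoeff_const_mul (c : ℂ) (h : ℝ → ℂ) (k : ℤ) :
    circleCoeff k (fun x => c * h x) = c * circleCoeff k h := by
  simp only [circleCoeff, mul_assoc]
  rw [intervalIntegral.integral_const_mul]
  ring

/-- The coefficients of the infinitesimal unipotent translate of a weight vector. -/
lemma exists_unipotent_circleCoeff_ne_zero (hε : ε₁ (-1) * ε₂ (-1) = (-1) ^ m) (a : ℤ) {k : ℤ}
    (hk : (k = 2 * (a + 1) + m ∧ a ≠ -m) ∨ (k = 2 * (a - 1) + m ∧ a ≠ 0)) :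
    ∃ x : ℝ, circleCoeff k (circle (psAction m ε₁ ε₂ (borelElt 1 1 x) (weightVec hε a))) ≠ 0 := by
  -- If the coefficient vanished for all x, so would its derivative at x = 0, which is the Lie
  -- algebra action and is computed explicitly below.
  by_contra! hzero
  set b : ℤ := -(m : ℤ) - a with hb
  set Z : ℝ → ℝ → ℂ := fun x α =>
    ((Real.cos α - x * Real.sin α : ℝ) : ℂ) - Complex.I * ((-Real.sin α : ℝ) : ℂ) with hZ
  set W : ℝ → ℝ → ℂ := fun x α =>
    ((Real.cos α - x * Real.sin α : ℝ) : ℂ) + Complex.I * ((-Real.sin α : ℝ) : ℂ) with hW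
  have hne : ∀ x α : ℝ, ((-Real.sin α, Real.cos α - x * Real.sin α) : ℝ × ℝ) ≠ 0 := by
    intro x α h
    have h1 : -Real.sin α = 0 := congrArg Prod.fst h
    have h2 : Real.cos α - x * Real.sin α = 0 := congrArg Prod.snd h
    refine sin_cos_ne_zero α (Prod.ext h1 ?_)
    simp only [Prod.snd_zero]
    linear_combination h2 - x * h1
  have hZ0 : ∀ x α, Z x α ≠ 0 := fun x α => sub_I_mul_ne_zero (hne x α)
  have hW0 : ∀ x α, W x α ≠ 0 := fun x α => add_I_mul_ne_zero (hne x α)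
  have hcirc : ∀ x α, circle (psAction m ε₁ ε₂ (borelElt 1 1 x) (weightVec hε a)) α =
      Z x α ^ a * W x α ^ b := by
    intro x α
    have hdet : ((borelElt 1 1 x).det : ℝ) = 1 := by
      rw [Matrix.GeneralLinearGroup.val_det_apply, coe_borelElt, Matrix.det_fin_two]
      simp
    have hrow : rowMul (-Real.sin α, Real.cos α) (borelElt 1 1 x) =
        (-Real.sin α, Real.cos α - x * Real.sin α) := by
      ext <;> simp [rowMul, coe_borelElt]
      ring
    rw [circle_eq_plane, plane_psAction _ _ (sin_cos_ne_zero α), hdet, detChar_one, one_mul, hrow,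
      plane_weightVec hε a (hne x α)]
  set F : ℝ → ℝ → ℂ := fun x α => Z x α ^ a * W x α ^ b * expChar (-k) α with hF
  set F' : ℝ → ℝ → ℂ := fun x α => -(Real.sin α : ℂ) *
    (a * Z x α ^ (a - 1) * W x α ^ b + Z x α ^ a * (b * W x α ^ (b - 1))) * expChar (-k) α with hF'
  have hcZ : Continuous fun p : ℝ × ℝ => Z p.1 p.2 := by
    simp only [hZ]
    fun_prop
  have hcW : Continuous fun p : ℝ × ℝ => W p.1 p.2 := by
    simp only [hW]
    fun_prop
  have hzp : ∀ n : ℤ, Continuous fun p : ℝ × ℝ => Z p.1 p.2 ^ n := fun n =>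
    hcZ.zpow₀ n fun p => Or.inl (hZ0 _ _)
  have hwp : ∀ n : ℤ, Continuous fun p : ℝ × ℝ => W p.1 p.2 ^ n := fun n =>
    hcW.zpow₀ n fun p => Or.inl (hW0 _ _)
  have hec : Continuous fun p : ℝ × ℝ => expChar (-k) p.2 := (continuous_expChar _).comp continuous_snd
  have hFc : Continuous fun p : ℝ × ℝ => F p.1 p.2 := ((hzp a).mul (hwp b)).mul hec
  have hF'c : Continuous fun p : ℝ × ℝ => F' p.1 p.2 := by
    refine Continuous.mul (Continuous.mul (by fun_prop) (Continuous.add ?_ ?_)) hec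
    · exact (continuous_const.mul (hzp _)).mul (hwp _)
    · exact (hzp _).mul (continuous_const.mul (hwp _))
  have hsec : ∀ {G : ℝ → ℝ → ℂ}, (Continuous fun p : ℝ × ℝ => G p.1 p.2) → ∀ x, Continuous (G x) :=
    fun hG x => hG.comp (Continuous.prodMk_right x)
  have hder : ∀ x α, HasDerivAt (fun x => F x α) (F' x α) x := by
    intro x α
    have h0 : HasDerivAt (fun x : ℝ => ((Real.cos α - x * Real.sin α : ℝ) : ℂ))
        (-(Real.sin α : ℂ)) x := by
      have := ((hasDerivAt_mul_const (Real.sin α) (x := x)).const_sub (Real.cos α)).ofReal_comp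
      simpa using this
    have h1 : HasDerivAt (fun x => Z x α ^ a) (a * Z x α ^ (a - 1) * -(Real.sin α : ℂ)) x := by
      have hZd : HasDerivAt (fun x => Z x α) (-(Real.sin α : ℂ)) x := h0.sub_const _
      exact HasDerivAt.comp x (hasDerivAt_zpow a (Z x α) (Or.inl (hZ0 x α))) hZd
    have h2 : HasDerivAt (fun x => W x α ^ b) (b * W x α ^ (b - 1) * -(Real.sin α : ℂ)) x := by
      have hWd : HasDerivAt (fun x => W x α) (-(Real.sin α : ℂ)) x := h0.add_const _
      exact HasDerivAt.comp x (hasDerivAt_zpow b (W x α) (Or.inl (hW0 x α))) hWd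
    refine ((h1.mul h2).mul_const (expChar (-k) α)).congr_deriv ?_
    simp only [hF']
    ring
  obtain ⟨C, hC⟩ := ((isCompact_Icc (a := (-1 : ℝ)) (b := 1)).prod
    (isCompact_Icc (a := (0 : ℝ)) (b := 2 * Real.pi))).exists_bound_of_continuousOn
      hF'c.continuousOn
  -- Differentiation under the integral sign at x = 0, with a constant bound from compactness of
  -- [-1, 1] × [0, 2π].
  have hmain := (intervalIntegral.hasDerivAt_integral_of_dominated_loc_of_deriv_le
    (μ := volume) (F := F) (F' := F') (x₀ := 0) (a := 0) (b := 2 * Real.pi) (bound := fun _ => C)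
    (Icc_mem_nhds (show (-1 : ℝ) < 0 by norm_num) one_pos)
    (Eventually.of_forall fun x => (hsec hFc x).aestronglyMeasurable)
    ((hsec hFc 0).intervalIntegrable _ _) (hsec hF'c 0).aestronglyMeasurable
    (Eventually.of_forall fun α hα x hx => hC (x, α) ⟨hx, by
      rw [Set.uIoc_of_le Real.two_pi_pos.le] at hα
      exact ⟨hα.1.le, hα.2⟩⟩)
    (continuous_const.intervalIntegrable _ _)
    (Eventually.of_forall fun α _ x _ => hder x α)).2
  have hpi : ((2 * Real.pi : ℝ) : ℂ)⁻¹ ≠ 0 := inv_ne_zero (by exact_mod_cast Real.two_pi_pos.ne')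
  have hF0 : (fun x => ∫ α in (0 : ℝ)..2 * Real.pi, F x α) = fun _ => 0 := by
    funext x
    have h1 := hzero x
    rw [circleCoeff] at h1
    simp only [hcirc] at h1
    exact (mul_eq_zero.1 h1).resolve_left hpi
  rw [hF0] at hmain
  have h0 := hmain.unique (hasDerivAt_const _ _)
  set l : ℤ := 2 * a + m with hl
  -- The infinitesimal translate has weights l and l ± 2, where l = 2a + m. The coefficient at l + 2
  -- is ib/2 with b = -m - a, and at l - 2 it is -ia/2; they vanish exactly for a = -m and for a =
  -- 0.
  have hexp : ∀ α, F' 0 α = ((Complex.I / 2 * (a - b)) * expChar l α +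
      ((Complex.I / 2 * b) * expChar (l + 2) α + (-(Complex.I / 2 * a)) * expChar (l - 2) α)) *
        expChar (-k) α := by
    intro α
    have hz : Z 0 α = expChar 1 α := by simp only [hZ, expChar_one_eq, zero_mul, sub_zero]
    have hw : W 0 α = expChar (-1) α := by simp only [hW, expChar_neg_one_eq, zero_mul, sub_zero]
    have hs : -(Real.sin α : ℂ) = Complex.I / 2 * (expChar 1 α - expChar (-1) α) := by
      rw [expChar_one_eq, expChar_neg_one_eq]
      push_cast
      linear_combination -(Complex.sin α) * Complex.I_sq
    have e1 : expChar (a - 1) α * expChar (-b) α = expChar (l - 1) α := by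
      rw [← expChar_add_int]
      congr 1
      omega
    have e2 : expChar a α * expChar (-(b - 1)) α = expChar (l + 1) α := by
      rw [← expChar_add_int]
      congr 1
      omega
    have e3 : expChar 1 α * expChar (l - 1) α = expChar l α := by
      rw [← expChar_add_int]
      congr 1
      ring
    have e4 : expChar 1 α * expChar (l + 1) α = expChar (l + 2) α := by
      rw [← expChar_add_int]
      congr 1
      ring
    have e5 : expChar (-1) α * expChar (l - 1) α = expChar (l - 2) α := by
      rw [← expChar_add_int]
      congr 1
      ring
    have e6 : expChar (-1) α * expChar (l + 1) α = expChar l α := by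
      rw [← expChar_add_int]
      congr 1
      ring
    simp only [hF', hz, hw, expChar_zpow, mul_one, mul_neg_one]
    rw [hs, ← e4, ← e5]
    linear_combination Complex.I / 2 * expChar (-k) α * ((expChar 1 α - expChar (-1) α) *
      (a * e1 + b * e2) + a * e3 - b * e6)
  have hcoef := congrArg (fun z => ((2 * Real.pi : ℝ) : ℂ)⁻¹ * z) h0
  simp only [hexp, mul_zero] at hcoef
  change circleCoeff k (fun α => (Complex.I / 2 * (a - b)) * expChar l α +
      ((Complex.I / 2 * b) * expChar (l + 2) α + (-(Complex.I / 2 * a)) * expChar (l - 2) α)) = 0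
    at hcoef
  have hce := continuous_expChar
  rw [circleCoeff_add (by fun_prop) (by fun_prop), circleCoeff_add (by fun_prop) (by fun_prop),
    circleCoeff_const_mul, circleCoeff_const_mul, circleCoeff_const_mul, circleCoeff_expChar,
    circleCoeff_expChar, circleCoeff_expChar] at hcoef
  rcases hk with ⟨hk, ha⟩ | ⟨hk, ha⟩
  · rw [if_neg (by omega), if_pos (by omega), if_neg (by omega)] at hcoef
    have hb0 : (b : ℂ) = 0 := by simpa using hcoef
    have : b = 0 := by exact_mod_cast hb0
    omega
  · rw [if_neg (by omega), if_neg (by omega), if_pos (by omega)] at hcoef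
    have ha0 : (a : ℂ) = 0 := by simpa using hcoef
    exact ha (by exact_mod_cast ha0)

/-! ### Closed invariant subspaces: irreducibility and uniqueness of `delta`. -/

section Invariant

variable {U : Subrepresentation (psAction m ε₁ ε₂)}

lemma weightVec_mem_of_circleCoeff_ne_zero (hε : ε₁ (-1) * ε₂ (-1) = (-1) ^ m)
    (hU : IsClosed (U : Set (PS m ε₁ ε₂))) {f : PS m ε₁ ε₂} (hf : f ∈ U.toSubmodule) {a : ℤ}
    (ha : circleCoeff (2 * a + m) (circle f) ≠ 0) : weightVec hε a ∈ U.toSubmodule :=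
  (Submodule.smul_mem_iff _ ha).1 (circleCoeff_smul_weightVec_mem hε hU hf a)

lemma weightVec_succ_mem (hε : ε₁ (-1) * ε₂ (-1) = (-1) ^ m)
    (hU : IsClosed (U : Set (PS m ε₁ ε₂))) {a : ℤ} (ha : a ≠ -m)
    (h : weightVec hε a ∈ U.toSubmodule) : weightVec hε (a + 1) ∈ U.toSubmodule := by
  obtain ⟨x, hx⟩ := exists_unipotent_circleCoeff_ne_zero hε a (Or.inl ⟨rfl, ha⟩)
  exact weightVec_mem_of_circleCoeff_ne_zero hε hU (U.apply_mem_toSubmodule _ h) hx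

lemma weightVec_pred_mem (hε : ε₁ (-1) * ε₂ (-1) = (-1) ^ m)
    (hU : IsClosed (U : Set (PS m ε₁ ε₂))) {a : ℤ} (ha : a ≠ 0)
    (h : weightVec hε a ∈ U.toSubmodule) : weightVec hε (a - 1) ∈ U.toSubmodule := by
  obtain ⟨x, hx⟩ := exists_unipotent_circleCoeff_ne_zero hε a (Or.inr ⟨rfl, ha⟩)
  exact weightVec_mem_of_circleCoeff_ne_zero hε hU (U.apply_mem_toSubmodule _ h) hx

/-- The element diag(-1, 1) sends c to -c, so it exchanges d - ic with d + ic and thereby the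
exponents a and -m - a. -/
lemma weightVec_flip_mem (hε : ε₁ (-1) * ε₂ (-1) = (-1) ^ m) {a : ℤ}
    (h : weightVec hε a ∈ U.toSubmodule) : weightVec hε (-(m : ℤ) - a) ∈ U.toSubmodule := by
  have hd : detChar m ε₁ ((-1 : ℝˣ) : ℝ) ≠ 0 := detChar_ne_zero m ε₁ (Units.ne_zero _)
  refine (Submodule.smul_mem_iff _ hd).1 ?_
  convert U.apply_mem_toSubmodule (embGL1 (-1)) h using 1
  refine plane_ext fun v hv => ?_
  have hv' : (((-1 : ℝˣ) : ℝ) * v.1, v.2) ≠ (0 : ℝ × ℝ) := fun h0 => hv (Prod.ext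
    (by simpa using congrArg Prod.fst h0) (by simpa using congrArg Prod.snd h0))
  rw [plane_smul, plane_embGL1 _ _ hv, plane_weightVec hε _ hv, plane_weightVec hε _ hv',
    sub_sub_cancel]
  push_cast
  rw [mul_comm (_ ^ a)]
  simp [sub_eq_add_neg]

/-- A nonzero closed invariant subspace contains all weight vectors of weight at least `m` in
absolute value. -/
lemma weightVec_mem (hm : 1 ≤ m) (hε : ε₁ (-1) * ε₂ (-1) = (-1) ^ m)
    (hU : IsClosed (U : Set (PS m ε₁ ε₂))) (hne : U ≠ ⊥) {a : ℤ} (ha : 0 ≤ a ∨ a ≤ -m) :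
    weightVec hε a ∈ U.toSubmodule := by
  have hex : ∃ f ∈ U.toSubmodule, f ≠ 0 := by
    refine U.toSubmodule.exists_mem_ne_zero_of_ne_bot fun h => hne ?_
    exact Subrepresentation.toSubmodule_injective h
  obtain ⟨f, hf, hf0⟩ := hex
  obtain ⟨a₀, ha₀⟩ := exists_circleCoeff_ne_zero hε hf0
  have h₀ := weightVec_mem_of_circleCoeff_ne_zero hε hU hf ha₀
  -- After a possible flip a₁ ≥ -m/2 > -m, so raising never meets the obstruction at -m, and
  -- lowering towards a nonnegative target stops no later than the obstruction at 0.
  obtain ⟨a₁, ha₁, h₁⟩ : ∃ a₁ : ℤ, -(m : ℤ) ≤ 2 * a₁ ∧ weightVec hε a₁ ∈ U.toSubmodule := by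
    rcases le_or_gt (-(m : ℤ)) (2 * a₀) with h | h
    · exact ⟨a₀, h, h₀⟩
    · exact ⟨-(m : ℤ) - a₀, by omega, weightVec_flip_mem hε h₀⟩
  have hup : ∀ c : ℤ, a₁ ≤ c → weightVec hε c ∈ U.toSubmodule := by
    intro c hc
    induction c, hc using Int.leInduction with
    | base => exact h₁
    | succ c hc ih => exact weightVec_succ_mem hε hU (by omega) ih
  have hpos : ∀ c : ℤ, 0 ≤ c → weightVec hε c ∈ U.toSubmodule := by
    intro c hc
    rcases le_or_gt a₁ c with h | h
    · exact hup c h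
    · have hdown : ∀ c : ℤ, c ≤ a₁ → 0 ≤ c → weightVec hε c ∈ U.toSubmodule := by
        intro c hc
        induction c, hc using Int.leInductionDown with
        | base => exact fun _ => h₁
        | pred c hc ih => exact fun h0 => weightVec_pred_mem hε hU (by omega) (ih (by omega))
      exact hdown c h.le hc
  rcases ha with ha | ha
  · exact hpos a ha
  · have := weightVec_flip_mem hε (hpos (-(m : ℤ) - a) (by omega))
    rwa [sub_sub_cancel] at this

/-- For -m < a < 0 the function e^{-i(2a+m)α} is the restriction to the circle of (d - ic)^p (d +
ic)^q with p = -1 - a and q = m - 1 + a. This form has degree m - 2, so it annihilates `delta`. -/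
lemma circleCoeff_eq_zero_of_mem_delta (hε : ε₁ (-1) * ε₂ (-1) = (-1) ^ m) {f : PS m ε₁ ε₂}
    (hf : f ∈ (delta hε).toSubmodule) {a : ℤ} (ha : a < 0) (ha' : -(m : ℤ) < a) :
    circleCoeff (2 * a + m) (circle f) = 0 := by
  obtain ⟨p, hp⟩ : ∃ p : ℕ, (p : ℤ) = -1 - a := ⟨(-1 - a).toNat, by omega⟩
  obtain ⟨q, hq⟩ : ∃ q : ℕ, (q : ℤ) = m - 1 + a := ⟨(m - 1 + a).toNat, by omega⟩
  have h1 := (mem_delta hε).1 hf (p + q) (by omega)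
    (fun i => if (i : ℕ) < p then -Complex.I else Complex.I) fun _ => 1
  rw [circleCoeff_eq_of_antiperiodic (contDiff_circle f).continuous (circle_add_pi hε f)]
  have h2 : ∀ α : ℝ, linearFormProd (n := p + q)
      (fun i => if (i : ℕ) < p then -Complex.I else Complex.I) (fun _ => 1)
      (-Real.sin α, Real.cos α) = expChar (-(2 * a + m)) α := by
    intro α
    have e : ∀ i : Fin (p + q), (if (i : ℕ) < p then -Complex.I else Complex.I) *
        ((-Real.sin α : ℝ) : ℂ) + 1 * ((Real.cos α : ℝ) : ℂ) =
        (fun i : ℕ => if i < p then expChar 1 α else expChar (-1) α) i := by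
      intro i
      simp only
      split_ifs
      · rw [expChar_one_eq]
        ring
      · rw [expChar_neg_one_eq]
        ring
    simp only [linearFormProd]
    rw [Finset.prod_congr rfl fun i _ => e i, Fin.prod_univ_eq_prod_range
      (fun i : ℕ => if i < p then expChar 1 α else expChar (-1) α) (p + q), Finset.prod_range_add,
      Finset.prod_congr rfl (g := fun _ => expChar 1 α)
        (fun i hi => if_pos (Finset.mem_range.1 hi)),
      Finset.prod_congr rfl (g := fun _ => expChar (-1) α)
        (fun i _ => if_neg (by omega)), Finset.prod_const, Finset.prod_const, Finset.card_range,
      Finset.card_range, ← zpow_natCast, ← zpow_natCast, expChar_zpow, expChar_zpow,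
      ← expChar_add_int]
    congr 1
    omega
  rw [densityIntegral] at h1
  simp only [h2, ← circle_eq_plane] at h1
  rw [h1, mul_zero, mul_zero]

/-- Elements of `delta` are limits of sums of weight vectors with a ≥ 0 or a ≤ -m, all of which lie
in U. -/
lemma delta_le (hm : 1 ≤ m) (hε : ε₁ (-1) * ε₂ (-1) = (-1) ^ m)
    (hU : IsClosed (U : Set (PS m ε₁ ε₂))) (hne : U ≠ ⊥) : delta hε ≤ U := by
  intro f hf
  refine hU.mem_of_tendsto (tendsto_sum_weightVec hε f) (Eventually.of_forall fun s => ?_)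
  refine Submodule.sum_mem U.toSubmodule fun a _ => ?_
  by_cases ha : 0 ≤ a ∨ a ≤ -m
  · exact Submodule.smul_mem _ _ (weightVec_mem hm hε hU hne ha)
  · push Not at ha
    rw [circleCoeff_eq_zero_of_mem_delta hε hf ha.1 ha.2, zero_smul]
    exact Submodule.zero_mem _

end Invariant

lemma delta_ne_bot (hε : ε₁ (-1) * ε₂ (-1) = (-1) ^ m) :
    (delta hε : Subrepresentation (psAction m ε₁ ε₂)) ≠ ⊥ := by
  intro h
  have h1 : (kernelElt hε Complex.I_sq 0 : PS m ε₁ ε₂) ∈ (delta hε).toSubmodule :=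
    kernelElt_mem_delta hε Complex.I_sq 0
  rw [h] at h1
  have h2 : (kernelElt hε Complex.I_sq 0 : PS m ε₁ ε₂) = 0 := (Submodule.mem_bot ℂ).1 h1
  have h3 := (inftyDeriv_kernelElt (ε₁ := ε₁) (ε₂ := ε₂) hε Complex.I_sq 0).2
  rw [h2, map_zero] at h3
  simp at h3

lemma isIrreducibleSub_delta (hm : 1 ≤ m) (hε : ε₁ (-1) * ε₂ (-1) = (-1) ^ m) :
    IsIrreducibleSub (delta hε : Subrepresentation (psAction m ε₁ ε₂)) where
  isClosed := isClosed_delta hε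
  ne_bot := delta_ne_bot hε
  eq_bot_or_eq U hU hle := by
    by_cases h : U = ⊥
    · exact Or.inl h
    · exact Or.inr (le_antisymm hle (delta_le hm hε hU h))

lemma eq_delta_of_isIrreducibleSub (hm : 1 ≤ m) (hε : ε₁ (-1) * ε₂ (-1) = (-1) ^ m)
    {V : Subrepresentation (psAction m ε₁ ε₂)} (hV : IsIrreducibleSub V) : V = delta hε :=
  ((hV.eq_bot_or_eq (delta hε) (isClosed_delta hε)
    (delta_le hm hε hV.isClosed hV.ne_bot)).resolve_left (delta_ne_bot hε)).symm

end

section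

open Filter Topology MeasureTheory

variable {m : ℕ} {ε₁ ε₂ : ℝˣ →* ℤˣ}

/-! ### The restriction of `δ(m)` to `GL₁(ℝ)` -/

lemma stepChar_two_mul (m l : ℕ) : stepChar m (2 * l) = fun t => absPow ((m : ℂ) / 2 + l) t := by
  funext t
  rw [stepChar, pow_mul, sq, sgn_mul_self, one_pow, one_mul, show 2 * l / 2 = l by omega]

lemma stepChar_two_mul_add_one (m l : ℕ) :
    stepChar m (2 * l + 1) = fun t => sgn t * absPow ((m : ℂ) / 2 + l) t := by
  funext t
  rw [stepChar, pow_succ, pow_mul, sq, sgn_mul_self, one_pow, one_mul,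
    show (2 * l + 1) / 2 = l by omega]

/-- The structure of the restriction of `δ(m)` to `GL₁(ℝ)`. -/
theorem delta_filtration (hm : 1 ≤ m) (hε : ε₁ (-1) * ε₂ (-1) = (-1) ^ m) :
    ∃ hX : ∀ t, bottomStep hε ≤ (bottomStep hε).comap
        (((delta (ε₁ := ε₁) (ε₂ := ε₂) hε).toRepresentation.comp embGL1) t),
      IsClosed (bottomStep hε : Set (delta (ε₁ := ε₁) (ε₂ := ε₂) hε).toSubmodule) ∧
      ∃ e : schwartzUnits ≃L[ℂ] bottomStep (ε₁ := ε₁) (ε₂ := ε₂) hε,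
        (∀ (t : ℝˣ) (f : schwartzUnits), e (unitsTranslation t f) =
          Representation.subrepresentation ((delta hε).toRepresentation.comp embGL1) _ hX t (e f)) ∧
        ∃ (F : ℕ → Submodule ℂ ((delta hε).toSubmodule ⧸ bottomStep hε)) (hF : Antitone F)
          (hFinv : ∀ n t, F n ≤ (F n).comap
            (Representation.quotient ((delta hε).toRepresentation.comp embGL1) _ hX t)),
          F 0 = ⊤ ∧
          (∀ n, SubquotientIsoChar
            (Representation.quotient ((delta hε).toRepresentation.comp embGL1) _ hX)
            (F n) (F (n + 1)) (hFinv n) (stepChar m n)) ∧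
          IsHomeomorph (toInverseLimit F hF) := by
  set W := (delta (ε₁ := ε₁) (ε₂ := ε₂) hε).toSubmodule with hW
  set σ : Representation ℂ ℝˣ W := (delta hε).toRepresentation.comp embGL1 with hσ
  let V : ℕ → Submodule ℂ W := fun n => (level hε n).comap W.subtype
  have hVinv : ∀ n t, V n ≤ (V n).comap (σ t) := fun n t v hv => level_embGL1 hv t
  have hXV : bottomStep hε = ⨅ n, V n := Submodule.comap_iInf _ _
  have hX : ∀ t, bottomStep hε ≤ (bottomStep hε).comap (σ t) := fun t v hv => by
    rw [hXV, Submodule.mem_iInf] at hv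
    rw [Submodule.mem_comap, hXV, Submodule.mem_iInf]
    exact fun n => hVinv n t (hv n)
  obtain ⟨e, he⟩ := exists_schwartzUnits_equiv hm hε
  refine ⟨hX, isClosed_bottomStep hm hε, e, fun t f => ?_, ?_⟩
  · refine Subtype.ext (Subtype.ext ?_)
    rw [he, ofSchwartzUnits_unitsTranslation, ← he]
    rfl
  · let ι : ∀ n, V n →ₗ[ℂ] level (ε₁ := ε₁) (ε₂ := ε₂) hε n := fun n =>
      LinearMap.codRestrict _ (W.subtype ∘ₗ (V n).subtype) fun v => v.2
    refine IsFrechet.exists_quotient_filtration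
      ((isFrechet_PS hε).of_isClosed (isClosed_delta hε)) σ V
      (fun a b hab => Submodule.comap_mono (antitone_level hε hab)) ?_
      (fun n => (isClosed_level hm hε n).preimage continuous_subtype_val) hVinv
      (stepChar m) (stepChar_ne_zero m) (fun n => levelCoeff hm hε n ∘ₗ ι n) (fun n => ?_)
      (fun n v => levelCoeff_eq_zero_iff hm hε n (ι n v))
      (fun n t v => levelCoeff_embGL1 hm hε n (ι n v) t)
      (fun N => (psSeminorm N).comp W.subtype) ?_ (fun N => ?_) ?_ ?_ _ hXV hX
    · refine eq_top_iff.2 fun v _ => ?_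
      exact mem_level.2 ⟨v.2, fun j hj => absurd hj (Nat.not_lt_zero j)⟩
    · intro c
      obtain ⟨f, hf⟩ := surjective_levelCoeff (ε₁ := ε₁) (ε₂ := ε₂) hm hε n c
      exact ⟨⟨⟨f.1, level_le_delta hε n f.2⟩, f.2⟩, hf⟩
    · exact fun a b hab v => psSeminorm_mono hab (v : PS m ε₁ ε₂)
    · exact (continuous_psSeminorm N).comp continuous_subtype_val
    · intro U hU
      obtain ⟨U', hU', hsub⟩ := mem_nhds_induced _ _ _ |>.1 hU
      obtain ⟨N, δ, hδ, h⟩ := exists_psSeminorm_lt hU'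
      exact ⟨N, δ, hδ, fun w hw => hsub (h _ hw)⟩
    · intro N
      -- From this index on ⌊n/2⌋ ≥ N + 1, so the character outgrows the N-th seminorm.
      refine ⟨2 * N + 2, fun n hn v δ hδ => ?_⟩
      exact exists_psSeminorm_dilation_lt hε N hn v hδ

end

end DiscreteSeriesFiltration

end

open DiscreteSeriesFiltration in
theorem proposition5p1 (m : ℕ) (hm : 1 ≤ m) (ε₁ ε₂ : ℝˣ →* ℤˣ)
    (hε : ε₁ (-1) * ε₂ (-1) = (-1) ^ m) :
    -- the principal series has a unique irreducible closed subrepresentation `δ(m)`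
    (∃! V : Subrepresentation (rightTranslation ε₁ ε₂ (((m : ℂ) - 1) / 2) ((1 - (m : ℂ)) / 2)),
      IsIrreducibleSub V) ∧
    -- and this `V = δ(m)`, restricted to `GL₁(ℝ)`, is filtered as follows
    ∀ V : Subrepresentation (rightTranslation ε₁ ε₂ (((m : ℂ) - 1) / 2) ((1 - (m : ℂ)) / 2)),
      IsIrreducibleSub V →
      ∃ (X : Submodule ℂ V.toSubmodule)
        (hX : ∀ t, X ≤ X.comap ((V.toRepresentation.comp embGL1) t)),
        IsClosed (X : Set V.toSubmodule) ∧
        -- the bottom piece `X` is `𝓢(ℝˣ)` with the translation action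
        (∃ e : schwartzUnits ≃L[ℂ] X, ∀ (t : ℝˣ) (f : schwartzUnits),
          e (unitsTranslation t f) =
            Representation.subrepresentation (V.toRepresentation.comp embGL1) X hX t (e f)) ∧
        -- the top quotient `Y = V / X`
        ∃ (F : ℕ → Submodule ℂ (V.toSubmodule ⧸ X)) (hF : Antitone F)
          (hFinv : ∀ n t, F n ≤ (F n).comap
            (Representation.quotient (V.toRepresentation.comp embGL1) X hX t)),
          F 0 = ⊤ ∧
          (∀ l : ℕ, SubquotientIsoChar
            (Representation.quotient (V.toRepresentation.comp embGL1) X hX)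
            (F (2 * l)) (F (2 * l + 1)) (hFinv (2 * l))
            (fun t => absPow ((m : ℂ) / 2 + l) t)) ∧
          (∀ l : ℕ, SubquotientIsoChar
            (Representation.quotient (V.toRepresentation.comp embGL1) X hX)
            (F (2 * l + 1)) (F (2 * l + 2)) (hFinv (2 * l + 1))
            (fun t => sgn t * absPow ((m : ℂ) / 2 + l) t)) ∧
          IsHomeomorph (toInverseLimit F hF) := by
  refine ⟨⟨delta hε, isIrreducibleSub_delta hm hε, fun V hV =>
    eq_delta_of_isIrreducibleSub hm hε hV⟩, fun V hV => ?_⟩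
  obtain rfl := eq_delta_of_isIrreducibleSub hm hε hV
  obtain ⟨hX, hcl, e, he, F, hF, hFinv, h0, hχ, hlim⟩ :=
    delta_filtration (ε₁ := ε₁) (ε₂ := ε₂) hm hε
  refine ⟨_, hX, hcl, ⟨e, he⟩, F, hF, hFinv, h0, fun l => ?_, fun l => ?_, hlim⟩
  · have h := hχ (2 * l)
    rwa [stepChar_two_mul] at h
  · have h := hχ (2 * l + 1)
    rwa [stepChar_two_mul_add_one] at h
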